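/- **Setting.** Let $k\in\mathbb N$, let $f_X$ be a probability density on $\mathbb R^k$, $m_1,m_2:\mathbb R^k\to\mathbb R$, $\lambda\in(0,1]$, and let $F_1,F_2$ be probability distributions on $\mathbb R$. Let $(X_p,Z_p)_{p\ge1}$ be i.i.d. with values in $\mathbb R^k\times\mathbb R$, where $X_p$ has density $f_X$ and, conditionally on $X_p=x$, $Z_p$ has the two-component mixture law: $Z_p=m_1(x)+\epsilon_1$ with probability $\lambda$ and $Z_p=m_2(x)+\epsilon_2$ with probability $1-\lambda$, where $\epsilon_l\sim F_l$ for every $x$. Fix $x_0,x_1\in\mathbb R^k$ and put $\Delta=m_1(x_1)-m_1(x_0)$, $\nabla=m_2(x_1)-m_2(x_0)$, $M_l(t)=\int e^{t\epsilon}dF_l(\epsilon)$, $\phi_l(s)=\int e^{is\epsilon}dF_l(\epsilon)$. For a kernel $K:\mathbb R^k\to\mathbb R$, bandwidths $h_n,b_n$ and tuning parameters $t_n,s_n,a_n$ let, for $j=0,1$, $$\hat M^j(t)=\frac{\sum_{p=1}^n e^{tZ_p}K(\frac{X_p-x_j}{h_n})}{\sum_{p=1}^n K(\frac{X_p-x_j}{h_n})},\qquad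 \hat\phi^j(s)=\frac{\sum_{p=1}^n e^{isZ_p}K(\frac{X_p-x_j}{b_n})}{\sum_{p=1}^n K(\frac{X_p-x_j}{b_n})},$$ $$\hat\Delta=\frac1{t_n}\log\frac{\hat M^1(t_n)}{\hat M^0(t_n)},\qquad \hat\nabla=\frac{-i}{a_n}\,\mathrm{Log}\left(\frac{\hat\phi^1(s_n+a_n)}{\hat\phi^0(s_n+a_n)}\Big(\frac{\hat\phi^1(s_n)}{\hat\phi^0(s_n)}\Big)^{-1}\right),$$ with $\mathrm{Log}$ the principal logarithm. $Y_n=O_{\mathbb P}(r_n)$ means: for every $\varepsilon>0$ there is $C$ with $\mathbb P(|Y_n|>C|r_n|)\le\varepsilon$ for all large $n$. **Assumptions.** 1. $\int|K|<\infty$, $\int K=1$, $UK(U)\to0$ as $\|U\|\to\infty$, $\int K^2<\infty$, $\int|K(U)|\,\|U\|^2dU<\infty$, $\int K(U)U\,dU=0$, and there is $\alpha_0>0$ with $\int e^{\alpha\|U\|}|K(U)|\,\|U\|^2dU<\infty$ and $\int e^{\alpha\|U\|}K(U)^2dU<\infty$ for all $\alpha\le\alpha_0$. 2. $f_X,m_1,m_2$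 have continuous second order partial derivatives; $f_X$ and all first and second order partial derivatives of $f_X,m_1,m_2$ are bounded on $\mathbb R^k$; $f_X(x_0),f_X(x_1)>0$. 3. $h_n,b_n>0$ for all large $n$, $h_n\to0$, $nh_n^k\to\infty$, $b_n\to0$, $nb_n^k\to\infty$, $t_n\to\infty$, $t_nh_n\to0$, $s_n\to\infty$, $s_nb_n\to0$. 4. $M_1,M_2$ are finite on $[0,\infty)$. The functions $\mu,f\ge0$ satisfy $\mu(t)\to0$ and $f(s)\to0$ at $+\infty$; for every $\epsilon>0$, $e^{\epsilon t}M_2(t)/M_1(t)=O(\mu(t))$ as $t\to\infty$; $\phi_2(s)\ne0$ for all large $s$, and $\phi_1(s)/\phi_2(s)=O(f(s))$ as $s\to\infty$. **Proposition.** Assume 1 and 2. (A) Assume 3 and 4, $a_n\to0$, and $a_n\neq0$ for all large $n$. Then (i) if $\frac1{nh_n^k}\frac{M_1(2t_n)}{M_1(t_n)^2}\to0$, $$\hat\Delta-\Delta=O_{\mathbb P}\left[\frac{\mu(t_n)}{t_n}+\frac1{t_n}\Big((t_nh_n)^4+\frac1{nh_n^k}\frac{M_1(2t_n)}{M_1(t_n)^2}\Big)^{1/2}\right];$$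 (ii) if $\lambda<1$, $\hat\nabla-\nabla$ is $$\frac1{|a_n|}\,O_{\mathbb P}\left[f(s_n+a_n)+f(s_n)+\Big((b_ns_n)^4+\frac1{nb_n^k|\phi_2(s_n+a_n)|^2}\Big)^{1/2}+\Big((b_ns_n)^4+\frac1{nb_n^k|\phi_2(s_n)|^2}\Big)^{1/2}\right].$$ (B) Let $F_l=\mathcal N(0,\sigma_l^2)$, $l=1,2$, with $0<\sigma_2<\sigma_1$, and $\delta=\sigma_1^2-\sigma_2^2$. For every $0<\nu<\delta/2$, assumption 4 holds with $\mu(t)=e^{-(\delta/2-\nu)t^2}$ and $f(s)=e^{-\delta s^2/2}$. Moreover, under assumption 3: if $\frac1{nh_n^k}e^{\sigma_1^2t_n^2}\to0$, then $$\hat\Delta-\Delta=\frac1{t_n}O_{\mathbb P}\left[e^{-(\delta/2-\nu)t_n^2}+\Big((t_nh_n)^4+\frac1{nh_n^k}e^{\sigma_1^2t_n^2}\Big)^{1/2}\right];$$ and if $\lambda<1$ and $a_n=a$ is a fixed number with $a>0$ and $a|\nabla|<\pi$, then $$\hat\nabla-\nabla=O_{\mathbb P}\left[e^{-\delta s_n^2/2}+\Big((b_ns_n)^4+\frac1{nb_n^k}e^{\sigma_2^2(s_n+a)^2}\Big)^{1/2}\right].$$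 (C) In the setting of (B) let $k=1$ and $\varepsilon,\beta\in(0,\frac15)$. With $h_n=n^{-1/5+\varepsilon}$ and $t_n=\sigma_1^{-1}(\varepsilon\log n)^{1/2}$, there is $\gamma>0$ with $\hat\Delta-\Delta=O_{\mathbb P}(n^{-\gamma})$. With $b_n=n^{-1/5+\beta}$, $s_n=\sigma_2^{-1}(\beta\log n)^{1/2}$, $\lambda<1$ and $a_n=a$ fixed with $a>0$ and $a|\nabla|<\pi$, there is $\gamma>0$ with $\hat\nabla-\nabla=O_{\mathbb P}(n^{-\gamma})$. -/

import Mathlib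

open MeasureTheory ProbabilityTheory Filter Topology Asymptotics

noncomputable section

/-- Stochastic boundedness `Y n = O_ℙ(r n)`: for every `ε > 0` there is a constant `C` such that
`P (‖Y n‖ > C |r n|) ≤ ε` for all large `n`. -/
def IsBigOP {Ω E : Type*} [MeasurableSpace Ω] [Norm E] (P : Measure Ω)
    (Y : ℕ → Ω → E) (r : ℕ → ℝ) : Prop :=
  ∀ ε : ℝ, 0 < ε → ∃ C : ℝ, 0 < C ∧
    ∀ᶠ n in atTop, P {ω | C * |r n| < ‖Y n ω‖} ≤ ENNReal.ofReal ε

/-- The conditional law of `Z` given `X = x` in the two-component mixture regression: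
`m₁ x + ε₁` with probability `lam` and `m₂ x + ε₂` with probability `1 - lam`,
where `ε₁ ∼ F₁`, `ε₂ ∼ F₂` whatever the value of `x`. -/
def mixtureCondLaw {k : ℕ} (lam : ℝ) (m₁ m₂ : EuclideanSpace ℝ (Fin k) → ℝ) (F₁ F₂ : Measure ℝ)
    (x : EuclideanSpace ℝ (Fin k)) : Measure ℝ :=
  ENNReal.ofReal lam • F₁.map (fun e => m₁ x + e) +
    ENNReal.ofReal (1 - lam) • F₂.map (fun e => m₂ x + e)

/-- `(X p, Z p)`, `p = 0, 1, …`, is an i.i.d. sample; `X p` has Lebesgue density `fX`, and the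
conditional law of `Z p` given `X p = x` is `mixtureCondLaw lam m₁ m₂ F₁ F₂ x`. -/
structure IsMixtureSample {Ω : Type*} [MeasurableSpace Ω] {k : ℕ} (P : Measure Ω)
    (X : ℕ → Ω → EuclideanSpace ℝ (Fin k)) (Z : ℕ → Ω → ℝ)
    (fX : EuclideanSpace ℝ (Fin k) → ℝ) (lam : ℝ) (m₁ m₂ : EuclideanSpace ℝ (Fin k) → ℝ)
    (F₁ F₂ : Measure ℝ) : Prop where
  measurable_X : ∀ p, Measurable (X p)
  measurable_Z : ∀ p, Measurable (Z p)
  indep : iIndepFun (fun p ω => (X p ω, Z p ω)) P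
  density_nonneg : ∀ x, 0 ≤ fX x
  law_X : ∀ p, P.map (X p) = volume.withDensity (fun x => ENNReal.ofReal (fX x))
  cond_law_Z : ∀ (p : ℕ) (A : Set (EuclideanSpace ℝ (Fin k))) (B : Set ℝ),
    MeasurableSet A → MeasurableSet B →
      P (X p ⁻¹' A ∩ Z p ⁻¹' B) =
        ∫⁻ x in A, mixtureCondLaw lam m₁ m₂ F₁ F₂ x B ∂(P.map (X p))

/-- The conditions on the kernel function. -/
structure IsRegularKernel {k : ℕ} (K : EuclideanSpace ℝ (Fin k) → ℝ) : Prop where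
  integrable : Integrable K
  integral_eq_one : ∫ U, K U = 1
  tendsto_zero : Tendsto (fun U => K U • U) (cocompact (EuclideanSpace ℝ (Fin k))) (𝓝 0)
  integrable_sq : Integrable (fun U => K U ^ 2)
  integrable_second_moment : Integrable (fun U => |K U| * ‖U‖ ^ 2)
  first_moment : ∫ U, K U • U = 0
  exp_moment : ∃ α₀ : ℝ, 0 < α₀ ∧ ∀ α : ℝ, α ≤ α₀ →
    Integrable (fun U => Real.exp (α * ‖U‖) * |K U| * ‖U‖ ^ 2) ∧
    Integrable (fun U => Real.exp (α * ‖U‖) * K U ^ 2)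

/-- `g` has continuous partial derivatives up to order two, and those of order one and two
are bounded on `ℝᵏ`. -/
def HasBoundedPartials {k : ℕ} (g : EuclideanSpace ℝ (Fin k) → ℝ) : Prop :=
  ContDiff ℝ 2 g ∧ (∃ C : ℝ, ∀ x, ‖fderiv ℝ g x‖ ≤ C) ∧
    (∃ C : ℝ, ∀ x, ‖iteratedFDeriv ℝ 2 g x‖ ≤ C)

/-- The conditions on the covariate density and on the two regression functions. -/
structure RegularModel {k : ℕ} (fX m₁ m₂ : EuclideanSpace ℝ (Fin k) → ℝ)
    (x₀ x₁ : EuclideanSpace ℝ (Fin k)) : Prop where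
  density_bounded : ∃ C : ℝ, ∀ x, |fX x| ≤ C
  density_partials : HasBoundedPartials fX
  density_pos₀ : 0 < fX x₀
  density_pos₁ : 0 < fX x₁
  partials₁ : HasBoundedPartials m₁
  partials₂ : HasBoundedPartials m₂

/-- The conditions on the bandwidths `h`, `b` and the frequencies `t`, `s`. -/
structure TuningConditions (k : ℕ) (h b t s : ℕ → ℝ) : Prop where
  h_pos : ∀ᶠ n in atTop, 0 < h n
  b_pos : ∀ᶠ n in atTop, 0 < b n
  h_zero : Tendsto h atTop (𝓝 0)
  nh_top : Tendsto (fun n : ℕ => (n : ℝ) * h n ^ k) atTop atTop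
  b_zero : Tendsto b atTop (𝓝 0)
  nb_top : Tendsto (fun n : ℕ => (n : ℝ) * b n ^ k) atTop atTop
  t_top : Tendsto t atTop atTop
  th_zero : Tendsto (fun n => t n * h n) atTop (𝓝 0)
  s_top : Tendsto s atTop atTop
  sb_zero : Tendsto (fun n => s n * b n) atTop (𝓝 0)

/-- The conditions on the error distributions: `mgf id F` is the moment generating function of `F`
and `charFun F` its characteristic function. The ratio of characteristic functions is
meant to be defined, so `charFun F₂` does not vanish at large arguments. -/
structure RatioRates (F₁ F₂ : Measure ℝ) (μ f : ℝ → ℝ) : Prop where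
  mgf_domain₁ : ∀ t : ℝ, 0 ≤ t → Integrable (fun e => Real.exp (t * e)) F₁
  mgf_domain₂ : ∀ t : ℝ, 0 ≤ t → Integrable (fun e => Real.exp (t * e)) F₂
  μ_nonneg : ∀ t, 0 ≤ μ t
  μ_zero : Tendsto μ atTop (𝓝 0)
  mgf_ratio : ∀ ε : ℝ, 0 < ε →
    (fun t => Real.exp (ε * t) * (mgf id F₂ t / mgf id F₁ t)) =O[atTop] μ
  f_nonneg : ∀ s, 0 ≤ f s
  f_zero : Tendsto f atTop (𝓝 0)
  cf_ne_zero : ∀ᶠ s : ℝ in atTop, charFun F₂ s ≠ 0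
  cf_ratio : (fun s : ℝ => charFun F₁ s / charFun F₂ s) =O[atTop] f

section Estimators

variable {Ω : Type*} {k : ℕ} (K : EuclideanSpace ℝ (Fin k) → ℝ)
  (X : ℕ → Ω → EuclideanSpace ℝ (Fin k)) (Z : ℕ → Ω → ℝ)

/-- Nadaraya–Watson estimator, from the first `n` observations with bandwidth `h`, of the
conditional moment generating function `E[exp (t Z) | X = x]`. -/
def mgfHat (n : ℕ) (h : ℝ) (x : EuclideanSpace ℝ (Fin k)) (t : ℝ) (ω : Ω) : ℝ :=
  (∑ p ∈ Finset.range n, Real.exp (t * Z p ω) * K (h⁻¹ • (X p ω - x))) /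
    (∑ p ∈ Finset.range n, K (h⁻¹ • (X p ω - x)))

/-- Nadaraya–Watson estimator, from the first `n` observations with bandwidth `b`, of the
conditional characteristic function `E[exp (i s Z) | X = x]`. -/
def cfHat (n : ℕ) (b : ℝ) (x : EuclideanSpace ℝ (Fin k)) (s : ℝ) (ω : Ω) : ℂ :=
  (∑ p ∈ Finset.range n,
      Complex.exp (Complex.I * (s : ℂ) * (Z p ω : ℂ)) * (K (b⁻¹ • (X p ω - x)) : ℂ)) /
    (∑ p ∈ Finset.range n, (K (b⁻¹ • (X p ω - x)) : ℂ))

/-- The estimator of the slope `m₁ x₁ - m₁ x₀`. -/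
def slopeHat₁ (x₀ x₁ : EuclideanSpace ℝ (Fin k)) (n : ℕ) (h t : ℝ) (ω : Ω) : ℝ :=
  1 / t * Real.log (mgfHat K X Z n h x₁ t ω / mgfHat K X Z n h x₀ t ω)

/-- The (complex-valued) estimator of the slope `m₂ x₁ - m₂ x₀`; `Complex.log` is the principal
value of the logarithm. -/
def slopeHat₂ (x₀ x₁ : EuclideanSpace ℝ (Fin k)) (n : ℕ) (b s a : ℝ) (ω : Ω) : ℂ :=
  -Complex.I / (a : ℂ) *
    Complex.log (cfHat K X Z n b x₁ (s + a) ω / cfHat K X Z n b x₀ (s + a) ω *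
      (cfHat K X Z n b x₁ s ω / cfHat K X Z n b x₀ s ω)⁻¹)

end Estimators

end

/-! Every estimator is built from the kernel sums S(z) = (n hᵏ)⁻¹ ∑ exp(z Zₚ) K((Xₚ - x)/h), with z
= t real, z = is imaginary, or z = 0 for the density estimator. They are treated together, for
complex z.

Mean. After the change of variables y = x + hU the mean of S(z) is a mixture of integrals of K(U)
fX(x + hU) exp(z mⱼ(x + hU)), each multiplied by the transform of Fⱼ at z. Taylor expansion at x
leaves fX(x) exp(z mⱼ(x)): the linear terms vanish because K has zero first moment, and the
remainder is of relative order ((1 + |z|)h)², its exponential growth being absorbed by the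
exponential moments of K as soon as |z|h is small. If one component dominates, the other contributes
relatively at most the ratio of the two transforms, that is μ(t) or f(s).

Fluctuation. The squared modulus of a summand is again of the same kind, with kernel K² and
frequency 2 Re z, so independence and Chebyshev give a relative variance M(2 Re z) / (n hᵏ |M(z)|²),
where M is the transform of the dominating component. Together this is
`MixtureSetup.isBigOP_kernelSum_div_sub_one`. The components are interchangeable
(`MixtureSetup.swap`), so one argument serves both slopes.

In the ratio of the sums at x₁ and x₀ the error transforms and the mixture weight cancel. What
remains is exp(tΔ), resp. exp(ia∇) for the double ratio, times relative errors. For `slopeHat₁` the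
rate tends to zero and the logarithm is Lipschitz near 1.

For `slopeHat₂` no such smallness is assumed, and this is the delicate point. Where the rate is
small, the principal logarithm is linearised; |a∇| bounded away from π excludes a jump of branch.
Where it is not small, it suffices that the logarithm be O_ℙ(1). Its imaginary part is at most π,
but its real part is large whenever one of the four sums is close to zero.
`MixtureSetup.isBigOP_log_norm_kernelSum` excludes this: the log-modulus of each sum is tight after
subtracting log max(σ, |φ|), with σ = (n bᵏ)^(-1/2), and this centring is the same at x₀ and x₁. If
|φ| is well above σ, the mean dominates. Otherwise the sum is of pure noise size and must not
concentrate at 0 on the scale σ, which follows from a Lindeberg-type bound on characteristic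
functions and Gaussian smoothing (`exists_measure_abs_sum_le`).

The kernel is only almost everywhere equal to a measurable one; since X has a density, the
estimators change only on a null set. The normal case and the polynomial rates are explicit
computations. -/

set_option linter.unusedSectionVars false

noncomputable section

/-! ### Joint law of an observation and its localised integrals -/

section JointLaw

variable {Ω : Type*} [MeasurableSpace Ω] {k : ℕ} {P : Measure Ω} [IsProbabilityMeasure P]
  {X : ℕ → Ω → EuclideanSpace ℝ (Fin k)} {Z : ℕ → Ω → ℝ}
  {fX m₁ m₂ : EuclideanSpace ℝ (Fin k) → ℝ} {lam : ℝ} {F₁ F₂ : Measure ℝ}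
  [IsProbabilityMeasure F₁] [IsProbabilityMeasure F₂]

/-- The roles of the two mixture components can be exchanged. -/
theorem IsMixtureSample.swap (hs : IsMixtureSample P X Z fX lam m₁ m₂ F₁ F₂) :
    IsMixtureSample P X Z fX (1 - lam) m₂ m₁ F₂ F₁ where
  measurable_X := hs.measurable_X
  measurable_Z := hs.measurable_Z
  indep := hs.indep
  density_nonneg := hs.density_nonneg
  law_X := hs.law_X
  cond_law_Z p A B hA hB := by
    rw [hs.cond_law_Z p A B hA hB]
    simp only [mixtureCondLaw, sub_sub_cancel, add_comm]

/-- The joint law of `(X p, Z p)` is a mixture of two images of product measures. -/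
theorem IsMixtureSample.law_pair (hs : IsMixtureSample P X Z fX lam m₁ m₂ F₁ F₂)
    (hm₁ : Measurable m₁) (hm₂ : Measurable m₂) (p : ℕ) :
    P.map (fun ω => (X p ω, Z p ω)) =
      ENNReal.ofReal lam • ((P.map (X p)).prod F₁).map (fun q => (q.1, m₁ q.1 + q.2)) +
      ENNReal.ofReal (1 - lam) • ((P.map (X p)).prod F₂).map (fun q => (q.1, m₂ q.1 + q.2)) := by
  have hX := hs.measurable_X p
  have hZ := hs.measurable_Z p
  have : IsProbabilityMeasure (P.map (X p)) := Measure.isProbabilityMeasure_map hX.aemeasurable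
  have key : ∀ (m : EuclideanSpace ℝ (Fin k) → ℝ) (F : Measure ℝ) [IsProbabilityMeasure F],
      Measurable m → ∀ (A : Set (EuclideanSpace ℝ (Fin k))) (B : Set ℝ), MeasurableSet A →
      MeasurableSet B → ((P.map (X p)).prod F).map (fun q => (q.1, m q.1 + q.2)) (A ×ˢ B) =
        ∫⁻ x in A, F.map (fun e => m x + e) B ∂(P.map (X p)) ∧
      Measurable (fun x => F.map (fun e => m x + e) B) := by
    intro m F _ hm A B hA hB
    have hT : Measurable (fun q : EuclideanSpace ℝ (Fin k) × ℝ => (q.1, m q.1 + q.2)) := by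
      fun_prop
    have hT2 : Measurable (fun q : EuclideanSpace ℝ (Fin k) × ℝ => m q.1 + q.2) := by
      fun_prop
    have hmap : ∀ x, F.map (fun e => m x + e) B =
        F (Prod.mk x ⁻¹' ((fun q : EuclideanSpace ℝ (Fin k) × ℝ => m q.1 + q.2) ⁻¹' B)) := by
      intro x
      rw [Measure.map_apply (by fun_prop) hB]
      rfl
    refine ⟨?_, ?_⟩
    · rw [Measure.map_apply hT (hA.prod hB), Measure.prod_apply (hT (hA.prod hB)),
        ← lintegral_indicator hA]
      refine lintegral_congr fun x => ?_
      by_cases hx : x ∈ A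
      · rw [Set.indicator_of_mem hx, hmap]
        congr 1
        ext e
        simp [hx]
      · rw [Set.indicator_of_notMem hx]
        convert measure_empty (μ := F)
        ext e
        simp [hx]
    · simp_rw [hmap]
      exact measurable_measure_prodMk_left (hT2 hB)
  have : IsProbabilityMeasure (P.map (fun ω => (X p ω, Z p ω))) :=
    Measure.isProbabilityMeasure_map (hX.prodMk hZ).aemeasurable
  refine Measure.ext_prod fun {A B} hA hB => ?_
  rw [Measure.map_apply (hX.prodMk hZ) (hA.prod hB)]
  have h1 := hs.cond_law_Z p A B hA hB
  have h2 : (fun ω => (X p ω, Z p ω)) ⁻¹' A ×ˢ B = X p ⁻¹' A ∩ Z p ⁻¹' B := by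
    ext; simp
  obtain ⟨e1, M1⟩ := key m₁ F₁ hm₁ A B hA hB
  obtain ⟨e2, M2⟩ := key m₂ F₂ hm₂ A B hA hB
  rw [h2, h1]
  simp only [mixtureCondLaw, Measure.add_apply, Measure.smul_apply, smul_eq_mul, e1, e2]
  rw [lintegral_add_left (M1.const_mul _), lintegral_const_mul _ M1, lintegral_const_mul _ M2]

/-- Integrability and expectation of `G (X p) exp (z Z p)` for the mixture model. -/
theorem IsMixtureSample.integral_cexp_mul (hs : IsMixtureSample P X Z fX lam m₁ m₂ F₁ F₂)
    (hm₁ : Measurable m₁) (hm₂ : Measurable m₂) (hlam₀ : 0 ≤ lam) (hlam₁ : lam ≤ 1) (p : ℕ)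
    {G : EuclideanSpace ℝ (Fin k) → ℂ} (hG : Measurable G) {z : ℂ}
    (hF₁ : Integrable (fun e => Real.exp (z.re * e)) F₁)
    (hF₂ : Integrable (fun e => Real.exp (z.re * e)) F₂)
    (hG₁ : Integrable (fun y => G y * Complex.exp (z * m₁ y)) (P.map (X p)))
    (hG₂ : Integrable (fun y => G y * Complex.exp (z * m₂ y)) (P.map (X p))) :
    Integrable (fun ω => Complex.exp (z * Z p ω) * G (X p ω)) P ∧
    ∫ ω, Complex.exp (z * Z p ω) * G (X p ω) ∂P =
      lam * (complexMGF id F₁ z * ∫ y, G y * Complex.exp (z * m₁ y) ∂(P.map (X p))) +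
      (1 - lam) * (complexMGF id F₂ z * ∫ y, G y * Complex.exp (z * m₂ y) ∂(P.map (X p))) := by
  have hX := hs.measurable_X p
  have hZ := hs.measurable_Z p
  have : IsProbabilityMeasure (P.map (X p)) := Measure.isProbabilityMeasure_map hX.aemeasurable
  set g : EuclideanSpace ℝ (Fin k) × ℝ → ℂ := fun q => Complex.exp (z * q.2) * G q.1 with hg
  have hgm : Measurable g := by fun_prop
  have hpair : Measurable (fun ω => (X p ω, Z p ω)) := hX.prodMk hZ
  have key : ∀ (m : EuclideanSpace ℝ (Fin k) → ℝ) (F : Measure ℝ) [IsProbabilityMeasure F],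
      Measurable m → Integrable (fun e => Real.exp (z.re * e)) F →
      Integrable (fun y => G y * Complex.exp (z * m y)) (P.map (X p)) →
      Integrable g (((P.map (X p)).prod F).map (fun q => (q.1, m q.1 + q.2))) ∧
      ∫ q, g q ∂(((P.map (X p)).prod F).map (fun q => (q.1, m q.1 + q.2))) =
        complexMGF id F z * ∫ y, G y * Complex.exp (z * m y) ∂(P.map (X p)) := by
    intro m F _ hm hF hGm
    have hT : Measurable (fun q : EuclideanSpace ℝ (Fin k) × ℝ => (q.1, m q.1 + q.2)) := by
      fun_prop
    have hFc : Integrable (fun e : ℝ => Complex.exp (z * e)) F := by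
      refine hF.mono' (by fun_prop) (Eventually.of_forall fun e => ?_)
      rw [Complex.norm_exp]
      simp
    have hcomp : (g ∘ fun q : EuclideanSpace ℝ (Fin k) × ℝ => (q.1, m q.1 + q.2)) =
        fun q => (G q.1 * Complex.exp (z * m q.1)) * Complex.exp (z * q.2) := by
      funext q
      simp only [hg, Function.comp, Complex.ofReal_add, mul_add, Complex.exp_add]
      ring
    refine ⟨?_, ?_⟩
    · rw [integrable_map_measure hgm.aestronglyMeasurable hT.aemeasurable, hcomp]
      exact hGm.mul_prod hFc
    · rw [integral_map hT.aemeasurable hgm.aestronglyMeasurable]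
      have := integral_prod_mul (μ := P.map (X p)) (ν := F)
        (fun y => G y * Complex.exp (z * m y)) (fun e : ℝ => Complex.exp (z * e))
      rw [show (fun q : EuclideanSpace ℝ (Fin k) × ℝ => g (q.1, m q.1 + q.2)) = _ from hcomp, this,
        mul_comm]
      simp [complexMGF]
  obtain ⟨i1, e1⟩ := key m₁ F₁ hm₁ hF₁ hG₁
  obtain ⟨i2, e2⟩ := key m₂ F₂ hm₂ hF₂ hG₂
  have i1' := i1.smul_measure (c := ENNReal.ofReal lam) ENNReal.ofReal_ne_top
  have i2' := i2.smul_measure (c := ENNReal.ofReal (1 - lam)) ENNReal.ofReal_ne_top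
  have hlaw := hs.law_pair hm₁ hm₂ p
  refine ⟨?_, ?_⟩
  · have := i1'.add_measure i2'
    rw [← hlaw, integrable_map_measure hgm.aestronglyMeasurable hpair.aemeasurable] at this
    exact this
  · have : ∫ ω, g (X p ω, Z p ω) ∂P = ∫ q, g q ∂(P.map (fun ω => (X p ω, Z p ω))) :=
      (integral_map hpair.aemeasurable hgm.aestronglyMeasurable).symm
    rw [show (∫ ω, Complex.exp (z * Z p ω) * G (X p ω) ∂P) = _ from this, hlaw,
      integral_add_measure i1' i2', integral_smul_measure, integral_smul_measure, e1, e2,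
      ENNReal.toReal_ofReal hlam₀, ENNReal.toReal_ofReal (by linarith)]
    simp

/-- Integrals against the law of the covariates, localised at `x` with bandwidth `h`. -/
theorem IsMixtureSample.integral_localised (hs : IsMixtureSample P X Z fX lam m₁ m₂ F₁ F₂)
    (hf : Measurable fX) (p : ℕ) (x : EuclideanSpace ℝ (Fin k)) {h : ℝ} (hh : 0 < h)
    (L : EuclideanSpace ℝ (Fin k) → ℝ) (g : EuclideanSpace ℝ (Fin k) → ℂ) :
    (Integrable (fun U => (L U * fX (x + h • U) : ℂ) * g (x + h • U)) →
      Integrable (fun y => (L (h⁻¹ • (y - x)) : ℂ) * g y) (P.map (X p))) ∧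
    ∫ y, (L (h⁻¹ • (y - x)) : ℂ) * g y ∂(P.map (X p)) =
      h ^ k * ∫ U, (L U * fX (x + h • U) : ℂ) * g (x + h • U) := by
  have hcong : ∀ y, (ENNReal.ofReal (fX y)).toReal • ((L (h⁻¹ • (y - x)) : ℂ) * g y) =
      (fun U => (L U * fX (x + h • U) : ℂ) * g (x + h • U)) (h⁻¹ • (y - x)) := by
    intro y
    rw [ENNReal.toReal_ofReal (hs.density_nonneg y)]
    simp only [smul_smul, mul_inv_cancel₀ hh.ne', one_smul, add_sub_cancel, Complex.real_smul]
    ring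
  have hfm : Measurable (fun y => ENNReal.ofReal (fX y)) := by fun_prop
  have hlt : ∀ᵐ y ∂(volume : Measure (EuclideanSpace ℝ (Fin k))), ENNReal.ofReal (fX y) < ⊤ :=
    Eventually.of_forall fun y => ENNReal.ofReal_lt_top
  refine ⟨fun hi => ?_, ?_⟩
  · rw [hs.law_X p, integrable_withDensity_iff_integrable_smul' hfm hlt]
    simp_rw [hcong]
    exact (hi.comp_smul (inv_ne_zero hh.ne')).comp_sub_right x
  · rw [hs.law_X p, integral_withDensity_eq_integral_toReal_smul hfm hlt]
    simp_rw [hcong]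
    rw [integral_sub_right_eq_self
      (fun y => (fun U => (L U * fX (x + h • U) : ℂ) * g (x + h • U)) (h⁻¹ • y)) x,
      Measure.integral_comp_inv_smul_of_nonneg volume
        (fun U => (L U * fX (x + h • U) : ℂ) * g (x + h • U)) hh.le]
    simp

end JointLaw

end

/-! ### Taylor bounds, measurable kernels and the second order bias -/

noncomputable section

/-- First order Taylor bounds for `g` at `x`, with constant `C` and differential `g'`. -/
structure HasTaylorBound {E : Type*} [NormedAddCommGroup E] [NormedSpace ℝ E] (g : E → ℝ)
    (g' : E →L[ℝ] ℝ) (x : E) (C : ℝ) : Prop where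
  abs_sub_le : ∀ u, |g (x + u) - g x| ≤ C * ‖u‖
  abs_sub_sub_le : ∀ u, |g (x + u) - g x - g' u| ≤ C * ‖u‖ ^ 2

theorem HasTaylorBound.mono {E : Type*} [NormedAddCommGroup E] [NormedSpace ℝ E] {g : E → ℝ}
    {g' : E →L[ℝ] ℝ} {x : E} {C D : ℝ} (hg : HasTaylorBound g g' x C) (hCD : C ≤ D) :
    HasTaylorBound g g' x D where
  abs_sub_le u := (hg.abs_sub_le u).trans (by gcongr)
  abs_sub_sub_le u := (hg.abs_sub_sub_le u).trans (by gcongr)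

/-- The differential is C₂-Lipschitz, so on the segment from x to x + u it deviates from its value
at x by at most C₂‖u‖; the mean value inequality then gives the quadratic bound. The lost factor 1/2
is immaterial. The constant does not depend on x. -/
theorem HasBoundedPartials.exists_hasTaylorBound {k : ℕ} {g : EuclideanSpace ℝ (Fin k) → ℝ}
    (hg : HasBoundedPartials g) : ∃ C, ∀ x, HasTaylorBound g (fderiv ℝ g x) x C := by
  obtain ⟨hc, ⟨C₁, h₁⟩, ⟨C₂, h₂⟩⟩ := hg
  have hd : Differentiable ℝ g := hc.differentiable (by norm_num)
  have hd' : Differentiable ℝ (fderiv ℝ g) :=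
    (hc.fderiv_right (m := 1) (by norm_num)).differentiable (by norm_num)
  have hn : ∀ x, ‖fderiv ℝ (fderiv ℝ g) x‖ ≤ C₂ := by
    intro x
    have := h₂ x
    rwa [show (2 : ℕ) = 1 + 1 from rfl, ← norm_iteratedFDeriv_fderiv,
      ← zero_add 1, ← norm_iteratedFDeriv_fderiv, norm_iteratedFDeriv_zero] at this
  have hC₂ : 0 ≤ C₂ := (norm_nonneg (fderiv ℝ (fderiv ℝ g) 0)).trans (hn 0)
  refine ⟨max C₁ C₂, fun x => ⟨fun u => ?_, fun u => ?_⟩⟩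
  · have := Convex.norm_image_sub_le_of_norm_fderiv_le (𝕜 := ℝ) (s := Set.univ) (f := g) (C := C₁)
      (fun y _ => hd y) (fun y _ => h₁ y) convex_univ (Set.mem_univ x) (Set.mem_univ (x + u))
    rw [add_sub_cancel_left, Real.norm_eq_abs] at this
    exact this.trans (by gcongr; exact le_max_left _ _)
  · have hlip : ∀ y ∈ segment ℝ x (x + u), ‖fderiv ℝ g y - fderiv ℝ g x‖ ≤ C₂ * ‖u‖ := by
      intro y hy
      have h1 := Convex.norm_image_sub_le_of_norm_fderiv_le (𝕜 := ℝ) (s := Set.univ)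
        (f := fderiv ℝ g) (C := C₂) (fun y _ => hd' y) (fun y _ => hn y) convex_univ
        (Set.mem_univ x) (Set.mem_univ y)
      refine h1.trans ?_
      gcongr
      obtain ⟨θ, ⟨hθ0, hθ1⟩, rfl⟩ := (segment_eq_image' ℝ x (x + u) ▸ hy)
      simp only [add_sub_cancel_left, norm_smul, Real.norm_eq_abs, abs_of_nonneg hθ0]
      exact mul_le_of_le_one_left (norm_nonneg _) hθ1
    have := (convex_segment x (x + u)).norm_image_sub_le_of_norm_fderiv_le' (𝕜 := ℝ) (f := g)
      (φ := fderiv ℝ g x) (C := C₂ * ‖u‖)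
      (fun y _ => hd y) hlip (left_mem_segment ℝ _ _) (right_mem_segment ℝ _ _)
    rw [add_sub_cancel_left, Real.norm_eq_abs] at this
    refine this.trans ?_
    rw [mul_assoc, ← sq]
    gcongr
    exact le_max_right _ _

/-- This controls the integrand of the localised mean after division by exp(z m(x)). The subtracted
part is constant plus linear in u, which the kernel integrates exactly. With u = hU, the factor
exp(C‖z‖‖u‖) is absorbed by the weight exp(α‖U‖) once C‖z‖h ≤ α. -/
theorem norm_mul_cexp_sub_linear_le {E : Type*} [NormedAddCommGroup E] [NormedSpace ℝ E]
    {f m : E → ℝ} {f' m' : E →L[ℝ] ℝ} {x : E} {C : ℝ} (hC : 1 ≤ C) (hfb : ∀ y, |f y| ≤ C)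
    (hf : HasTaylorBound f f' x C) (hm : HasTaylorBound m m' x C) (z : ℂ) (u : E) :
    ‖(f (x + u) : ℂ) * Complex.exp (z * (m (x + u) - m x)) - (f x + f' u + f x * z * m' u)‖ ≤
      C ^ 3 * (1 + ‖z‖) ^ 2 * ‖u‖ ^ 2 * Real.exp (C * ‖z‖ * ‖u‖) := by
  set q : ℂ := (m (x + u) : ℂ) - m x with hq
  set R : ℂ := Complex.exp (z * q) - (1 + z * q) with hR
  set r₁ : ℂ := (f (x + u) : ℂ) - f x - f' u with hr₁
  set r₂ : ℂ := q - m' u with hr₂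
  have bq : ‖q‖ ≤ C * ‖u‖ := by
    rw [hq, ← Complex.ofReal_sub, Complex.norm_real]
    exact hm.abs_sub_le u
  have bf : ‖(f (x + u) : ℂ) - f x‖ ≤ C * ‖u‖ := by
    rw [← Complex.ofReal_sub, Complex.norm_real]
    exact hf.abs_sub_le u
  have b₁ : ‖r₁‖ ≤ C * ‖u‖ ^ 2 := by
    rw [hr₁, ← Complex.ofReal_sub, ← Complex.ofReal_sub, Complex.norm_real]
    exact hf.abs_sub_sub_le u
  have b₂ : ‖r₂‖ ≤ C * ‖u‖ ^ 2 := by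
    rw [hr₂, hq, ← Complex.ofReal_sub, ← Complex.ofReal_sub, Complex.norm_real]
    exact hm.abs_sub_sub_le u
  have bp : ∀ y, ‖(f y : ℂ)‖ ≤ C := fun y => by rw [Complex.norm_real]; exact hfb y
  have bz : ‖z * q‖ ≤ C * ‖z‖ * ‖u‖ := by
    rw [norm_mul]
    calc ‖z‖ * ‖q‖ ≤ ‖z‖ * (C * ‖u‖) := by gcongr
      _ = _ := by ring
  set e := Real.exp (C * ‖z‖ * ‖u‖) with he
  have he1 : 1 ≤ e := Real.one_le_exp (by positivity)
  have bR : ‖R‖ ≤ (C * ‖z‖ * ‖u‖) ^ 2 * e := by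
    have := Complex.norm_exp_sub_sum_le_norm_mul_exp (z * q) 2
    simp only [Finset.sum_range_succ, Finset.sum_range_zero, pow_zero, Nat.factorial_zero,
      Nat.cast_one, div_one, zero_add, pow_one, Nat.factorial_one] at this
    refine this.trans ?_
    have he2 : Real.exp ‖z * q‖ ≤ e := Real.exp_le_exp.2 bz
    gcongr
  -- Errors, in order: second order in f, the cross term of f and m, second order in m, and the tail
  -- of the exponential series.
  have hdec : (f (x + u) : ℂ) * Complex.exp (z * q) - (f x + f' u + f x * z * m' u) =
      r₁ + z * ((f (x + u) - f x) * q + f x * r₂) + f (x + u) * R := by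
    simp only [hR, hr₁, hr₂]; ring
  rw [hdec]
  have hu := norm_nonneg u
  have hz := norm_nonneg z
  calc ‖r₁ + z * (((f (x + u) : ℂ) - f x) * q + f x * r₂) + f (x + u) * R‖
      ≤ ‖r₁‖ + ‖z‖ * (‖(f (x + u) : ℂ) - f x‖ * ‖q‖ + ‖(f x : ℂ)‖ * ‖r₂‖)
          + ‖(f (x + u) : ℂ)‖ * ‖R‖ := by
        refine (norm_add₃_le).trans ?_
        rw [norm_mul, norm_mul]
        gcongr
        refine (norm_add_le _ _).trans ?_
        rw [norm_mul, norm_mul]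
    _ ≤ C * ‖u‖ ^ 2 + ‖z‖ * ((C * ‖u‖) * (C * ‖u‖) + C * (C * ‖u‖ ^ 2))
          + C * ((C * ‖z‖ * ‖u‖) ^ 2 * e) := by
        gcongr <;> apply bp
    _ = (C + 2 * C ^ 2 * ‖z‖) * ‖u‖ ^ 2 * 1 + C ^ 3 * ‖z‖ ^ 2 * ‖u‖ ^ 2 * e := by ring
    _ ≤ (C ^ 3 + 2 * C ^ 3 * ‖z‖) * ‖u‖ ^ 2 * e + C ^ 3 * ‖z‖ ^ 2 * ‖u‖ ^ 2 * e := by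
        have h1 : C ≤ C ^ 3 := le_self_pow₀ hC (by norm_num)
        have h2 : C ^ 2 ≤ C ^ 3 := pow_le_pow_right₀ hC (by norm_num)
        gcongr
    _ = _ := by ring

/-- A measurable kernel satisfying the moment conditions with exponential weight `α`. -/
structure IsMeasurableKernel {k : ℕ} (K : EuclideanSpace ℝ (Fin k) → ℝ) (α : ℝ) : Prop where
  measurable : Measurable K
  pos : 0 < α
  integral_eq_one : ∫ U, K U = 1
  first_moment : ∫ U, K U • U = 0
  exp_abs : Integrable (fun U => Real.exp (α * ‖U‖) * |K U|)
  exp_second : Integrable (fun U => Real.exp (α * ‖U‖) * |K U| * ‖U‖ ^ 2)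
  exp_sq : Integrable (fun U => Real.exp (α * ‖U‖) * K U ^ 2)

/-- A regular kernel agrees almost everywhere with a measurable kernel. -/
theorem IsRegularKernel.exists_isMeasurableKernel {k : ℕ} {K : EuclideanSpace ℝ (Fin k) → ℝ}
    (hK : IsRegularKernel K) : ∃ K' α, K =ᵐ[volume] K' ∧ IsMeasurableKernel K' α := by
  obtain ⟨α, hα, h⟩ := hK.exp_moment
  obtain ⟨h1, h2⟩ := h α le_rfl
  set K' := hK.integrable.aestronglyMeasurable.mk K with hK'
  have hm : Measurable K' := hK.integrable.aestronglyMeasurable.stronglyMeasurable_mk.measurable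
  have hae : K =ᵐ[volume] K' := hK.integrable.aestronglyMeasurable.ae_eq_mk
  have h1' : Integrable (fun U => Real.exp (α * ‖U‖) * |K' U| * ‖U‖ ^ 2) :=
    h1.congr (hae.mono fun U hU => by simp only [hU])
  have h0 : Integrable K' := hK.integrable.congr hae
  refine ⟨K', α, hae, hm, hα, ?_, ?_, ?_, h1', ?_⟩
  · rw [← hK.integral_eq_one]
    exact integral_congr_ae (hae.mono fun U hU => hU.symm)
  · rw [← hK.first_moment]
    exact integral_congr_ae (hae.mono fun U hU => by simp only [hU])
  · refine ((h0.abs.const_mul (Real.exp α)).add h1').mono' (by fun_prop)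
      (Eventually.of_forall fun U => ?_)
    rw [Real.norm_eq_abs, abs_of_nonneg (by positivity), Pi.add_apply]
    -- In the unit ball the weight is at most exp(α); outside it ‖U‖² ≥ 1, so the weighted second
    -- moment takes over.
    rcases le_total ‖U‖ 1 with hU | hU
    · have : Real.exp (α * ‖U‖) ≤ Real.exp α := Real.exp_le_exp.2 (by nlinarith)
      have h3 : 0 ≤ Real.exp (α * ‖U‖) * |K' U| * ‖U‖ ^ 2 := by positivity
      have h4 := mul_le_mul_of_nonneg_right this (abs_nonneg (K' U))
      linarith
    · have : 1 ≤ ‖U‖ ^ 2 := one_le_pow₀ hU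
      have h3 : 0 ≤ Real.exp (α * ‖U‖) * |K' U| := by positivity
      have h4 : 0 ≤ Real.exp α * |K' U| := by positivity
      nlinarith
  · exact h2.congr (hae.mono fun U hU => by simp only [hU])

namespace IsMeasurableKernel

variable {k : ℕ} {K : EuclideanSpace ℝ (Fin k) → ℝ} {α : ℝ}

theorem one_le_exp (hK : IsMeasurableKernel K α) (U : EuclideanSpace ℝ (Fin k)) : 1 ≤ Real.exp (α * ‖U‖) :=
  Real.one_le_exp (mul_nonneg hK.pos.le (norm_nonneg U))

theorem integrable (hK : IsMeasurableKernel K α) : Integrable K := by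
  refine hK.exp_abs.mono' hK.measurable.aestronglyMeasurable (Eventually.of_forall fun U => ?_)
  exact le_mul_of_one_le_left (abs_nonneg _) (hK.one_le_exp U)

theorem integrable_sq (hK : IsMeasurableKernel K α) : Integrable (fun U => K U ^ 2) := by
  refine hK.exp_sq.mono' (hK.measurable.pow_const 2).aestronglyMeasurable
    (Eventually.of_forall fun U => ?_)
  rw [Real.norm_eq_abs, abs_of_nonneg (sq_nonneg _)]
  exact le_mul_of_one_le_left (sq_nonneg _) (hK.one_le_exp U)

/-- Otherwise K would vanish almost everywhere, against ∫ K = 1. This makes the limiting variance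
nondegenerate in the anticoncentration argument. -/
theorem integral_sq_pos (hK : IsMeasurableKernel K α) : 0 < ∫ U, K U ^ 2 := by
  rw [integral_pos_iff_support_of_nonneg (fun U => sq_nonneg _) hK.integrable_sq]
  rw [pos_iff_ne_zero]
  intro h0
  have : K =ᵐ[volume] 0 := by
    rw [EventuallyEq, ae_iff]
    refine measure_mono_null (fun U hU => ?_) h0
    simpa using hU
  have h1 := hK.integral_eq_one
  rw [integral_congr_ae this] at h1
  simp at h1

theorem integrable_smul (hK : IsMeasurableKernel K α) : Integrable (fun U => K U • U) := by
  refine (hK.exp_abs.add hK.exp_second).mono'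
    (hK.measurable.smul measurable_id).aestronglyMeasurable (Eventually.of_forall fun U => ?_)
  rw [norm_smul, Real.norm_eq_abs, Pi.add_apply]
  have h1 := hK.one_le_exp U
  have h2 : ‖U‖ ≤ 1 + ‖U‖ ^ 2 := by nlinarith [sq_nonneg (‖U‖ - 1)]
  have h3 := abs_nonneg (K U)
  calc |K U| * ‖U‖ ≤ |K U| * (1 + ‖U‖ ^ 2) := by gcongr
    _ ≤ Real.exp (α * ‖U‖) * |K U| * (1 + ‖U‖ ^ 2) := by
      gcongr
      exact le_mul_of_one_le_left h3 h1
    _ = _ := by ring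

/-- Removes both first order Taylor terms, of the density and of the regression function, and so
makes the bias quadratic in h. -/
theorem integral_mul_linear (hK : IsMeasurableKernel K α) (ℓ : EuclideanSpace ℝ (Fin k) →L[ℝ] ℝ) :
    Integrable (fun U => (K U : ℂ) * (ℓ U : ℂ)) ∧ ∫ U, (K U : ℂ) * (ℓ U : ℂ) = 0 := by
  have h1 : (fun U => (K U : ℂ) * (ℓ U : ℂ)) = fun U => ((ℓ (K U • U) : ℝ) : ℂ) := by
    funext U; simp
  have h2 := ContinuousLinearMap.integrable_comp ℓ hK.integrable_smul
  rw [h1]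
  refine ⟨h2.ofReal, ?_⟩
  rw [integral_complex_ofReal, ContinuousLinearMap.integral_comp_comm ℓ hK.integrable_smul,
    hK.first_moment]
  simp

end IsMeasurableKernel

/-- Exponentially weighted kernels: integrability and bound of the localised integral. -/
theorem integrable_localised_and_norm_le {k : ℕ} {L : EuclideanSpace ℝ (Fin k) → ℝ} {α : ℝ}
    (hLm : Measurable L) (hL : Integrable (fun U => Real.exp (α * ‖U‖) * |L U|))
    {f m : EuclideanSpace ℝ (Fin k) → ℝ} {x : EuclideanSpace ℝ (Fin k)} {C : ℝ}
    (hfm : Measurable f) (hmm : Measurable m) (hfb : ∀ y, |f y| ≤ C)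
    (hm : ∀ u, |m (x + u) - m x| ≤ C * ‖u‖) {z : ℂ} {h : ℝ} (hh : 0 ≤ h)
    (hz : C * ‖z‖ * h ≤ α) :
    Integrable (fun U => (L U * f (x + h • U) : ℂ) * Complex.exp (z * m (x + h • U))) ∧
    ‖∫ U, (L U * f (x + h • U) : ℂ) * Complex.exp (z * m (x + h • U))‖ ≤
      C * Real.exp (z.re * m x) * ∫ U, Real.exp (α * ‖U‖) * |L U| := by
  have hb : ∀ U, ‖(L U * f (x + h • U) : ℂ) * Complex.exp (z * m (x + h • U))‖ ≤
      C * Real.exp (z.re * m x) * (Real.exp (α * ‖U‖) * |L U|) := by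
    intro U
    have hU := norm_nonneg U
    have hC : 0 ≤ C := (abs_nonneg _).trans (hfb x)
    have h1 : z.re * m (x + h • U) ≤ z.re * m x + α * ‖U‖ := by
      have h2 := hm (h • U)
      rw [norm_smul, Real.norm_eq_abs, abs_of_nonneg hh] at h2
      have h3 : z.re * (m (x + h • U) - m x) ≤ ‖z‖ * (C * (h * ‖U‖)) := by
        refine (le_abs_self _).trans ?_
        rw [abs_mul]
        gcongr
        exact Complex.abs_re_le_norm z
      nlinarith [mul_le_mul_of_nonneg_right hz hU]
    rw [norm_mul, norm_mul, Complex.norm_real, Complex.norm_real, Complex.norm_exp]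
    have h4 : (z * (m (x + h • U) : ℂ)).re = z.re * m (x + h • U) := by simp
    rw [h4, Real.norm_eq_abs, Real.norm_eq_abs]
    calc |L U| * |f (x + h • U)| * Real.exp (z.re * m (x + h • U))
        ≤ |L U| * C * Real.exp (z.re * m x + α * ‖U‖) := by
          gcongr
          exact hfb _
      _ = _ := by rw [Real.exp_add]; ring
  refine ⟨(hL.const_mul _).mono' (by fun_prop) (Eventually.of_forall hb), ?_⟩
  rw [← integral_const_mul]
  exact norm_integral_le_of_norm_le (hL.const_mul _) (Eventually.of_forall hb)

/-- The bias of the localised integral is of second order in the bandwidth. -/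
theorem IsMeasurableKernel.norm_localised_sub_le {k : ℕ} {K : EuclideanSpace ℝ (Fin k) → ℝ} {α : ℝ}
    (hK : IsMeasurableKernel K α)
    {f m : EuclideanSpace ℝ (Fin k) → ℝ} {f' m' : EuclideanSpace ℝ (Fin k) →L[ℝ] ℝ}
    {x : EuclideanSpace ℝ (Fin k)} {C : ℝ} (hC : 1 ≤ C)
    (hfm : Measurable f) (hmm : Measurable m) (hfb : ∀ y, |f y| ≤ C)
    (hf : HasTaylorBound f f' x C) (hm : HasTaylorBound m m' x C) {z : ℂ} {h : ℝ} (hh : 0 ≤ h)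
    (hz : C * ‖z‖ * h ≤ α) :
    ‖(∫ U, (K U * f (x + h • U) : ℂ) * Complex.exp (z * m (x + h • U))) -
        f x * Complex.exp (z * m x)‖ ≤
      Real.exp (z.re * m x) * (C ^ 3 * (∫ U, Real.exp (α * ‖U‖) * |K U| * ‖U‖ ^ 2)) *
        ((1 + ‖z‖) ^ 2 * h ^ 2) := by
  set D : EuclideanSpace ℝ (Fin k) → ℂ := fun U =>
    (f (x + h • U) : ℂ) * Complex.exp (z * (m (x + h • U) - m x)) -
      (f x + f' (h • U) + f x * z * m' (h • U)) with hD
  have hDb : ∀ U, ‖(K U : ℂ) * D U‖ ≤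
      C ^ 3 * ((1 + ‖z‖) ^ 2 * h ^ 2) * (Real.exp (α * ‖U‖) * |K U| * ‖U‖ ^ 2) := by
    intro U
    have h1 := norm_mul_cexp_sub_linear_le hC hfb hf hm z (h • U)
    rw [norm_smul, Real.norm_eq_abs, abs_of_nonneg hh] at h1
    rw [norm_mul, Complex.norm_real, Real.norm_eq_abs]
    have hU := norm_nonneg U
    have h2 : C * ‖z‖ * (h * ‖U‖) ≤ α * ‖U‖ := by nlinarith [mul_le_mul_of_nonneg_right hz hU]
    calc |K U| * ‖D U‖
        ≤ |K U| * (C ^ 3 * (1 + ‖z‖) ^ 2 * (h * ‖U‖) ^ 2 * Real.exp (C * ‖z‖ * (h * ‖U‖))) := by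
          gcongr
      _ ≤ |K U| * (C ^ 3 * (1 + ‖z‖) ^ 2 * (h * ‖U‖) ^ 2 * Real.exp (α * ‖U‖)) := by
          gcongr
      _ = _ := by ring
  have hint := (integrable_localised_and_norm_le hK.measurable hK.exp_abs hfm hmm hfb
    hm.abs_sub_le (z := z) hh hz).1
  obtain ⟨i1, e1⟩ := hK.integral_mul_linear f'
  obtain ⟨i2, e2⟩ := hK.integral_mul_linear m'
  have hdec : ∀ U, (K U * f (x + h • U) : ℂ) * Complex.exp (z * m (x + h • U)) =
      Complex.exp (z * m x) * ((K U : ℂ) * D U) +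
        Complex.exp (z * m x) * (f x * (K U : ℂ) + h * ((K U : ℂ) * (f' U : ℂ)) +
          f x * z * h * ((K U : ℂ) * (m' U : ℂ))) := by
    intro U
    simp only [hD, mul_sub, Complex.exp_sub, map_smul, smul_eq_mul, Complex.ofReal_mul]
    field_simp [Complex.exp_ne_zero]
    ring
  have iK : Integrable (fun U => (K U : ℂ)) := hK.integrable.ofReal
  have iD : Integrable (fun U => (K U : ℂ) * D U) := by
    refine (hK.exp_second.const_mul _).mono' ?_ (Eventually.of_forall hDb)
    have := hK.measurable
    exact Measurable.aestronglyMeasurable (by fun_prop)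
  have iA : Integrable (fun U => f x * (K U : ℂ) + h * ((K U : ℂ) * (f' U : ℂ))) :=
    (iK.const_mul _).add (i1.const_mul _)
  have iL : Integrable (fun U => f x * (K U : ℂ) + h * ((K U : ℂ) * (f' U : ℂ)) +
          f x * z * h * ((K U : ℂ) * (m' U : ℂ))) :=
    iA.add (i2.const_mul _)
  have eL : ∫ U, (f x * (K U : ℂ) + h * ((K U : ℂ) * (f' U : ℂ)) +
          f x * z * h * ((K U : ℂ) * (m' U : ℂ))) = f x := by
    rw [integral_add iA (i2.const_mul _),
      integral_add (iK.const_mul _) (i1.const_mul _), integral_const_mul, integral_const_mul,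
      integral_const_mul, e1, e2, integral_complex_ofReal, hK.integral_eq_one]
    simp
  simp_rw [hdec]
  rw [integral_add (iD.const_mul _) (iL.const_mul _), integral_const_mul, integral_const_mul, eL,
    mul_comm (Complex.exp _) (f x : ℂ), add_sub_cancel_right, norm_mul, Complex.norm_exp]
  have h4 : (z * (m x : ℂ)).re = z.re * m x := by simp
  rw [h4, mul_assoc]
  gcongr
  refine (norm_integral_le_of_norm_le (hK.exp_second.const_mul _)
    (Eventually.of_forall hDb)).trans_eq ?_
  rw [integral_const_mul]
  ring

end

/-! ### Stochastic boundedness, Chebyshev's inequality and variances of complex sums -/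

noncomputable section

section BigOP

variable {Ω : Type*} [MeasurableSpace Ω] {P : Measure Ω}

/-- If `Y' = O(r')` holds deterministically on the events `∀ i, ‖Y i‖ ≤ C |r i|`, and
`Y i = O_ℙ(r i)` for finitely many `i`, then `Y' = O_ℙ(r')`. -/
theorem IsBigOP.of_forall_imp {ι E E' : Type*} [Fintype ι] [Norm E] [Norm E']
    {Y : ι → ℕ → Ω → E} {r : ι → ℕ → ℝ} {Y' : ℕ → Ω → E'} {r' : ℕ → ℝ}
    (hY : ∀ i, IsBigOP P (Y i) (r i))
    (h : ∀ C : ℝ, 0 < C → ∃ C' : ℝ, 0 < C' ∧ ∀ᶠ n in atTop, ∀ᵐ ω ∂P,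
      (∀ i, ‖Y i n ω‖ ≤ C * |r i n|) → ‖Y' n ω‖ ≤ C' * |r' n|) :
    IsBigOP P Y' r' := by
  intro ε hε
  -- The added 1 keeps N positive for an empty index type; the union bound then costs at most ε.
  set N : ℝ := Fintype.card ι + 1 with hN
  have hN0 : 0 < N := by positivity
  choose c hc0 hc using fun i => hY i (ε / N) (by positivity)
  have hC : ∀ i, c i ≤ ∑ j, c j + 1 := fun i => by
    have := Finset.single_le_sum (f := c) (fun j _ => (hc0 j).le) (Finset.mem_univ i)
    linarith
  have hsum : 0 ≤ ∑ j, c j := Finset.sum_nonneg fun j _ => (hc0 j).le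
  obtain ⟨C', hC', hev⟩ := h (∑ j, c j + 1) (by positivity)
  refine ⟨C', hC', ?_⟩
  filter_upwards [hev, eventually_all.2 hc] with n hn hcn
  calc P {ω | C' * |r' n| < ‖Y' n ω‖} ≤ P (⋃ i, {ω | c i * |r i n| < ‖Y i n ω‖}) := by
        refine measure_mono_ae (hn.mono fun ω hω hlt => ?_)
        change _ < _ at hlt
        by_contra hnot
        have hall : ∀ i, ‖Y i n ω‖ ≤ c i * |r i n| := by
          intro i
          by_contra hi
          exact hnot (Set.mem_iUnion.2 ⟨i, not_le.1 hi⟩)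
        exact absurd (hω fun i => (hall i).trans (by gcongr; exact hC i)) (not_le.2 hlt)
    _ ≤ ∑ i, P {ω | c i * |r i n| < ‖Y i n ω‖} := measure_iUnion_fintype_le _ _
    _ ≤ ∑ _i : ι, ENNReal.ofReal (ε / N) := Finset.sum_le_sum fun i _ => hcn i
    _ = ENNReal.ofReal (Fintype.card ι * (ε / N)) := by
        rw [Finset.sum_const, nsmul_eq_mul, ENNReal.ofReal_mul (by positivity)]
        simp
    _ ≤ ENNReal.ofReal ε := by
        apply ENNReal.ofReal_le_ofReal
        rw [← mul_div_assoc, div_le_iff₀ hN0, hN]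
        nlinarith

theorem IsBigOP.of_imp {E E' : Type*} [Norm E] [Norm E']
    {Y : ℕ → Ω → E} {r : ℕ → ℝ} {Y' : ℕ → Ω → E'} {r' : ℕ → ℝ} (hY : IsBigOP P Y r)
    (h : ∀ C : ℝ, 0 < C → ∃ C' : ℝ, 0 < C' ∧ ∀ᶠ n in atTop, ∀ᵐ ω ∂P,
      ‖Y n ω‖ ≤ C * |r n| → ‖Y' n ω‖ ≤ C' * |r' n|) :
    IsBigOP P Y' r' :=
  IsBigOP.of_forall_imp (ι := Unit) (fun _ => hY) fun C hC => by
    obtain ⟨C', h1, h2⟩ := h C hC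
    exact ⟨C', h1, h2.mono fun n hn => hn.mono fun ω hω hall => hω (hall ())⟩

theorem IsBigOP.mono {E : Type*} [Norm E] {Y : ℕ → Ω → E} {r r' : ℕ → ℝ} (hY : IsBigOP P Y r)
    (D : ℝ) (h : ∀ᶠ n in atTop, |r n| ≤ D * |r' n|) : IsBigOP P Y r' :=
  hY.of_imp fun C hC => ⟨C * (|D| + 1), by positivity, h.mono fun n hn => ae_of_all _ fun ω hω => by
    refine hω.trans ?_
    rw [mul_assoc]
    gcongr
    exact hn.trans (by gcongr; linarith [le_abs_self D])⟩

/-- `O_ℙ` bounds are insensitive to null sets. -/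
theorem IsBigOP.congr_ae {E : Type*} [Norm E] {Y Y' : ℕ → Ω → E} {r : ℕ → ℝ} (hY : IsBigOP P Y r)
    (h : ∀ᶠ n in atTop, Y n =ᵐ[P] Y' n) : IsBigOP P Y' r :=
  hY.of_imp fun C hC => ⟨C, hC, h.mono fun n hn => hn.mono fun ω hω h1 => by rwa [← hω]⟩

theorem measure_lt_norm_le_of_integral_sq {E : Type*} [NormedAddCommGroup E]
    {Y : Ω → E} {c v : ℝ} (hc : 0 < c) (hi : Integrable (fun ω => ‖Y ω‖ ^ 2) P)
    (hv : ∫ ω, ‖Y ω‖ ^ 2 ∂P ≤ v) : P {ω | c < ‖Y ω‖} ≤ ENNReal.ofReal (v / c ^ 2) := by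
  have h1 : {ω | c < ‖Y ω‖} ⊆ {ω | ENNReal.ofReal (c ^ 2) ≤ ENNReal.ofReal (‖Y ω‖ ^ 2)} := by
    intro ω hω
    exact ENNReal.ofReal_le_ofReal (pow_le_pow_left₀ hc.le (le_of_lt hω) 2)
  have hc2 : 0 < c ^ 2 := by positivity
  refine (measure_mono h1).trans ?_
  refine (meas_ge_le_lintegral_div hi.aestronglyMeasurable.aemeasurable.ennreal_ofReal
    (by simpa using hc.ne') ENNReal.ofReal_ne_top).trans ?_
  rw [← ofReal_integral_eq_lintegral_ofReal hi (ae_of_all _ fun ω => by positivity),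
    ← ENNReal.ofReal_div_of_pos hc2]
  exact ENNReal.ofReal_le_ofReal (by gcongr)

/-- Chebyshev: a second moment of order `r²` gives `O_ℙ(r)`. -/
theorem isBigOP_of_integral_sq_le {E : Type*} [NormedAddCommGroup E] {Y : ℕ → Ω → E} {r : ℕ → ℝ}
    (D : ℝ) (h : ∀ᶠ n in atTop, 0 < r n ∧ Integrable (fun ω => ‖Y n ω‖ ^ 2) P ∧
      ∫ ω, ‖Y n ω‖ ^ 2 ∂P ≤ D * r n ^ 2) : IsBigOP P Y r := by
  intro ε hε
  have hC : 0 < √((|D| + 1) / ε) := by positivity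
  -- Markov's inequality for the square bounds the probability by D/C², which is at most ε for this
  -- C.
  refine ⟨√((|D| + 1) / ε), hC, ?_⟩
  filter_upwards [h] with n hn
  obtain ⟨hr, hi, hv⟩ := hn
  rw [abs_of_pos hr]
  refine (measure_lt_norm_le_of_integral_sq (by positivity) hi hv).trans
    (ENNReal.ofReal_le_ofReal ?_)
  rw [mul_pow, Real.sq_sqrt (by positivity), mul_div_mul_right _ _ (by positivity),
    div_div_eq_mul_div, div_le_iff₀ (by positivity)]
  nlinarith [le_abs_self D]

end BigOP

/-- Variance bound for sums of independent complex random variables. -/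
theorem integral_norm_sum_sub_sq_le {Ω : Type*} [MeasurableSpace Ω] {P : Measure Ω}
    [IsProbabilityMeasure P] {W : ℕ → Ω → ℂ} (hW : ∀ p, Measurable (W p)) (hind : iIndepFun W P)
    {w : ℂ} {v : ℝ} (hi : ∀ p, Integrable (fun ω => ‖W p ω‖ ^ 2) P) (hw : ∀ p, ∫ ω, W p ω ∂P = w)
    (hv : ∀ p, ∫ ω, ‖W p ω‖ ^ 2 ∂P ≤ v) (n : ℕ) :
    Integrable (fun ω => ‖∑ p ∈ Finset.range n, W p ω - n * w‖ ^ 2) P ∧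
      ∫ ω, ‖∑ p ∈ Finset.range n, W p ω - n * w‖ ^ 2 ∂P ≤ n * v := by
  have hsq : ∀ a : ℂ, ‖a‖ ^ 2 = a.re ^ 2 + a.im ^ 2 := fun a => by
    rw [Complex.sq_norm, Complex.normSq_apply]; ring
  have hLp : ∀ p, MemLp (W p) 2 P := fun p =>
    (memLp_two_iff_integrable_sq_norm (hW p).aestronglyMeasurable).2 (hi p)
  have hWi : ∀ p, Integrable (W p) P := fun p => (hLp p).integrable (by norm_num)
  -- Variance is available for real variables only, so the bound is proved for a real-linear
  -- functional and then applied to the real and imaginary parts, whose squares add up to the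
  -- squared modulus.
  have key : ∀ φ : ℂ →L[ℝ] ℝ, (∀ a, φ a ^ 2 ≤ ‖a‖ ^ 2) →
      Integrable (fun ω => φ (∑ p ∈ Finset.range n, W p ω - n * w) ^ 2) P ∧
      ∫ ω, φ (∑ p ∈ Finset.range n, W p ω - n * w) ^ 2 ∂P ≤
        ∑ p ∈ Finset.range n, ∫ ω, φ (W p ω) ^ 2 ∂P := by
    intro φ hφ
    have hφLp : ∀ p, MemLp (fun ω => φ (W p ω)) 2 P := fun p => φ.comp_memLp' (hLp p)
    have hmean : ∀ p, ∫ ω, φ (W p ω) ∂P = φ w := fun p => by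
      rw [ContinuousLinearMap.integral_comp_comm φ (hWi p), hw p]
    have hvar := IndepFun.variance_sum (μ := P) (s := Finset.range n)
      (X := fun p ω => φ (W p ω)) (fun p _ => hφLp p)
      (fun p _ q _ hpq => (hind.indepFun hpq).comp φ.measurable φ.measurable)
    have hsumLp : MemLp (∑ p ∈ Finset.range n, fun ω => φ (W p ω)) 2 P :=
      memLp_finsetSum' _ fun p _ => hφLp p
    have hEsum : ∫ ω, (∑ p ∈ Finset.range n, fun ω => φ (W p ω)) ω ∂P = n * φ w := by
      simp only [Finset.sum_apply]
      rw [integral_finsetSum _ fun p _ => (hφLp p).integrable (by norm_num)]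
      simp [hmean]
    have heq : ∀ ω, φ (∑ p ∈ Finset.range n, W p ω - n * w) =
        (∑ p ∈ Finset.range n, fun ω => φ (W p ω)) ω - n * φ w := by
      intro ω
      have : (n : ℂ) * w = (n : ℝ) • w := by simp
      rw [map_sub, map_sum, this, map_smul]
      simp
    rw [variance_eq_integral hsumLp.1.aemeasurable, hEsum] at hvar
    simp_rw [heq]
    refine ⟨?_, ?_⟩
    · exact (hsumLp.sub (memLp_const (n * φ w))).integrable_sq
    · rw [hvar]
      exact Finset.sum_le_sum fun p _ => variance_le_expectation_sq (hφLp p).1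
  obtain ⟨i1, e1⟩ := key Complex.reCLM fun a => by
    rw [hsq]; exact le_add_of_nonneg_right (sq_nonneg _)
  obtain ⟨i2, e2⟩ := key Complex.imCLM fun a => by
    rw [hsq]; exact le_add_of_nonneg_left (sq_nonneg _)
  simp only [Complex.reCLM_apply, Complex.imCLM_apply] at i1 e1 i2 e2
  simp_rw [hsq]
  refine ⟨i1.add i2, ?_⟩
  rw [integral_add i1 i2]
  refine (add_le_add e1 e2).trans ?_
  rw [← Finset.sum_add_distrib]
  have : ∀ p ∈ Finset.range n, (∫ ω, (W p ω).re ^ 2 ∂P) + ∫ ω, (W p ω).im ^ 2 ∂P ≤ v := by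
    intro p _
    have hre : Integrable (fun ω => (W p ω).re ^ 2) P :=
      (Complex.reCLM.comp_memLp' (hLp p)).integrable_sq
    have him : Integrable (fun ω => (W p ω).im ^ 2) P :=
      (Complex.imCLM.comp_memLp' (hLp p)).integrable_sq
    rw [← integral_add hre him]
    refine (le_of_eq ?_).trans (hv p)
    simp_rw [hsq]
  refine (Finset.sum_le_sum this).trans ?_
  simp

end

/-! ### First and second moments of the kernel sums -/

noncomputable section

/-- `∫ L(U) f(x + hU) exp (z m(x + hU)) dU`. -/
def localMean {k : ℕ} (L f m : EuclideanSpace ℝ (Fin k) → ℝ) (x : EuclideanSpace ℝ (Fin k))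
    (h : ℝ) (z : ℂ) : ℂ :=
  ∫ U, (L U * f (x + h • U) : ℂ) * Complex.exp (z * m (x + h • U))

/-- The expectation of `h⁻ᵏ exp (z Z) L((X - x) / h)` in the mixture model. -/
def mixtureMean {k : ℕ} (L fX : EuclideanSpace ℝ (Fin k) → ℝ) (lam : ℝ)
    (m₁ m₂ : EuclideanSpace ℝ (Fin k) → ℝ) (F₁ F₂ : Measure ℝ) (x : EuclideanSpace ℝ (Fin k))
    (h : ℝ) (z : ℂ) : ℂ :=
  lam * (complexMGF id F₁ z * localMean L fX m₁ x h z) +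
    (1 - lam) * (complexMGF id F₂ z * localMean L fX m₂ x h z)

/-- The kernel-weighted sum `∑ exp (z Zₚ) K((Xₚ - x) / h)`. -/
def kernelSum {Ω : Type*} {k : ℕ} (K : EuclideanSpace ℝ (Fin k) → ℝ)
    (X : ℕ → Ω → EuclideanSpace ℝ (Fin k)) (Z : ℕ → Ω → ℝ) (n : ℕ) (h : ℝ)
    (x : EuclideanSpace ℝ (Fin k)) (z : ℂ) (ω : Ω) : ℂ :=
  ∑ p ∈ Finset.range n, Complex.exp (z * Z p ω) * (K (h⁻¹ • (X p ω - x)) : ℂ)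

/-- The mixture model with a measurable kernel, with a common constant `C` for all bounds. -/
structure MixtureSetup {Ω : Type*} [MeasurableSpace Ω] {k : ℕ} (P : Measure Ω)
    (X : ℕ → Ω → EuclideanSpace ℝ (Fin k)) (Z : ℕ → Ω → ℝ)
    (K : EuclideanSpace ℝ (Fin k) → ℝ) (α : ℝ) (fX : EuclideanSpace ℝ (Fin k) → ℝ) (lam : ℝ)
    (m₁ m₂ : EuclideanSpace ℝ (Fin k) → ℝ) (F₁ F₂ : Measure ℝ) (C : ℝ) : Prop where
  sample : IsMixtureSample P X Z fX lam m₁ m₂ F₁ F₂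
  kernel : IsMeasurableKernel K α
  lam_nonneg : 0 ≤ lam
  lam_le : lam ≤ 1
  one_le : 1 ≤ C
  measurable_density : Measurable fX
  measurable₁ : Measurable m₁
  measurable₂ : Measurable m₂
  density_le : ∀ y, |fX y| ≤ C
  taylor_density : ∀ x, HasTaylorBound fX (fderiv ℝ fX x) x C
  taylor₁ : ∀ x, HasTaylorBound m₁ (fderiv ℝ m₁ x) x C
  taylor₂ : ∀ x, HasTaylorBound m₂ (fderiv ℝ m₂ x) x C

section Moments

variable {Ω : Type*} [MeasurableSpace Ω] {k : ℕ} {P : Measure Ω} [IsProbabilityMeasure P]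
  {X : ℕ → Ω → EuclideanSpace ℝ (Fin k)} {Z : ℕ → Ω → ℝ}
  {K : EuclideanSpace ℝ (Fin k) → ℝ} {α : ℝ}
  {fX m₁ m₂ : EuclideanSpace ℝ (Fin k) → ℝ} {lam : ℝ} {F₁ F₂ : Measure ℝ}
  [IsProbabilityMeasure F₁] [IsProbabilityMeasure F₂] {C : ℝ}

theorem MixtureSetup.swap (H : MixtureSetup P X Z K α fX lam m₁ m₂ F₁ F₂ C) :
    MixtureSetup P X Z K α fX (1 - lam) m₂ m₁ F₂ F₁ C where
  sample := H.sample.swap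
  kernel := H.kernel
  lam_nonneg := by linarith [H.lam_le]
  lam_le := by linarith [H.lam_nonneg]
  one_le := H.one_le
  measurable_density := H.measurable_density
  measurable₁ := H.measurable₂
  measurable₂ := H.measurable₁
  density_le := H.density_le
  taylor_density := H.taylor_density
  taylor₁ := H.taylor₂
  taylor₂ := H.taylor₁

/-- The weight L is general because L = K yields the means, L = K² the second moments, and
truncations of K² the Lindeberg condition. -/
theorem MixtureSetup.integral_term (H : MixtureSetup P X Z K α fX lam m₁ m₂ F₁ F₂ C) (p : ℕ)
    (x : EuclideanSpace ℝ (Fin k)) {L : EuclideanSpace ℝ (Fin k) → ℝ} (hLm : Measurable L)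
    (hL : Integrable (fun U => Real.exp (α * ‖U‖) * |L U|)) {h : ℝ} (hh : 0 < h) {z : ℂ}
    (hz : C * ‖z‖ * h ≤ α) (hF₁ : Integrable (fun e => Real.exp (z.re * e)) F₁)
    (hF₂ : Integrable (fun e => Real.exp (z.re * e)) F₂) :
    Integrable (fun ω => Complex.exp (z * Z p ω) * (L (h⁻¹ • (X p ω - x)) : ℂ)) P ∧
    ∫ ω, Complex.exp (z * Z p ω) * (L (h⁻¹ • (X p ω - x)) : ℂ) ∂P =
      h ^ k * mixtureMean L fX lam m₁ m₂ F₁ F₂ x h z := by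
  have loc := fun m : EuclideanSpace ℝ (Fin k) → ℝ => H.sample.integral_localised H.measurable_density p x hh L
    (fun y => Complex.exp (z * m y))
  have i₁ := (integrable_localised_and_norm_le hLm hL H.measurable_density H.measurable₁
    H.density_le (H.taylor₁ x).abs_sub_le (z := z) hh.le hz).1
  have i₂ := (integrable_localised_and_norm_le hLm hL H.measurable_density H.measurable₂
    H.density_le (H.taylor₂ x).abs_sub_le (z := z) hh.le hz).1
  obtain ⟨hi, he⟩ := H.sample.integral_cexp_mul H.measurable₁ H.measurable₂ H.lam_nonneg H.lam_le p
    (G := fun y => (L (h⁻¹ • (y - x)) : ℂ)) (by fun_prop) hF₁ hF₂ ((loc m₁).1 i₁) ((loc m₂).1 i₂)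
  refine ⟨hi, ?_⟩
  rw [he, (loc m₁).2, (loc m₂).2, mixtureMean, localMean, localMean]
  ring

/-- Bound for the second moment of `h⁻ᵏᐟ² exp (z Z) K((X - x) / h)`. -/
def secondMomentBound {k : ℕ} (lam : ℝ) (m₁ m₂ : EuclideanSpace ℝ (Fin k) → ℝ) (F₁ F₂ : Measure ℝ)
    (x : EuclideanSpace ℝ (Fin k)) (s : ℝ) : ℝ :=
  lam * (mgf id F₁ s * Real.exp (s * m₁ x)) + (1 - lam) * (mgf id F₂ s * Real.exp (s * m₂ x))

/-- Since |exp(zZ) K|² = exp(2 Re(z) Z) K², this is a first moment with kernel K² at the real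
frequency 2 Re z; hence the factor 2 in the smallness condition. -/
theorem MixtureSetup.integral_sq_term (H : MixtureSetup P X Z K α fX lam m₁ m₂ F₁ F₂ C) (p : ℕ)
    (x : EuclideanSpace ℝ (Fin k)) {h : ℝ} (hh : 0 < h) {z : ℂ}
    (hz : 2 * C * ‖z‖ * h ≤ α) (hF₁ : Integrable (fun e => Real.exp (2 * z.re * e)) F₁)
    (hF₂ : Integrable (fun e => Real.exp (2 * z.re * e)) F₂) :
    Integrable (fun ω => ‖Complex.exp (z * Z p ω) * (K (h⁻¹ • (X p ω - x)) : ℂ)‖ ^ 2) P ∧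
    ∫ ω, ‖Complex.exp (z * Z p ω) * (K (h⁻¹ • (X p ω - x)) : ℂ)‖ ^ 2 ∂P ≤
      h ^ k * (secondMomentBound lam m₁ m₂ F₁ F₂ x (2 * z.re) *
        (C * ∫ U, Real.exp (α * ‖U‖) * K U ^ 2)) := by
  have hL : Integrable (fun U => Real.exp (α * ‖U‖) * |K U ^ 2|) := by
    simpa only [abs_sq] using H.kernel.exp_sq
  have hKm : Measurable (fun U => K U ^ 2) := H.kernel.measurable.pow_const 2
  have hz' : C * ‖((2 * z.re : ℝ) : ℂ)‖ * h ≤ α := by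
    refine le_trans ?_ hz
    have h1 := Complex.abs_re_le_norm z
    have hC := H.one_le
    rw [Complex.norm_real, Real.norm_eq_abs, abs_mul, abs_two]
    calc C * (2 * |z.re|) * h ≤ C * (2 * ‖z‖) * h := by gcongr
      _ = _ := by ring
  obtain ⟨hi, he⟩ := H.integral_term p x hKm hL hh hz' (by simpa using hF₁) (by simpa using hF₂)
  have b₁ := (integrable_localised_and_norm_le hKm hL H.measurable_density H.measurable₁
    H.density_le (H.taylor₁ x).abs_sub_le (z := ((2 * z.re : ℝ) : ℂ)) hh.le hz').2
  have b₂ := (integrable_localised_and_norm_le hKm hL H.measurable_density H.measurable₂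
    H.density_le (H.taylor₂ x).abs_sub_le (z := ((2 * z.re : ℝ) : ℂ)) hh.le hz').2
  have heq : ∀ ω, Complex.exp (((2 * z.re : ℝ) : ℂ) * Z p ω) *
      (((K (h⁻¹ • (X p ω - x))) ^ 2 : ℝ) : ℂ) =
      ((‖Complex.exp (z * Z p ω) * (K (h⁻¹ • (X p ω - x)) : ℂ)‖ ^ 2 : ℝ) : ℂ) := by
    intro ω
    rw [norm_mul, Complex.norm_exp, Complex.norm_real, Real.norm_eq_abs, mul_pow, sq_abs,
      ← Real.exp_nat_mul, ← Complex.ofReal_mul, ← Complex.ofReal_exp, ← Complex.ofReal_mul]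
    congr 3
    simp
    ring
  simp_rw [heq] at hi he
  have hi' : Integrable (fun ω => ‖Complex.exp (z * Z p ω) *
      (K (h⁻¹ • (X p ω - x)) : ℂ)‖ ^ 2) P := by
    have := hi.re
    simpa only [RCLike.re_to_complex, Complex.ofReal_re] using this
  refine ⟨hi', ?_⟩
  rw [integral_complex_ofReal] at he
  refine (le_abs_self _).trans ?_
  rw [← Real.norm_eq_abs, ← Complex.norm_real, he, norm_mul, norm_pow, Complex.norm_real,
    Real.norm_eq_abs, abs_of_pos hh]
  gcongr
  simp only [abs_sq, Complex.ofReal_re] at b₁ b₂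
  set I := ∫ U, Real.exp (α * ‖U‖) * K U ^ 2 with hI
  rw [mixtureMean, secondMomentBound, complexMGF_ofReal, complexMGF_ofReal]
  have hl := H.lam_nonneg
  have hl' : 0 ≤ 1 - lam := by linarith [H.lam_le]
  refine (norm_add_le _ _).trans ?_
  rw [norm_mul, norm_mul, norm_mul, norm_mul, ← Complex.ofReal_one, ← Complex.ofReal_sub,
    Complex.norm_real, Complex.norm_real, Complex.norm_real, Complex.norm_real,
    Real.norm_of_nonneg hl, Real.norm_of_nonneg hl', Real.norm_of_nonneg mgf_nonneg,
    Real.norm_of_nonneg mgf_nonneg]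
  calc _ ≤ lam * (mgf id F₁ (2 * z.re) * (C * Real.exp (2 * z.re * m₁ x) * I)) +
        (1 - lam) * (mgf id F₂ (2 * z.re) * (C * Real.exp (2 * z.re * m₂ x) * I)) := by
        gcongr
        · exact mgf_nonneg
        · exact b₁
        · exact mgf_nonneg
        · exact b₂
    _ = _ := by ring

/-- Variance of the normalised kernel sum. -/
theorem MixtureSetup.integral_sq_kernelSum_sub_le
    (H : MixtureSetup P X Z K α fX lam m₁ m₂ F₁ F₂ C)
    (x : EuclideanSpace ℝ (Fin k)) {h : ℝ} (hh : 0 < h) {z : ℂ}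
    (hz : 2 * C * ‖z‖ * h ≤ α) (hF₁ : Integrable (fun e => Real.exp (z.re * e)) F₁)
    (hF₂ : Integrable (fun e => Real.exp (z.re * e)) F₂)
    (hF₁' : Integrable (fun e => Real.exp (2 * z.re * e)) F₁)
    (hF₂' : Integrable (fun e => Real.exp (2 * z.re * e)) F₂) {n : ℕ} (hn : 0 < n) :
    Integrable (fun ω => ‖kernelSum K X Z n h x z ω / (n * h ^ k : ℝ) -
      mixtureMean K fX lam m₁ m₂ F₁ F₂ x h z‖ ^ 2) P ∧
    ∫ ω, ‖kernelSum K X Z n h x z ω / (n * h ^ k : ℝ) -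
      mixtureMean K fX lam m₁ m₂ F₁ F₂ x h z‖ ^ 2 ∂P ≤
      secondMomentBound lam m₁ m₂ F₁ F₂ x (2 * z.re) *
        (C * ∫ U, Real.exp (α * ‖U‖) * K U ^ 2) / (n * h ^ k) := by
  have hz' : C * ‖z‖ * h ≤ α := by
    have : 0 ≤ C * ‖z‖ * h := mul_nonneg (mul_nonneg (by linarith [H.one_le]) (norm_nonneg _)) hh.le
    linarith
  have hKm := H.kernel.measurable
  set W : ℕ → Ω → ℂ := fun p ω => Complex.exp (z * Z p ω) * (K (h⁻¹ • (X p ω - x)) : ℂ) with hW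
  have hWm : ∀ p, Measurable (W p) := fun p => by
    have := H.sample.measurable_X p
    have := H.sample.measurable_Z p
    fun_prop
  have hind : iIndepFun W P := H.sample.indep.comp
    (fun _ q => Complex.exp (z * q.2) * (K (h⁻¹ • (q.1 - x)) : ℂ)) (fun _ => by fun_prop)
  obtain ⟨i1, e1⟩ := integral_norm_sum_sub_sq_le hWm hind
    (fun p => (H.integral_sq_term p x hh hz hF₁' hF₂').1)
    (fun p => (H.integral_term p x hKm H.kernel.exp_abs hh hz' hF₁ hF₂).2)
    (fun p => (H.integral_sq_term p x hh hz hF₁' hF₂').2) n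
  have hn' : (0 : ℝ) < n := by exact_mod_cast hn
  have hnn : 0 < (n * h ^ k : ℝ) := by positivity
  have heq : ∀ ω, ‖kernelSum K X Z n h x z ω / (n * h ^ k : ℝ) -
      mixtureMean K fX lam m₁ m₂ F₁ F₂ x h z‖ ^ 2 = ((n * h ^ k : ℝ) ^ 2)⁻¹ *
      ‖∑ p ∈ Finset.range n, W p ω - n * (h ^ k * mixtureMean K fX lam m₁ m₂ F₁ F₂ x h z)‖ ^ 2 := by
    intro ω
    have hne : ((n * h ^ k : ℝ) : ℂ) ≠ 0 := by exact_mod_cast hnn.ne'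
    have : kernelSum K X Z n h x z ω / (n * h ^ k : ℝ) -
        mixtureMean K fX lam m₁ m₂ F₁ F₂ x h z = (∑ p ∈ Finset.range n, W p ω -
          n * (h ^ k * mixtureMean K fX lam m₁ m₂ F₁ F₂ x h z)) / (n * h ^ k : ℝ) := by
      rw [eq_div_iff hne, sub_mul, div_mul_cancel₀ _ hne, kernelSum]
      push_cast
      ring
    rw [this, norm_div, Complex.norm_real, Real.norm_of_nonneg hnn.le, div_pow]
    field_simp
  simp_rw [heq]
  refine ⟨i1.const_mul _, ?_⟩
  rw [integral_const_mul]
  refine (mul_le_mul_of_nonneg_left e1 (by positivity)).trans_eq ?_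
  field_simp

end Moments

end

/-! ### Relative errors of the kernel sums -/

noncomputable section

section Rates

variable {Ω : Type*} [MeasurableSpace Ω] {k : ℕ} {P : Measure Ω} [IsProbabilityMeasure P]
  {X : ℕ → Ω → EuclideanSpace ℝ (Fin k)} {Z : ℕ → Ω → ℝ}
  {K : EuclideanSpace ℝ (Fin k) → ℝ} {α : ℝ}
  {fX m₁ m₂ : EuclideanSpace ℝ (Fin k) → ℝ} {lam : ℝ} {F₁ F₂ : Measure ℝ}
  [IsProbabilityMeasure F₁] [IsProbabilityMeasure F₂] {C : ℝ}

/-- Stochastic order of the centred kernel sums. -/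
theorem MixtureSetup.isBigOP_kernelSum_sub (H : MixtureSetup P X Z K α fX lam m₁ m₂ F₁ F₂ C)
    (x : EuclideanSpace ℝ (Fin k)) {h : ℕ → ℝ} {z : ℕ → ℂ} (hh : ∀ᶠ n in atTop, 0 < h n)
    (hzh : Tendsto (fun n => ‖z n‖ * h n) atTop (𝓝 0))
    (hF₁ : ∀ᶠ n in atTop, Integrable (fun e => Real.exp ((z n).re * e)) F₁ ∧
      Integrable (fun e => Real.exp (2 * (z n).re * e)) F₁)
    (hF₂ : ∀ᶠ n in atTop, Integrable (fun e => Real.exp ((z n).re * e)) F₂ ∧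
      Integrable (fun e => Real.exp (2 * (z n).re * e)) F₂)
    {v : ℕ → ℝ} (D : ℝ) (hv : ∀ᶠ n in atTop, 0 < v n ∧
      secondMomentBound lam m₁ m₂ F₁ F₂ x (2 * (z n).re) ≤ D * v n) :
    IsBigOP P (fun n ω => kernelSum K X Z n (h n) x (z n) ω / (n * h n ^ k : ℝ) -
      mixtureMean K fX lam m₁ m₂ F₁ F₂ x (h n) (z n)) (fun n => √(v n / (n * h n ^ k))) := by
  have hα := H.kernel.pos
  have hC := H.one_le
  have hI : 0 ≤ ∫ U, Real.exp (α * ‖U‖) * K U ^ 2 := integral_nonneg fun U => by positivity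
  refine isBigOP_of_integral_sq_le (D * (C * ∫ U, Real.exp (α * ‖U‖) * K U ^ 2)) ?_
  have hsmall : ∀ᶠ n in atTop, ‖z n‖ * h n < α / (2 * C) :=
    hzh.eventually_lt_const (by positivity)
  filter_upwards [hh, hF₁, hF₂, hv, hsmall, eventually_gt_atTop 0] with n hhn h1 h2 hvn hs hn
  have hn' : (0 : ℝ) < n := by exact_mod_cast hn
  have hz : 2 * C * ‖z n‖ * h n ≤ α := by
    rw [lt_div_iff₀ (by positivity)] at hs
    linarith
  obtain ⟨i, e⟩ := H.integral_sq_kernelSum_sub_le x hhn hz h1.1 h2.1 h1.2 h2.2 hn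
  have hpos : 0 < v n / (n * h n ^ k) := div_pos hvn.1 (by positivity)
  refine ⟨Real.sqrt_pos.2 hpos, i, e.trans ?_⟩
  rw [Real.sq_sqrt hpos.le]
  calc _ ≤ D * v n * (C * ∫ U, Real.exp (α * ‖U‖) * K U ^ 2) / (n * h n ^ k) := by
        gcongr
        exact hvn.2
    _ = _ := by ring

/-- The bias of the kernel sums. -/
theorem MixtureSetup.norm_mixtureMean_sub_le (H : MixtureSetup P X Z K α fX lam m₁ m₂ F₁ F₂ C)
    (x : EuclideanSpace ℝ (Fin k)) {h : ℝ} {z : ℂ} (hh : 0 ≤ h) (hz : C * ‖z‖ * h ≤ α) :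
    ‖mixtureMean K fX lam m₁ m₂ F₁ F₂ x h z -
      lam * (complexMGF id F₁ z * (fX x * Complex.exp (z * m₁ x)))‖ ≤
    lam * (‖complexMGF id F₁ z‖ * (Real.exp (z.re * m₁ x) *
      (C ^ 3 * (∫ U, Real.exp (α * ‖U‖) * |K U| * ‖U‖ ^ 2)) * ((1 + ‖z‖) ^ 2 * h ^ 2))) +
    ‖complexMGF id F₂ z‖ *
      (C * Real.exp (z.re * m₂ x) * ∫ U, Real.exp (α * ‖U‖) * |K U|) := by
  have b₁ := H.kernel.norm_localised_sub_le H.one_le H.measurable_density H.measurable₁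
    H.density_le (H.taylor_density x) (H.taylor₁ x) (z := z) hh hz
  have b₂ := (integrable_localised_and_norm_le H.kernel.measurable H.kernel.exp_abs
    H.measurable_density H.measurable₂ H.density_le (H.taylor₂ x).abs_sub_le (z := z) hh hz).2
  have hl := H.lam_nonneg
  have hl' : 0 ≤ 1 - lam := by linarith [H.lam_le]
  have hl1 : 1 - lam ≤ 1 := by linarith
  have hdec : mixtureMean K fX lam m₁ m₂ F₁ F₂ x h z -
      lam * (complexMGF id F₁ z * (fX x * Complex.exp (z * m₁ x))) =
      lam * (complexMGF id F₁ z * (localMean K fX m₁ x h z - fX x * Complex.exp (z * m₁ x))) +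
      ((1 - lam : ℝ) : ℂ) * (complexMGF id F₂ z * localMean K fX m₂ x h z) := by
    rw [mixtureMean]
    push_cast
    ring
  rw [hdec]
  refine (norm_add_le _ _).trans ?_
  rw [norm_mul, norm_mul, norm_mul, norm_mul, Complex.norm_real, Complex.norm_real,
    Real.norm_of_nonneg hl, Real.norm_of_nonneg hl']
  refine add_le_add (by gcongr; exact b₁) ?_
  calc (1 - lam) * (‖complexMGF id F₂ z‖ * ‖localMean K fX m₂ x h z‖)
      ≤ 1 * (‖complexMGF id F₂ z‖ * ‖localMean K fX m₂ x h z‖) := by gcongr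
    _ ≤ _ := by
      rw [one_mul]
      gcongr
      exact b₂

/-- The leading term of the kernel sums when the first component dominates. -/
def leadingTerm {k : ℕ} (fX : EuclideanSpace ℝ (Fin k) → ℝ) (lam : ℝ)
    (m : EuclideanSpace ℝ (Fin k) → ℝ) (F : Measure ℝ) (x : EuclideanSpace ℝ (Fin k)) (z : ℂ) : ℂ :=
  lam * (complexMGF id F z * (fX x * Complex.exp (z * m x)))

theorem norm_leadingTerm {m : EuclideanSpace ℝ (Fin k) → ℝ} {F : Measure ℝ}
    {x : EuclideanSpace ℝ (Fin k)} (hl : 0 ≤ lam) (hf : 0 ≤ fX x) (z : ℂ) :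
    ‖leadingTerm fX lam m F x z‖ =
      lam * (‖complexMGF id F z‖ * (fX x * Real.exp (z.re * m x))) := by
  have h4 : (z * (m x : ℂ)).re = z.re * m x := by simp
  rw [leadingTerm, norm_mul, norm_mul, norm_mul, Complex.norm_real, Complex.norm_real,
    Complex.norm_exp, h4, Real.norm_of_nonneg hl, Real.norm_of_nonneg hf]

/-- Relative bias of the kernel sums when the first component dominates. -/
theorem MixtureSetup.norm_mixtureMean_div_sub_one_le
    (H : MixtureSetup P X Z K α fX lam m₁ m₂ F₁ F₂ C) (hlam : 0 < lam)
    (x : EuclideanSpace ℝ (Fin k)) (hx : 0 < fX x) {d : ℝ} (hd : 0 ≤ d) :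
    ∃ D : ℝ, 0 < D ∧ ∀ (h : ℝ) (z : ℂ) (q : ℝ), 0 ≤ h → 0 ≤ q → C * ‖z‖ * h ≤ α →
      complexMGF id F₁ z ≠ 0 →
      Real.exp (z.re * (m₂ x - m₁ x)) * ‖complexMGF id F₂ z‖ ≤ d * q * ‖complexMGF id F₁ z‖ →
      ‖mixtureMean K fX lam m₁ m₂ F₁ F₂ x h z / leadingTerm fX lam m₁ F₁ x z - 1‖ ≤
        D * (q + ((1 + ‖z‖) * h) ^ 2) := by
  set I₁ := ∫ U, Real.exp (α * ‖U‖) * |K U| * ‖U‖ ^ 2 with hI₁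
  set I₀ := ∫ U, Real.exp (α * ‖U‖) * |K U| with hI₀
  have hI₁0 : 0 ≤ I₁ := integral_nonneg fun U => by positivity
  have hI₀0 : 0 ≤ I₀ := integral_nonneg fun U => by positivity
  have hC := H.one_le
  -- The first summand comes from the bias of the dominating component, the second from the other
  -- component; the 1 only ensures positivity.
  refine ⟨C ^ 3 * I₁ / fX x + C * I₀ * d / (lam * fX x) + 1, by positivity,
    fun h z q hh hq hz hM hr => ?_⟩
  have hMpos : 0 < ‖complexMGF id F₁ z‖ := norm_pos_iff.2 hM
  have hA := norm_leadingTerm (m := m₁) (F := F₁) hlam.le hx.le z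
  have hApos : 0 < ‖leadingTerm fX lam m₁ F₁ x z‖ := by rw [hA]; positivity
  have hA0 : leadingTerm fX lam m₁ F₁ x z ≠ 0 := norm_pos_iff.1 hApos
  have hb := H.norm_mixtureMean_sub_le x hh hz
  rw [div_sub_one hA0, norm_div, div_le_iff₀ hApos]
  refine hb.trans ?_
  have h2 : Real.exp (z.re * m₂ x) * ‖complexMGF id F₂ z‖ ≤
      d * q * ‖complexMGF id F₁ z‖ * Real.exp (z.re * m₁ x) := by
    calc Real.exp (z.re * m₂ x) * ‖complexMGF id F₂ z‖
        = Real.exp (z.re * (m₂ x - m₁ x)) * ‖complexMGF id F₂ z‖ * Real.exp (z.re * m₁ x) := by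
          rw [mul_right_comm, ← Real.exp_add]
          ring_nf
      _ ≤ _ := by gcongr
  set e := Real.exp (z.re * m₁ x) with he
  set M := ‖complexMGF id F₁ z‖ with hMdef
  have he0 : 0 < e := Real.exp_pos _
  set b := ((1 + ‖z‖) * h) ^ 2 with hbdef
  have hb0 : 0 ≤ b := sq_nonneg _
  rw [hA]
  calc lam * (M * (e * (C ^ 3 * I₁) * ((1 + ‖z‖) ^ 2 * h ^ 2))) +
        ‖complexMGF id F₂ z‖ * (C * Real.exp (z.re * m₂ x) * I₀)
      = lam * (M * e) * (C ^ 3 * I₁) * b +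
        C * I₀ * (Real.exp (z.re * m₂ x) * ‖complexMGF id F₂ z‖) := by rw [hbdef]; ring
    _ ≤ lam * (M * e) * (C ^ 3 * I₁) * b + C * I₀ * (d * q * M * e) := by gcongr
    _ = (C ^ 3 * I₁ / fX x * b + C * I₀ * d / (lam * fX x) * q) * (lam * (M * (fX x * e))) := by
        field_simp
    _ ≤ _ := by
        gcongr
        have t1 : 0 ≤ C ^ 3 * I₁ / fX x := by positivity
        have t2 : 0 ≤ C * I₀ * d / (lam * fX x) := by positivity
        nlinarith [mul_nonneg t1 hq, mul_nonneg t2 hb0]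

theorem le_sqrt_pow_four_add {a b : ℝ} (hb : 0 ≤ b) : a ^ 2 ≤ √(a ^ 4 + b) := by
  apply Real.le_sqrt_of_sq_le
  nlinarith

theorem sqrt_le_sqrt_pow_four_add (a b : ℝ) : √b ≤ √(a ^ 4 + b) := by
  gcongr
  have : 0 ≤ a ^ 4 := by positivity
  linarith

/-- Relative error of the kernel sums when the first component dominates. -/
theorem MixtureSetup.isBigOP_kernelSum_div_sub_one
    (H : MixtureSetup P X Z K α fX lam m₁ m₂ F₁ F₂ C) (hlam : 0 < lam)
    (x : EuclideanSpace ℝ (Fin k)) (hx : 0 < fX x) {h : ℕ → ℝ} {z : ℕ → ℂ} {q : ℕ → ℝ}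
    (hh : ∀ᶠ n in atTop, 0 < h n) (hzh : Tendsto (fun n => ‖z n‖ * h n) atTop (𝓝 0))
    (hF₁ : ∀ᶠ n in atTop, Integrable (fun e => Real.exp ((z n).re * e)) F₁ ∧
      Integrable (fun e => Real.exp (2 * (z n).re * e)) F₁)
    (hF₂ : ∀ᶠ n in atTop, Integrable (fun e => Real.exp ((z n).re * e)) F₂ ∧
      Integrable (fun e => Real.exp (2 * (z n).re * e)) F₂)
    (hM : ∀ᶠ n in atTop, complexMGF id F₁ (z n) ≠ 0) (hq : ∀ᶠ n in atTop, 0 ≤ q n)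
    (hr : ∃ d : ℝ, ∀ᶠ n in atTop, Real.exp ((z n).re * (m₂ x - m₁ x)) * ‖complexMGF id F₂ (z n)‖ ≤
      d * q n * ‖complexMGF id F₁ (z n)‖)
    (hr₂ : ∃ d : ℝ, ∀ᶠ n in atTop, Real.exp (2 * (z n).re * (m₂ x - m₁ x)) *
      mgf id F₂ (2 * (z n).re) ≤ d * mgf id F₁ (2 * (z n).re)) :
    IsBigOP P (fun n ω => kernelSum K X Z n (h n) x (z n) ω / (n * h n ^ k : ℝ) /
      leadingTerm fX lam m₁ F₁ x (z n) - 1) (fun n => q n + √(((1 + ‖z n‖) * h n) ^ 4 +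
        mgf id F₁ (2 * (z n).re) / ‖complexMGF id F₁ (z n)‖ ^ 2 / (n * h n ^ k))) := by
  obtain ⟨d, hd⟩ := hr
  obtain ⟨d₂, hd₂⟩ := hr₂
  have hC := H.one_le
  have hα := H.kernel.pos
  obtain ⟨D, hD0, hD⟩ := H.norm_mixtureMean_div_sub_one_le hlam x hx (abs_nonneg d)
  -- By `hr₂`, at the doubled frequency the second component is at most comparable to the first, so
  -- that only the moment generating function of `F₁` enters the variance.
  have hfl := H.isBigOP_kernelSum_sub x hh hzh hF₁ hF₂
    (v := fun n => mgf id F₁ (2 * (z n).re) * Real.exp (2 * (z n).re * m₁ x)) (1 + |d₂|) (by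
      filter_upwards [hF₁, hd₂] with n h1 h2
      have hmg : 0 < mgf id F₁ (2 * (z n).re) := mgf_pos h1.2
      refine ⟨by positivity, ?_⟩
      have hl := H.lam_nonneg
      have hl1 := H.lam_le
      have hm2 : 0 ≤ mgf id F₂ (2 * (z n).re) := mgf_nonneg
      have h3 : mgf id F₂ (2 * (z n).re) * Real.exp (2 * (z n).re * m₂ x) ≤
          |d₂| * (mgf id F₁ (2 * (z n).re) * Real.exp (2 * (z n).re * m₁ x)) := by
        calc _ = Real.exp (2 * (z n).re * (m₂ x - m₁ x)) * mgf id F₂ (2 * (z n).re) *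
              Real.exp (2 * (z n).re * m₁ x) := by
              have : Real.exp (2 * (z n).re * m₂ x) = Real.exp (2 * (z n).re * (m₂ x - m₁ x)) *
                  Real.exp (2 * (z n).re * m₁ x) := by
                rw [← Real.exp_add]
                ring_nf
              rw [this]
              ring
          _ ≤ |d₂| * mgf id F₁ (2 * (z n).re) * Real.exp (2 * (z n).re * m₁ x) := by
              refine mul_le_mul_of_nonneg_right (h2.trans ?_) (Real.exp_pos _).le
              gcongr
              exact le_abs_self _
          _ = _ := by ring
      rw [secondMomentBound]
      have h4 : 0 ≤ mgf id F₁ (2 * (z n).re) * Real.exp (2 * (z n).re * m₁ x) := by positivity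
      have h5 : 0 ≤ mgf id F₂ (2 * (z n).re) * Real.exp (2 * (z n).re * m₂ x) := by positivity
      nlinarith)
  refine hfl.of_imp fun c hc => ⟨c / (lam * fX x) + D, by positivity, ?_⟩
  have hsmall : ∀ᶠ n in atTop, ‖z n‖ * h n < α / C := hzh.eventually_lt_const (by positivity)
  filter_upwards [hh, hsmall, hM, hq, hd, hF₁, eventually_gt_atTop 0]
    with n hhn hs hMn hqn hdn h1 hn
  refine ae_of_all _ fun ω hω => ?_
  have hn' : (0 : ℝ) < n := by exact_mod_cast hn
  have hMpos : 0 < ‖complexMGF id F₁ (z n)‖ := norm_pos_iff.2 hMn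
  have hmg : 0 < mgf id F₁ (2 * (z n).re) := mgf_pos h1.2
  have hz : C * ‖z n‖ * h n ≤ α := by
    rw [lt_div_iff₀ (by positivity)] at hs
    linarith
  have hbias := hD (h n) (z n) (q n) hhn.le hqn hz hMn
    (hdn.trans (by gcongr; exact le_abs_self d))
  have hA := norm_leadingTerm (m := m₁) (F := F₁) hlam.le hx.le (z n)
  have hApos : 0 < ‖leadingTerm fX lam m₁ F₁ x (z n)‖ := by rw [hA]; positivity
  set A := leadingTerm fX lam m₁ F₁ x (z n) with hAdef
  set M := mixtureMean K fX lam m₁ m₂ F₁ F₂ x (h n) (z n) with hMdef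
  set S := kernelSum K X Z n (h n) x (z n) ω / (n * h n ^ k : ℝ) with hS
  set V := mgf id F₁ (2 * (z n).re) / ‖complexMGF id F₁ (z n)‖ ^ 2 / (n * h n ^ k) with hV
  have hV0 : 0 ≤ V := by positivity
  -- Fluctuation plus bias, both relative to the leading term.
  have hdec : S / A - 1 = (S - M) / A + (M / A - 1) := by ring
  have hsq : √(mgf id F₁ (2 * (z n).re) * Real.exp (2 * (z n).re * m₁ x) / (n * h n ^ k)) =
      ‖complexMGF id F₁ (z n)‖ * Real.exp ((z n).re * m₁ x) * √V := by
    have he : mgf id F₁ (2 * (z n).re) * Real.exp (2 * (z n).re * m₁ x) / (n * h n ^ k) =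
        (‖complexMGF id F₁ (z n)‖ * Real.exp ((z n).re * m₁ x)) ^ 2 * V := by
      rw [mul_pow, ← Real.exp_nat_mul, hV]
      field_simp
      push_cast
      ring_nf
    rw [he, Real.sqrt_mul (by positivity), Real.sqrt_sq (by positivity)]
  rw [hsq, abs_of_nonneg (by positivity)] at hω
  have hfluct : ‖(S - M) / A‖ ≤ c / (lam * fX x) * √V := by
    rw [norm_div, div_le_iff₀ hApos, hA]
    refine hω.trans_eq ?_
    field_simp
  have hsum0 : 0 ≤ q n + √(((1 + ‖z n‖) * h n) ^ 4 + V) := by positivity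
  rw [hdec, abs_of_nonneg hsum0, add_mul]
  refine (norm_add_le _ _).trans (add_le_add (hfluct.trans ?_) (hbias.trans ?_))
  · gcongr
    have := sqrt_le_sqrt_pow_four_add ((1 + ‖z n‖) * h n) V
    linarith
  · gcongr
    exact le_sqrt_pow_four_add hV0

/-- Relative error of the kernel density estimator. -/
theorem MixtureSetup.isBigOP_kernelSum_zero_div_sub_one
    (H : MixtureSetup P X Z K α fX lam m₁ m₂ F₁ F₂ C)
    (x : EuclideanSpace ℝ (Fin k)) (hx : 0 < fX x) {h : ℕ → ℝ}
    (hh : ∀ᶠ n in atTop, 0 < h n) :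
    IsBigOP P (fun n ω => kernelSum K X Z n (h n) x 0 ω / (n * h n ^ k : ℝ) / fX x - 1)
      (fun n => √(h n ^ 4 + 1 / (n * h n ^ k))) := by
  have hα := H.kernel.pos
  have hC := H.one_le
  set B := C ^ 3 * (∫ U, Real.exp (α * ‖U‖) * |K U| * ‖U‖ ^ 2) with hB
  have hB0 : 0 ≤ B := mul_nonneg (by positivity) (integral_nonneg fun U => by positivity)
  have hfl := H.isBigOP_kernelSum_sub x hh (z := fun _ => 0) (by simp)
    (Eventually.of_forall fun n => by simp) (Eventually.of_forall fun n => by simp)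
    (v := fun _ => 1) 1 (Eventually.of_forall fun n => by simp [secondMomentBound])
  refine hfl.of_imp fun c hc => ⟨(c + B) / fX x, by positivity, ?_⟩
  filter_upwards [hh, eventually_gt_atTop 0] with n hhn hn
  refine ae_of_all _ fun ω hω => ?_
  have hn' : (0 : ℝ) < n := by exact_mod_cast hn
  have b₁ := H.kernel.norm_localised_sub_le H.one_le H.measurable_density H.measurable₁
    H.density_le (H.taylor_density x) (H.taylor₁ x) (z := 0) hhn.le (by simpa using hα.le)
  have b₂ := H.kernel.norm_localised_sub_le H.one_le H.measurable_density H.measurable₂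
    H.density_le (H.taylor_density x) (H.taylor₂ x) (z := 0) hhn.le (by simpa using hα.le)
  set M := mixtureMean K fX lam m₁ m₂ F₁ F₂ x (h n) 0 with hMdef
  set S := kernelSum K X Z n (h n) x 0 ω / (n * h n ^ k : ℝ) with hS
  have hM : ‖M - fX x‖ ≤ B * h n ^ 2 := by
    -- At frequency 0 both error transforms equal 1 and the two mixture weights sum to 1, so neither
    -- component has to dominate.
    have hdec : M - fX x = lam * (localMean K fX m₁ x (h n) 0 - fX x) +
        ((1 - lam : ℝ) : ℂ) * (localMean K fX m₂ x (h n) 0 - fX x) := by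
      rw [hMdef, mixtureMean]
      have : ∀ (F : Measure ℝ) [IsProbabilityMeasure F], complexMGF id F 0 = 1 := by
        intro F _; simp [complexMGF]
      rw [this, this]
      push_cast
      ring
    have hl := H.lam_nonneg
    have hl' : 0 ≤ 1 - lam := by linarith [H.lam_le]
    rw [hdec]
    refine (norm_add_le _ _).trans ?_
    rw [norm_mul, norm_mul, Complex.norm_real, Complex.norm_real, Real.norm_of_nonneg hl,
      Real.norm_of_nonneg hl']
    simp only [zero_mul, Complex.exp_zero, mul_one, Complex.zero_re, Real.exp_zero, norm_zero,
      add_zero, one_pow, one_mul] at b₁ b₂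
    simp only [localMean, zero_mul, Complex.exp_zero, mul_one]
    nlinarith [mul_le_mul_of_nonneg_left b₁ hl, mul_le_mul_of_nonneg_left b₂ hl']
  have hfx : (fX x : ℂ) ≠ 0 := by exact_mod_cast hx.ne'
  rw [abs_of_nonneg (Real.sqrt_nonneg _)] at hω ⊢
  have hfx' : S / fX x - 1 = ((S - M) + (M - fX x)) / fX x := by
    field_simp
    ring
  rw [hfx', norm_div, Complex.norm_real, Real.norm_of_nonneg hx.le, div_mul_eq_mul_div]
  gcongr
  refine (norm_add_le _ _).trans ?_
  rw [add_mul]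
  refine add_le_add (hω.trans ?_) (hM.trans ?_)
  · exact mul_le_mul_of_nonneg_left (sqrt_le_sqrt_pow_four_add _ _) hc.le
  · gcongr
    exact le_sqrt_pow_four_add (by positivity)

end Rates

end

/-! ### Anticoncentration for triangular arrays -/

noncomputable section

section Anticoncentration

/-- Gaussian smoothing: a small ball probability is controlled by the characteristic function. -/
theorem measureReal_abs_le_le_integral_norm_charFun (ρ : Measure ℝ) [IsProbabilityMeasure ρ]
    {η : ℝ} (hη : 0 < η) :
    ρ.real {y | |y| ≤ η} ≤
      Real.exp (1 / 2) * ∫ θ, ‖charFun ρ (θ / η)‖ ∂(gaussianReal 0 1) := by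
  have hcf : ∀ y : ℝ, charFun (gaussianReal 0 1) (y / η) =
      ((Real.exp (-(y / η) ^ 2 / 2) : ℝ) : ℂ) := by
    intro y
    rw [charFun_gaussianReal]
    push_cast
    congr 1
    ring
  have hgi : Integrable (fun y : ℝ => Real.exp (-(y / η) ^ 2 / 2)) ρ := by
    refine (integrable_const (1 : ℝ)).mono' (by fun_prop) (ae_of_all _ fun y => ?_)
    rw [Real.norm_of_nonneg (Real.exp_pos _).le]
    exact Real.exp_le_one_iff.2 (by nlinarith [sq_nonneg (y / η)])
  have hswap : ∫ y, charFun (gaussianReal 0 1) (y / η) ∂ρ =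
      ∫ θ, charFun ρ (θ / η) ∂(gaussianReal 0 1) := by
    simp_rw [charFun_apply_real]
    rw [integral_integral_swap]
    · refine integral_congr_ae (ae_of_all _ fun θ => integral_congr_ae (ae_of_all _ fun y => ?_))
      simp only
      congr 1
      push_cast
      ring
    · refine (integrable_const (1 : ℝ)).mono' (Measurable.aestronglyMeasurable (by fun_prop))
        (ae_of_all _ fun q => ?_)
      simp only [Function.uncurry]
      rw [← Complex.ofReal_mul, Complex.norm_exp_ofReal_mul_I]
  -- On |y| ≤ η the Gaussian factor is at least exp(-1/2). As it is itself the characteristic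
  -- function of a normal law, Fubini has already moved the transform onto ρ.
  have h1 : ρ.real {y | |y| ≤ η} ≤ Real.exp (1 / 2) * ∫ y, Real.exp (-(y / η) ^ 2 / 2) ∂ρ := by
    have hm : MeasurableSet {y : ℝ | |y| ≤ η} := measurableSet_le (by fun_prop) (by fun_prop)
    rw [← integral_indicator_one hm, ← integral_const_mul]
    refine integral_mono ((integrable_const (1 : ℝ)).indicator hm) (hgi.const_mul _) fun y => ?_
    by_cases hy : |y| ≤ η
    · rw [Set.indicator_of_mem (show y ∈ {y : ℝ | |y| ≤ η} from hy)]
      simp only [Pi.one_apply]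
      rw [← Real.exp_add]
      apply Real.one_le_exp
      have : (y / η) ^ 2 ≤ 1 := by
        rw [div_pow, div_le_one (by positivity)]
        exact sq_le_sq.2 (by rwa [abs_of_pos hη])
      linarith
    · rw [Set.indicator_of_notMem (show y ∉ {y : ℝ | |y| ≤ η} from hy)]
      positivity
  refine h1.trans (mul_le_mul_of_nonneg_left ?_ (Real.exp_pos _).le)
  simp_rw [hcf] at hswap
  rw [integral_complex_ofReal] at hswap
  refine (le_abs_self _).trans ?_
  rw [← Real.norm_eq_abs, ← Complex.norm_real, hswap]
  exact norm_integral_le_integral_norm _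

/-- The minimum merges the cubic remainder for |y| ≤ 1 with the trivial quadratic one for |y| ≥ 1.
Only second moments are then needed, and the remainder has the form that a Lindeberg condition
controls. -/
theorem norm_cexp_sub_taylor_two_le (y : ℝ) :
    ‖Complex.exp (y * Complex.I) - (1 + y * Complex.I - y ^ 2 / 2)‖ ≤ 4 * (y ^ 2 * min 1 |y|) := by
  have hI : ((y : ℂ) * Complex.I) ^ 2 = -(y : ℂ) ^ 2 := by rw [mul_pow, Complex.I_sq]; ring
  have hn : ‖(y : ℂ) * Complex.I‖ = |y| := by simp
  rcases le_total |y| 1 with hy | hy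
  · have := Complex.exp_bound (x := (y : ℂ) * Complex.I) (by rwa [hn]) (n := 3) (by norm_num)
    rw [hn] at this
    simp only [Finset.sum_range_succ, Finset.sum_range_zero, hI] at this
    rw [min_eq_right hy]
    have h2 : (1 : ℂ) + y * Complex.I - y ^ 2 / 2 = 0 + (y * Complex.I) ^ 0 / (Nat.factorial 0) +
      (y * Complex.I) ^ 1 / (Nat.factorial 1) + -(y : ℂ) ^ 2 / (Nat.factorial 2) := by
      simp [Nat.factorial]
      ring
    rw [h2]
    refine this.trans ?_
    have h3 : |y| ^ 3 = y ^ 2 * |y| := by rw [pow_succ, sq_abs]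
    rw [h3]
    norm_num [Nat.factorial]
    have : 0 ≤ y ^ 2 * |y| := by positivity
    linarith
  · rw [min_eq_left hy, mul_one]
    have h1 : ‖Complex.exp (y * Complex.I)‖ = 1 := Complex.norm_exp_ofReal_mul_I y
    have h2 : ‖(1 : ℂ) + y * Complex.I - y ^ 2 / 2‖ ≤ 1 + |y| + y ^ 2 / 2 := by
      refine (norm_sub_le _ _).trans (add_le_add ((norm_add_le _ _).trans ?_) ?_)
      · simp
      · simp
    refine (norm_sub_le _ _).trans ?_
    have h3 : |y| ≤ y ^ 2 := by rw [← sq_abs]; nlinarith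
    have h4 : 1 ≤ |y| := hy
    linarith

/-- This is √v ≤ (1 + v)/2 for the squared modulus v = (1 - u)² + w². The imaginary part enters only
through its square, so the row means matter only through n times their squares. -/
theorem norm_one_add_mul_I_sub_le (u w : ℝ) :
    ‖(1 : ℂ) + w * Complex.I - u‖ ≤ 1 - u + (u ^ 2 + w ^ 2) / 2 := by
  have h0 : 0 ≤ 1 - u + (u ^ 2 + w ^ 2) / 2 := by nlinarith [sq_nonneg (1 - u), sq_nonneg w]
  rw [← abs_of_nonneg (norm_nonneg _), ← abs_of_nonneg h0, ← sq_le_sq, Complex.sq_norm,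
    Complex.normSq_apply]
  simp
  nlinarith [sq_nonneg (-u + (u ^ 2 + w ^ 2) / 2)]

/-- Second order expansion of the modulus of a characteristic function. -/
theorem norm_charFun_pow_le (ν : Measure ℝ) [IsProbabilityMeasure ν]
    (hi : Integrable (fun x : ℝ => x ^ 2) ν) (θ : ℝ) (n : ℕ) :
    ‖charFun ν θ‖ ^ n ≤ Real.exp (-(θ ^ 2 * (n * ∫ x, x ^ 2 ∂ν) / 2) +
      ((θ ^ 2 * (∫ x, x ^ 2 ∂ν) / 2) * (θ ^ 2 * (n * ∫ x, x ^ 2 ∂ν) / 2) / 2 +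
        θ ^ 2 * (n * (∫ x, x ∂ν) ^ 2) / 2 +
        4 * θ ^ 2 * (n * ∫ x, x ^ 2 * min 1 |θ * x| ∂ν))) := by
  have hm : MemLp (fun x : ℝ => x) 2 ν :=
    (memLp_two_iff_integrable_sq (by fun_prop)).2 hi
  have hi1 : Integrable (fun x : ℝ => x) ν := hm.integrable (by norm_num)
  have hiT : Integrable (fun x : ℝ => x ^ 2 * min 1 |θ * x|) ν := by
    refine hi.mono' (by fun_prop) (ae_of_all _ fun x => ?_)
    rw [Real.norm_of_nonneg (by positivity)]
    exact mul_le_of_le_one_right (sq_nonneg _) (min_le_left _ _)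
  set A := ∫ x, x ^ 2 ∂ν with hA
  set b := ∫ x, x ∂ν with hb
  set T := ∫ x, x ^ 2 * min 1 |θ * x| ∂ν with hT
  have hi1' : Integrable (fun x : ℝ => (x : ℂ)) ν := hi1.ofReal
  have hi2' : Integrable (fun x : ℝ => ((x ^ 2 : ℝ) : ℂ)) ν := hi.ofReal
  have hmain : Integrable (fun x : ℝ => (1 : ℂ) + (θ * Complex.I) * x -
      (θ ^ 2 / 2) * ((x ^ 2 : ℝ) : ℂ)) ν :=
    ((integrable_const _).add (hi1'.const_mul _)).sub (hi2'.const_mul _)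
  have hexp : Integrable (fun x : ℝ => Complex.exp ((θ * x : ℝ) * Complex.I)) ν := by
    refine (integrable_const (1 : ℝ)).mono' (by fun_prop) (ae_of_all _ fun x => ?_)
    rw [Complex.norm_exp_ofReal_mul_I]
  have hmainE : ∫ x : ℝ, ((1 : ℂ) + (θ * Complex.I) * x -
      (θ ^ 2 / 2) * ((x ^ 2 : ℝ) : ℂ)) ∂ν =
      1 + ((θ * b : ℝ) : ℂ) * Complex.I - ((θ ^ 2 * A / 2 : ℝ) : ℂ) := by
    have h1 : Integrable (fun x : ℝ => (1 : ℂ) + (θ * Complex.I) * x) ν :=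
      (integrable_const _).add (hi1'.const_mul _)
    rw [integral_sub h1 (hi2'.const_mul _),
      integral_add (integrable_const _) (hi1'.const_mul _), integral_const_mul, integral_const_mul,
      integral_complex_ofReal, integral_complex_ofReal]
    simp only [integral_const, probReal_univ, one_smul, Complex.ofReal_mul, Complex.ofReal_div,
      Complex.ofReal_pow, Complex.ofReal_ofNat, ← hA, ← hb]
    ring
  have hR : ‖charFun ν θ - (1 + ((θ * b : ℝ) : ℂ) * Complex.I - ((θ ^ 2 * A / 2 : ℝ) : ℂ))‖ ≤
      4 * θ ^ 2 * T := by
    have hcf : charFun ν θ = ∫ x : ℝ, Complex.exp ((θ * x : ℝ) * Complex.I) ∂ν := by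
      rw [charFun_apply_real]
      simp
    rw [hcf, ← hmainE, ← integral_sub hexp hmain]
    rw [hT, ← integral_const_mul]
    refine norm_integral_le_of_norm_le (hiT.const_mul _) (ae_of_all _ fun x => ?_)
    have := norm_cexp_sub_taylor_two_le (θ * x)
    rw [mul_pow] at this
    calc _ = _ := by
          congr 2
          push_cast
          ring
      _ ≤ _ := this
      _ = _ := by ring
  have hn : ‖charFun ν θ‖ ≤ 1 + (-(θ ^ 2 * A / 2) + (((θ ^ 2 * A / 2) ^ 2 + (θ * b) ^ 2) / 2 +
      4 * θ ^ 2 * T)) := by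
    have h1 := norm_one_add_mul_I_sub_le (θ ^ 2 * A / 2) (θ * b)
    have h2 := norm_le_norm_add_norm_sub'
      (charFun ν θ) (1 + ((θ * b : ℝ) : ℂ) * Complex.I - ((θ ^ 2 * A / 2 : ℝ) : ℂ))
    linarith
  calc ‖charFun ν θ‖ ^ n ≤ (Real.exp (-(θ ^ 2 * A / 2) + (((θ ^ 2 * A / 2) ^ 2 + (θ * b) ^ 2) / 2 +
      4 * θ ^ 2 * T))) ^ n := by
        gcongr
        refine hn.trans ?_
        rw [add_comm]
        exact Real.add_one_le_exp _
    _ = _ := by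
        rw [← Real.exp_nat_mul]
        congr 1
        ring

/-- Anticoncentration at the origin for normalised row sums of a triangular array which satisfies
a Lindeberg condition and whose row means are negligible. -/
theorem exists_measure_abs_sum_le {Ω : Type*} [MeasurableSpace Ω] {P : Measure Ω}
    [IsProbabilityMeasure P] {l : Filter ℕ} [l.IsCountablyGenerated] (hl : l ≤ atTop)
    {Y : ℕ → ℕ → Ω → ℝ} {ν : ℕ → Measure ℝ} (hν : ∀ n, IsProbabilityMeasure (ν n))
    (hY : ∀ n p, Measurable (Y n p)) (hlaw : ∀ n p, P.map (Y n p) = ν n)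
    (hind : ∀ n, iIndepFun (Y n) P)
    {c D : ℝ} (hc : 0 < c) (hi : ∀ᶠ n in l, Integrable (fun x : ℝ => x ^ 2) (ν n))
    (hlow : ∀ᶠ n : ℕ in l, c ≤ n * ∫ x, x ^ 2 ∂(ν n))
    (hup : ∀ᶠ n : ℕ in l, n * ∫ x, x ^ 2 ∂(ν n) ≤ D)
    (hmean : Tendsto (fun n : ℕ => n * (∫ x, x ∂(ν n)) ^ 2) l (𝓝 0))
    (htail : ∀ θ : ℝ, Tendsto (fun n : ℕ => n * ∫ x, x ^ 2 * min 1 |θ * x| ∂(ν n)) l (𝓝 0))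
    {ε : ℝ} (hε : 0 < ε) :
    ∃ η : ℝ, 0 < η ∧ ∀ᶠ n in l,
      P {ω | |∑ p ∈ Finset.range n, Y n p ω| ≤ η} ≤ ENNReal.ofReal ε := by
  set γ := gaussianReal 0 1 with hγ
  have hγ0 : ∀ᵐ θ ∂γ, θ ≠ (0 : ℝ) := by
    have : NullSingletonClass γ := nullSingletonClass_gaussianReal (by norm_num)
    exact compl_mem_ae_iff.2 (measure_singleton 0)
  -- choice of the radius
  have hE0 : Tendsto (fun η : ℝ => ∫ θ, Real.exp (-(c * (θ / η) ^ 2 / 4)) ∂γ) (𝓝[>] 0) (𝓝 0) := by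
    have h0 : (0 : ℝ) = ∫ _θ : ℝ, (0 : ℝ) ∂γ := by simp
    suffices h3 : Tendsto (fun η : ℝ => ∫ θ, Real.exp (-(c * (θ / η) ^ 2 / 4)) ∂γ) (𝓝[>] 0)
        (𝓝 (∫ _θ : ℝ, (0 : ℝ) ∂γ)) by rwa [← h0] at h3
    refine tendsto_integral_filter_of_dominated_convergence (fun _ => 1)
      (Eventually.of_forall fun η => by fun_prop) (Eventually.of_forall fun η => ae_of_all _ fun θ => ?_)
      (integrable_const _) (hγ0.mono fun θ hθ => ?_)
    · rw [Real.norm_of_nonneg (Real.exp_pos _).le]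
      exact Real.exp_le_one_iff.2 (by have := sq_nonneg (θ / η); nlinarith)
    · refine Real.tendsto_exp_neg_atTop_nhds_zero.comp ?_
      have h1 : Tendsto (fun η : ℝ => (η⁻¹) ^ 2) (𝓝[>] 0) atTop :=
        (tendsto_pow_atTop (by norm_num)).comp tendsto_inv_nhdsGT_zero
      have h2 : 0 < c * θ ^ 2 / 4 := by positivity
      refine (h1.const_mul_atTop h2).congr fun η => ?_
      ring
  have hsel : ∀ᶠ η : ℝ in 𝓝[>] 0, 0 < η ∧
      ∫ θ, Real.exp (-(c * (θ / η) ^ 2 / 4)) ∂γ < ε / Real.exp (1 / 2) :=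
    (eventually_mem_nhdsWithin).and (hE0.eventually_lt_const (by positivity))
  obtain ⟨η, hη, hEη⟩ := hsel.exists
  refine ⟨η, hη, ?_⟩
  -- the characteristic functions of the sums
  have hSm : ∀ n, Measurable (fun ω => ∑ p ∈ Finset.range n, Y n p ω) := fun n =>
    Finset.measurable_fun_sum _ fun p _ => hY n p
  have hcf : ∀ n θ, charFun (P.map (fun ω => ∑ p ∈ Finset.range n, Y n p ω)) θ =
      charFun (ν n) θ ^ n := by
    intro n θ
    rw [((hind n).restrict _).charFun_map_fun_finsetSum_eq_prod (fun p _ => (hY n p).aemeasurable)]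
    simp [hlaw]
  -- The leading exponent is at most -cθ²/2; half of it is given up to the remainder, which tends to
  -- 0.
  have hpt : ∀ θ : ℝ, θ ≠ 0 → ∀ᶠ n in l,
      ‖charFun (ν n) θ‖ ^ n ≤ Real.exp (-(c * θ ^ 2 / 4)) := by
    intro θ hθ
    have hninv : Tendsto (fun n : ℕ => ((n : ℝ))⁻¹) l (𝓝 0) :=
      tendsto_inv_atTop_nhds_zero_nat.mono_left hl
    have e1 : Tendsto (fun n : ℕ => (θ ^ 2 * D / 2) ^ 2 / 2 * ((n : ℝ))⁻¹ +
        θ ^ 2 / 2 * (n * (∫ x, x ∂(ν n)) ^ 2) +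
        4 * θ ^ 2 * (n * ∫ x, x ^ 2 * min 1 |θ * x| ∂(ν n))) l (𝓝 0) := by
      simpa using ((hninv.const_mul _).add (hmean.const_mul (θ ^ 2 / 2))).add
        ((htail θ).const_mul (4 * θ ^ 2))
    have hθ2 : 0 < θ ^ 2 := by positivity
    filter_upwards [e1.eventually_lt_const (show 0 < c * θ ^ 2 / 4 by positivity), hi, hlow, hup,
      hl (eventually_gt_atTop 0)] with n h1 hin hln hun hn
    refine (norm_charFun_pow_le (ν n) hin θ n).trans (Real.exp_le_exp.2 ?_)
    have hn' : (0 : ℝ) < n := by exact_mod_cast hn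
    have hA0 : 0 ≤ ∫ x, x ^ 2 ∂(ν n) := integral_nonneg fun x => sq_nonneg x
    have h2 : (θ ^ 2 * (∫ x, x ^ 2 ∂(ν n)) / 2) * (θ ^ 2 * (n * ∫ x, x ^ 2 ∂(ν n)) / 2) / 2 ≤
        (θ ^ 2 * D / 2) ^ 2 / 2 * ((n : ℝ))⁻¹ := by
      have h3 : (θ ^ 2 * (n * ∫ x, x ^ 2 ∂(ν n)) / 2) ^ 2 ≤ (θ ^ 2 * D / 2) ^ 2 := by
        gcongr
      calc _ = (θ ^ 2 * (n * ∫ x, x ^ 2 ∂(ν n)) / 2) ^ 2 / 2 * ((n : ℝ))⁻¹ := by field_simp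
        _ ≤ _ := by gcongr
    have h4 : θ ^ 2 * c ≤ θ ^ 2 * (n * ∫ x, x ^ 2 ∂(ν n)) := by gcongr
    linarith
  -- dominated convergence
  have hlim : Tendsto (fun n : ℕ => ∫ θ, max (‖charFun (ν n) (θ / η)‖ ^ n)
      (Real.exp (-(c * (θ / η) ^ 2 / 4))) ∂γ) l
      (𝓝 (∫ θ, Real.exp (-(c * (θ / η) ^ 2 / 4)) ∂γ)) := by
    refine tendsto_integral_filter_of_dominated_convergence (fun _ => 1)
      (Eventually.of_forall fun n => ?_) (Eventually.of_forall fun n => ae_of_all _ fun θ => ?_)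
      (integrable_const _) (hγ0.mono fun θ hθ => ?_)
    · have : Measurable (charFun (ν n)) := measurable_charFun
      exact Measurable.aestronglyMeasurable (by fun_prop)
    · rw [Real.norm_of_nonneg (le_max_of_le_right (Real.exp_pos _).le)]
      refine max_le (pow_le_one₀ (norm_nonneg _) (norm_charFun_le_one _)) ?_
      exact Real.exp_le_one_iff.2 (by have := sq_nonneg (θ / η); nlinarith)
    -- The powers of the characteristic functions need not converge. Their maximum with the target
    -- does, because it is eventually equal to the target.
    · refine tendsto_const_nhds.congr' ?_
      filter_upwards [hpt (θ / η) (div_ne_zero hθ hη.ne')] with n hn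
      rw [max_eq_right hn]
  filter_upwards [hlim.eventually_lt_const hEη] with n hn
  have hprob : IsProbabilityMeasure (P.map (fun ω => ∑ p ∈ Finset.range n, Y n p ω)) :=
    Measure.isProbabilityMeasure_map (hSm n).aemeasurable
  have hsmall := measureReal_abs_le_le_integral_norm_charFun
    (P.map (fun ω => ∑ p ∈ Finset.range n, Y n p ω)) hη
  have hms : MeasurableSet {y : ℝ | |y| ≤ η} := measurableSet_le (by fun_prop) (by fun_prop)
  have hcm : Measurable (charFun (ν n)) := measurable_charFun
  have hle : ∫ θ, ‖charFun (P.map (fun ω => ∑ p ∈ Finset.range n, Y n p ω)) (θ / η)‖ ∂γ ≤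
      ∫ θ, max (‖charFun (ν n) (θ / η)‖ ^ n) (Real.exp (-(c * (θ / η) ^ 2 / 4))) ∂γ := by
    simp_rw [hcf, norm_pow]
    refine integral_mono_of_nonneg (ae_of_all _ fun θ => by positivity) ?_
      (ae_of_all _ fun θ => le_max_left _ _)
    refine (integrable_const (1 : ℝ)).mono' (Measurable.aestronglyMeasurable (by fun_prop))
      (ae_of_all _ fun θ => ?_)
    rw [Real.norm_of_nonneg (le_max_of_le_right (Real.exp_pos _).le)]
    refine max_le (pow_le_one₀ (norm_nonneg _) (norm_charFun_le_one _)) ?_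
    exact Real.exp_le_one_iff.2 (by have := sq_nonneg (θ / η); nlinarith)
  rw [lt_div_iff₀ (Real.exp_pos _)] at hn
  have hfin : (P.map (fun ω => ∑ p ∈ Finset.range n, Y n p ω)).real {y | |y| ≤ η} ≤ ε := by
    refine hsmall.trans ?_
    have := mul_le_mul_of_nonneg_left hle (Real.exp_pos (1 / 2)).le
    linarith
  have hmap : P {ω | |∑ p ∈ Finset.range n, Y n p ω| ≤ η} =
      P.map (fun ω => ∑ p ∈ Finset.range n, Y n p ω) {y | |y| ≤ η} := by
    rw [Measure.map_apply (hSm n) hms]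
    rfl
  rw [hmap, ← ENNReal.ofReal_toReal (measure_ne_top _ _)]
  exact ENNReal.ofReal_le_ofReal hfin

end Anticoncentration

end

/-! ### Anticoncentration of the oscillating kernel sums -/

noncomputable section

section KernelAnticoncentration

variable {Ω : Type*} [MeasurableSpace Ω] {k : ℕ} {P : Measure Ω} [IsProbabilityMeasure P]
  {X : ℕ → Ω → EuclideanSpace ℝ (Fin k)} {Z : ℕ → Ω → ℝ}
  {K : EuclideanSpace ℝ (Fin k) → ℝ} {α : ℝ}
  {fX m₁ m₂ : EuclideanSpace ℝ (Fin k) → ℝ} {lam : ℝ} {F₁ F₂ : Measure ℝ}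
  [IsProbabilityMeasure F₁] [IsProbabilityMeasure F₂] {C : ℝ}

/-- Expectation of a localised weight. -/
theorem MixtureSetup.integral_weight (H : MixtureSetup P X Z K α fX lam m₁ m₂ F₁ F₂ C) (p : ℕ)
    (x : EuclideanSpace ℝ (Fin k)) {L : EuclideanSpace ℝ (Fin k) → ℝ} (hLm : Measurable L)
    (hL : Integrable (fun U => Real.exp (α * ‖U‖) * |L U|)) {h : ℝ} (hh : 0 < h) :
    Integrable (fun ω => L (h⁻¹ • (X p ω - x))) P ∧
    ∫ ω, L (h⁻¹ • (X p ω - x)) ∂P = h ^ k * ∫ U, L U * fX (x + h • U) := by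
  obtain ⟨hi, he⟩ := H.integral_term p x hLm hL hh (z := 0) (by simpa using H.kernel.pos.le)
    (by simp) (by simp)
  simp only [zero_mul, Complex.exp_zero, one_mul] at hi he
  have hi' := hi.re
  simp only [RCLike.re_to_complex, Complex.ofReal_re] at hi'
  refine ⟨hi', ?_⟩
  have hM : ∀ (F : Measure ℝ) [IsProbabilityMeasure F], complexMGF id F 0 = 1 := by
    intro F _; simp [complexMGF]
  have hloc : ∀ m, localMean L fX m x h 0 = ((∫ U, L U * fX (x + h • U) : ℝ) : ℂ) := by
    intro m
    rw [localMean, ← integral_complex_ofReal]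
    simp
  rw [integral_complex_ofReal, mixtureMean, hM, hM, hloc, hloc] at he
  have : ((∫ ω, L (h⁻¹ • (X p ω - x)) ∂P : ℝ) : ℂ) =
      ((h ^ k * ∫ U, L U * fX (x + h • U) : ℝ) : ℂ) := by
    rw [he]
    push_cast
    ring
  exact_mod_cast this

/-- The second moment of the kernel weights, normalised by `hᵏ`, converges. -/
theorem MixtureSetup.tendsto_integral_sq (H : MixtureSetup P X Z K α fX lam m₁ m₂ F₁ F₂ C)
    (x : EuclideanSpace ℝ (Fin k)) {h : ℕ → ℝ} (hh0 : Tendsto h atTop (𝓝 0)) :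
    Tendsto (fun n => ∫ U, K U ^ 2 * fX (x + h n • U)) atTop (𝓝 (fX x * ∫ U, K U ^ 2)) := by
  have hKm := H.kernel.measurable
  have hfm := H.measurable_density
  rw [← integral_const_mul]
  refine tendsto_integral_of_dominated_convergence (fun U => C * K U ^ 2)
    (fun n => Measurable.aestronglyMeasurable (by fun_prop)) (H.kernel.integrable_sq.const_mul C)
    (fun n => ae_of_all _ fun U => ?_) (ae_of_all _ fun U => ?_)
  · rw [norm_mul, Real.norm_of_nonneg (sq_nonneg _), mul_comm, Real.norm_eq_abs]
    gcongr
    exact H.density_le _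
  · have h1 : Tendsto (fun n => fX (x + h n • U)) atTop (𝓝 (fX x)) := by
      rw [tendsto_iff_norm_sub_tendsto_zero]
      have h2 : Tendsto (fun n => C * ‖h n • U‖) atTop (𝓝 0) := by
        have h3 := ((hh0.smul_const U).norm).const_mul C
        simpa using h3
      exact squeeze_zero (fun n => norm_nonneg _)
        (fun n => (H.taylor_density x).abs_sub_le (h n • U)) h2
    simpa [mul_comm] using h1.const_mul (K U ^ 2)

/-- Truncated second moments of the kernel vanish. -/
theorem IsMeasurableKernel.tendsto_integral_sq_mul_min (hK : IsMeasurableKernel K α) {τ : ℕ → ℝ}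
    {l : Filter ℕ} [l.IsCountablyGenerated] (hτ : Tendsto τ l (𝓝 0)) :
    Tendsto (fun n => ∫ U, K U ^ 2 * min 1 |τ n * K U|) l (𝓝 0) := by
  have hKm := hK.measurable
  have h0 : ∫ _U : EuclideanSpace ℝ (Fin k), (0 : ℝ) = 0 := by simp
  suffices h3 : Tendsto (fun n => ∫ U, K U ^ 2 * min 1 |τ n * K U|) l
      (𝓝 (∫ _U : EuclideanSpace ℝ (Fin k), (0 : ℝ))) by rwa [h0] at h3
  refine tendsto_integral_filter_of_dominated_convergence (fun U => K U ^ 2)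
    (Eventually.of_forall fun n => Measurable.aestronglyMeasurable (by fun_prop))
    (Eventually.of_forall fun n => ae_of_all _ fun U => ?_) hK.integrable_sq
    (ae_of_all _ fun U => ?_)
  · rw [Real.norm_of_nonneg (by positivity)]
    exact mul_le_of_le_one_right (sq_nonneg _) (min_le_left _ _)
  · have h1 : Tendsto (fun n => |τ n * K U|) l (𝓝 0) := by
      simpa using (hτ.mul_const (K U)).abs
    have h2 : Tendsto (fun n => min 1 |τ n * K U|) l (𝓝 0) :=
      squeeze_zero (fun n => by positivity) (fun n => min_le_right _ _) h1
    simpa using h2.const_mul (K U ^ 2)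

/-- Anticoncentration at the origin of the oscillating kernel sums, when their mean vanishes. -/
theorem MixtureSetup.exists_measure_norm_kernelSum_le
    (H : MixtureSetup P X Z K α fX lam m₁ m₂ F₁ F₂ C)
    (x : EuclideanSpace ℝ (Fin k)) (hx : 0 < fX x) {h : ℕ → ℝ} {z : ℕ → ℂ}
    (hh : ∀ᶠ n in atTop, 0 < h n) (hh0 : Tendsto h atTop (𝓝 0))
    (hnh : Tendsto (fun n : ℕ => (n : ℝ) * h n ^ k) atTop atTop)
    (hzh : Tendsto (fun n => ‖z n‖ * h n) atTop (𝓝 0)) (hre : ∀ n, (z n).re = 0)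
    {l : Filter ℕ} [l.IsCountablyGenerated] (hl : l ≤ atTop)
    (hmean : Tendsto (fun n => ‖mixtureMean K fX lam m₁ m₂ F₁ F₂ x (h n) (z n)‖) l (𝓝 0))
    {ε : ℝ} (hε : 0 < ε) :
    ∃ η : ℝ, 0 < η ∧ ∀ᶠ n in l,
      P {ω | ‖kernelSum K X Z n (h n) x (z n) ω / (n * h n ^ k : ℝ)‖ ≤ η * √(1 / (n * h n ^ k))} ≤
        ENNReal.ofReal ε := by
  have hKm := H.kernel.measurable
  have hα := H.kernel.pos
  have hC := H.one_le
  set W : ℕ → ℕ → Ω → ℂ := fun n p ω =>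
    Complex.exp (z n * Z p ω) * (K ((h n)⁻¹ • (X p ω - x)) : ℂ) with hW
  have hWm : ∀ n p, Measurable (W n p) := fun n p => by
    have := H.sample.measurable_X p
    have := H.sample.measurable_Z p
    fun_prop
  have hWnorm : ∀ n p ω, ‖W n p ω‖ = |K ((h n)⁻¹ • (X p ω - x))| := by
    intro n p ω
    rw [hW, norm_mul, Complex.norm_exp, Complex.norm_real, Real.norm_eq_abs]
    simp [hre]
  have hsq : ∀ a : ℂ, ‖a‖ ^ 2 = a.re ^ 2 + a.im ^ 2 := fun a => by
    rw [Complex.sq_norm, Complex.normSq_apply]; ring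
  have hexpsq : Integrable (fun U => Real.exp (α * ‖U‖) * |K U ^ 2|) := by
    simpa only [abs_sq] using H.kernel.exp_sq
  -- second moments
  have hsecond : ∀ n, 0 < h n → Integrable (fun ω => ‖W n 0 ω‖ ^ 2) P ∧
      ∫ ω, ‖W n 0 ω‖ ^ 2 ∂P = h n ^ k * ∫ U, K U ^ 2 * fX (x + h n • U) := by
    intro n hn
    simp_rw [hWnorm, sq_abs]
    exact H.integral_weight 0 x (L := fun U => K U ^ 2) (by fun_prop) hexpsq hn
  -- the direction carrying at least half of the second moment
  have hdir : ∀ n, ∃ φ : ℂ →L[ℝ] ℝ, (∀ a, |φ a| ≤ ‖a‖) ∧ (0 < h n →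
      ∫ ω, ‖W n 0 ω‖ ^ 2 ∂P ≤ 2 * ∫ ω, φ (W n 0 ω) ^ 2 ∂P) := by
    intro n
    by_cases hn : 0 < h n
    · have hLp : MemLp (W n 0) 2 P :=
        (memLp_two_iff_integrable_sq_norm (hWm n 0).aestronglyMeasurable).2 (hsecond n hn).1
      have i1 : Integrable (fun ω => (W n 0 ω).re ^ 2) P :=
        (Complex.reCLM.comp_memLp' hLp).integrable_sq
      have i2 : Integrable (fun ω => (W n 0 ω).im ^ 2) P :=
        (Complex.imCLM.comp_memLp' hLp).integrable_sq
      have hadd : ∫ ω, ‖W n 0 ω‖ ^ 2 ∂P =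
          ∫ ω, (W n 0 ω).re ^ 2 ∂P + ∫ ω, (W n 0 ω).im ^ 2 ∂P := by
        rw [← integral_add i1 i2]
        simp_rw [hsq]
      rcases le_total (∫ ω, (W n 0 ω).re ^ 2 ∂P) (∫ ω, (W n 0 ω).im ^ 2 ∂P) with hle | hle
      · refine ⟨Complex.imCLM, Complex.abs_im_le_norm, fun _ => ?_⟩
        simp only [Complex.imCLM_apply]
        linarith
      · refine ⟨Complex.reCLM, Complex.abs_re_le_norm, fun _ => ?_⟩
        simp only [Complex.reCLM_apply]
        linarith
    · exact ⟨Complex.reCLM, Complex.abs_re_le_norm, fun h' => absurd h' hn⟩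
  choose φ hφ hφ2 using hdir
  -- With this scale n σ² = h⁻ᵏ, which compensates the order hᵏ of a single second moment, and σ
  -- times the unnormalised sum measures the normalised sum in units of σ.
  set σ : ℕ → ℝ := fun n => √(1 / (n * h n ^ k)) with hσ
  set Y : ℕ → ℕ → Ω → ℝ := fun n p ω => σ n * φ n (W n p ω) with hYdef
  have hYm : ∀ n p, Measurable (Y n p) := fun n p =>
    ((φ n).measurable.comp (hWm n p)).const_mul _
  have hψm : ∀ n, Measurable (fun q : EuclideanSpace ℝ (Fin k) × ℝ =>
      σ n * φ n (Complex.exp (z n * q.2) * (K ((h n)⁻¹ • (q.1 - x)) : ℂ))) := fun n => by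
    fun_prop
  have hind : ∀ n, iIndepFun (Y n) P := fun n => H.sample.indep.comp
    (fun _ q => σ n * φ n (Complex.exp (z n * q.2) * (K ((h n)⁻¹ • (q.1 - x)) : ℂ)))
    (fun _ => hψm n)
  have hlaw : ∀ n p, P.map (Y n p) = P.map (Y n 0) := by
    have hpair : ∀ p, P.map (fun ω => (X p ω, Z p ω)) = P.map (fun ω => (X 0 ω, Z 0 ω)) := by
      intro p
      rw [H.sample.law_pair H.measurable₁ H.measurable₂ p,
        H.sample.law_pair H.measurable₁ H.measurable₂ 0, H.sample.law_X p, H.sample.law_X 0]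
    intro n p
    have hc : ∀ p, P.map (Y n p) = (P.map (fun ω => (X p ω, Z p ω))).map
        (fun q => σ n * φ n (Complex.exp (z n * q.2) * (K ((h n)⁻¹ • (q.1 - x)) : ℂ))) := by
      intro p
      rw [Measure.map_map (hψm n) ((H.sample.measurable_X p).prodMk (H.sample.measurable_Z p))]
      rfl
    rw [hc p, hc 0, hpair p]
  have hmap : ∀ n (g : ℝ → ℝ), Measurable g →
      ∫ y, g y ∂(P.map (Y n 0)) = ∫ ω, g (Y n 0 ω) ∂P := fun n g hg =>
    integral_map (hYm n 0).aemeasurable hg.aestronglyMeasurable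
  have hφsq : ∀ n a, φ n a ^ 2 ≤ ‖a‖ ^ 2 := fun n a => by
    rw [← sq_abs]
    exact pow_le_pow_left₀ (abs_nonneg _) (hφ n a) 2
  have hφi : ∀ n, 0 < h n → Integrable (fun ω => φ n (W n 0 ω) ^ 2) P := fun n hn =>
    (hsecond n hn).1.mono' (((φ n).measurable.comp (hWm n 0)).pow_const 2).aestronglyMeasurable
      (ae_of_all _ fun ω => by
        rw [Real.norm_of_nonneg (sq_nonneg _)]
        exact hφsq n _)
  have hpos : ∀ᶠ n : ℕ in atTop, 0 < h n ∧ (0 : ℝ) < n ∧ 0 < (n : ℝ) * h n ^ k ∧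
      n * σ n ^ 2 = (h n ^ k)⁻¹ := by
    filter_upwards [hh, eventually_gt_atTop 0] with n h1 h2
    have h2' : (0 : ℝ) < n := by exact_mod_cast h2
    have h3 : 0 < (n : ℝ) * h n ^ k := by positivity
    refine ⟨h1, h2', h3, ?_⟩
    rw [hσ, Real.sq_sqrt (by positivity)]
    field_simp
  set v := fX x * ∫ U, K U ^ 2 with hv
  have hv0 : 0 < v := mul_pos hx H.kernel.integral_sq_pos
  have hκ := H.tendsto_integral_sq x hh0
  have hmom : ∀ n, 0 < h n → n * σ n ^ 2 = (h n ^ k)⁻¹ →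
      n * ∫ y, y ^ 2 ∂(P.map (Y n 0)) = (h n ^ k)⁻¹ * ∫ ω, φ n (W n 0 ω) ^ 2 ∂P := by
    intro n h1 h4
    rw [hmap n _ (by fun_prop), ← h4]
    simp_rw [hYdef, mul_pow]
    rw [integral_const_mul]
    ring
  -- The integrals of K² against the density tend to v, hence eventually lie between v/2 and 2v; the
  -- chosen direction keeps at least half, which explains v/4.
  obtain ⟨η, hη, hev⟩ := exists_measure_abs_sum_le (P := P) hl (Y := Y)
    (ν := fun n => P.map (Y n 0))
    (fun n => Measure.isProbabilityMeasure_map (hYm n 0).aemeasurable) hYm hlaw hind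
    (c := v / 4) (D := 2 * v) (by positivity)
    (by
      filter_upwards [hl hpos] with n ⟨h1, _⟩
      rw [integrable_map_measure (Measurable.aestronglyMeasurable (by fun_prop))
        (hYm n 0).aemeasurable]
      have := (hφi n h1).const_mul (σ n ^ 2)
      refine this.congr (ae_of_all _ fun ω => ?_)
      simp only [hYdef, Function.comp, mul_pow])
    (by
      filter_upwards [hl hpos, hl (hκ.eventually_const_lt (show v / 2 < v by linarith))]
        with n ⟨h1, h2, h3, h4⟩ h5
      have h6 := hφ2 n h1
      rw [(hsecond n h1).2] at h6
      rw [hmom n h1 h4, ← div_eq_inv_mul, le_div_iff₀ (by positivity)]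
      have h7 : 0 < h n ^ k := by positivity
      nlinarith)
    (by
      filter_upwards [hl hpos, hl (hκ.eventually_lt_const (show v < 2 * v by linarith))]
        with n ⟨h1, h2, h3, h4⟩ h5
      have h6 : ∫ ω, φ n (W n 0 ω) ^ 2 ∂P ≤ ∫ ω, ‖W n 0 ω‖ ^ 2 ∂P :=
        integral_mono (hφi n h1) (hsecond n h1).1 fun ω => hφsq n _
      rw [(hsecond n h1).2] at h6
      rw [hmom n h1 h4, ← div_eq_inv_mul, div_le_iff₀ (by positivity)]
      have h7 : 0 < h n ^ k := by positivity
      nlinarith)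
    (by
      have hsm : ∀ᶠ n in atTop, ‖z n‖ * h n < α / C := hzh.eventually_lt_const (by positivity)
      have hle1 : ∀ᶠ n in atTop, h n < 1 := hh0.eventually_lt_const one_pos
      have hm2 := hmean.pow 2
      rw [zero_pow two_ne_zero] at hm2
      -- The quantity is at most hᵏ times the squared norm of the mean. For k ≥ 1 the factor hᵏ
      -- alone would tend to 0; for k = 0 the vanishing of the mean is essential.
      refine squeeze_zero' (Eventually.of_forall fun n => by positivity) ?_ hm2
      filter_upwards [hl hpos, hl hsm, hl hle1] with n ⟨h1, h2, h3, h4⟩ h5 h6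
      have hz : C * ‖z n‖ * h n ≤ α := by
        rw [lt_div_iff₀ (by positivity)] at h5
        linarith
      obtain ⟨hWi, hWE⟩ := H.integral_term 0 x hKm H.kernel.exp_abs h1 hz
        (by simp [hre]) (by simp [hre])
      rw [hmap n _ measurable_id']
      simp_rw [hYdef]
      rw [integral_const_mul, ContinuousLinearMap.integral_comp_comm (φ n) hWi, hWE, mul_pow,
        ← mul_assoc, h4]
      have h7 := hφsq n ((h n : ℂ) ^ k * mixtureMean K fX lam m₁ m₂ F₁ F₂ x (h n) (z n))
      rw [norm_mul, norm_pow, Complex.norm_real, Real.norm_of_nonneg h1.le, mul_pow] at h7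
      have h8 : h n ^ k ≤ 1 := pow_le_one₀ h1.le h6.le
      have h9 : 0 < h n ^ k := by positivity
      rw [← div_eq_inv_mul, div_le_iff₀ h9]
      refine h7.trans ?_
      rw [mul_comm]
      gcongr
      nlinarith)
    (by
      intro θ
      have hσ0 : Tendsto σ atTop (𝓝 0) := by
        have h1 : Tendsto (fun n : ℕ => 1 / ((n : ℝ) * h n ^ k)) atTop (𝓝 0) := by
          simp only [one_div]
          exact hnh.inv_tendsto_atTop
        have h2 := h1.sqrt
        rwa [Real.sqrt_zero] at h2
      have hτ : Tendsto (fun n => θ * σ n) l (𝓝 0) := by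
        simpa using (hσ0.const_mul θ).mono_left hl
      have ht := (H.kernel.tendsto_integral_sq_mul_min hτ).const_mul C
      rw [mul_zero] at ht
      refine squeeze_zero' (Eventually.of_forall fun n => mul_nonneg (Nat.cast_nonneg _)
        (integral_nonneg fun y => by positivity)) ?_ ht
      filter_upwards [hl hpos] with n ⟨h1, h2, h3, h4⟩
      set τ := θ * σ n with hτdef
      have hLexp : Integrable (fun U => Real.exp (α * ‖U‖) * |K U ^ 2 * min 1 (|τ * K U|)|) := by
        refine H.kernel.exp_sq.mono' (Measurable.aestronglyMeasurable (by fun_prop))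
          (ae_of_all _ fun U => ?_)
        rw [norm_mul, Real.norm_of_nonneg (Real.exp_pos _).le, norm_abs_eq_norm,
          Real.norm_of_nonneg (by positivity)]
        gcongr
        exact mul_le_of_le_one_right (sq_nonneg _) (min_le_left _ _)
      obtain ⟨wi, we⟩ := H.integral_weight 0 x (L := fun U => K U ^ 2 * min 1 |τ * K U|)
        (by fun_prop) hLexp h1
      rw [hmap n _ (by fun_prop)]
      -- At an imaginary frequency the summand has modulus |K|, and the functional does not increase
      -- moduli. The oscillation disappears, and the Lindeberg condition reduces to truncated second
      -- moments of K.
      have hptw : ∀ ω, Y n 0 ω ^ 2 * min 1 |θ * Y n 0 ω| ≤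
          σ n ^ 2 * (K ((h n)⁻¹ • (X 0 ω - x)) ^ 2 * min 1 |τ * K ((h n)⁻¹ • (X 0 ω - x))|) := by
        intro ω
        have e1 : |φ n (W n 0 ω)| ≤ |K ((h n)⁻¹ • (X 0 ω - x))| := by
          rw [← hWnorm]; exact hφ n _
        have e2 : φ n (W n 0 ω) ^ 2 ≤ K ((h n)⁻¹ • (X 0 ω - x)) ^ 2 := sq_le_sq.2 e1
        have e3 : |θ * Y n 0 ω| ≤ |τ * K ((h n)⁻¹ • (X 0 ω - x))| := by
          rw [show θ * Y n 0 ω = τ * φ n (W n 0 ω) by simp only [hYdef, hτdef]; ring,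
            abs_mul τ, abs_mul τ]
          exact mul_le_mul_of_nonneg_left e1 (abs_nonneg τ)
        refine (mul_le_mul ?_ (min_le_min le_rfl e3) (by positivity) (by positivity)).trans_eq
          (mul_assoc _ _ _)
        simp only [hYdef, mul_pow]
        gcongr
      have hint : ∫ ω, Y n 0 ω ^ 2 * min 1 |θ * Y n 0 ω| ∂P ≤
          σ n ^ 2 * (h n ^ k * ∫ U, K U ^ 2 * min 1 |τ * K U| * fX (x + h n • U)) := by
        rw [← we, ← integral_const_mul]
        exact integral_mono_of_nonneg (ae_of_all _ fun ω => by positivity) (wi.const_mul _)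
          (ae_of_all _ hptw)
      have hfle : ∫ U, K U ^ 2 * min 1 |τ * K U| * fX (x + h n • U) ≤
          C * ∫ U, K U ^ 2 * min 1 |τ * K U| := by
        rw [← integral_const_mul]
        have hi0 : Integrable (fun U => K U ^ 2 * min 1 |τ * K U|) :=
          H.kernel.integrable_sq.mono' (Measurable.aestronglyMeasurable (by fun_prop))
            (ae_of_all _ fun U => by
              rw [Real.norm_of_nonneg (by positivity)]
              exact mul_le_of_le_one_right (sq_nonneg _) (min_le_left _ _))
        refine integral_mono_of_nonneg (ae_of_all _ fun U => ?_) (hi0.const_mul C)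
          (ae_of_all _ fun U => ?_)
        · exact mul_nonneg (by positivity) (H.sample.density_nonneg _)
        · simp only
          rw [mul_comm C]
          gcongr
          exact (le_abs_self _).trans (H.density_le _)
      calc _ ≤ n * (σ n ^ 2 * (h n ^ k * (C * ∫ U, K U ^ 2 * min 1 |τ * K U|))) := by
            gcongr
            exact hint.trans (by gcongr)
        _ = (n * σ n ^ 2) * h n ^ k * (C * ∫ U, K U ^ 2 * min 1 |τ * K U|) := by ring
        _ = _ := by
            rw [h4, inv_mul_cancel₀ (by positivity), one_mul])
    hε
  refine ⟨η, hη, ?_⟩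
  filter_upwards [hev, hl hpos] with n hn ⟨h1, h2, h3, h4⟩
  refine (measure_mono fun ω hω => ?_).trans hn
  rw [Set.mem_ofPred_eq] at hω ⊢
  have hsum : ∑ p ∈ Finset.range n, Y n p ω = σ n * φ n (kernelSum K X Z n (h n) x (z n) ω) := by
    rw [kernelSum, map_sum, Finset.mul_sum]
  have hσ0 : 0 < σ n := Real.sqrt_pos.2 (by positivity)
  have hσ2 : σ n ^ 2 = 1 / ((n : ℝ) * h n ^ k) := Real.sq_sqrt (by positivity)
  rw [hsum, abs_mul, abs_of_pos hσ0]
  rw [norm_div, Complex.norm_real, Real.norm_of_nonneg h3.le] at hω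
  have hω2 : ‖kernelSum K X Z n (h n) x (z n) ω‖ * σ n ^ 2 ≤ η * σ n := by
    rw [hσ2, mul_one_div]
    exact hω
  have h5 := hφ n (kernelSum K X Z n (h n) x (z n) ω)
  have h6 : σ n * ‖kernelSum K X Z n (h n) x (z n) ω‖ ≤ η := by
    by_contra hcon
    have := mul_lt_mul_of_pos_right (not_le.1 hcon) hσ0
    nlinarith
  exact (mul_le_mul_of_nonneg_left h5 hσ0.le).trans h6

end KernelAnticoncentration

end

/-! ### Bounds for the principal logarithm and tightness of the log-modulus -/

noncomputable section

theorem abs_log_sub_log_le {y g c₁ c₂ : ℝ} (hg : 0 < g) (hc₁ : 0 < c₁) (h₁ : c₁ * g ≤ y)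
    (h₂ : y ≤ c₂ * g) : |Real.log y - Real.log g| ≤ |Real.log c₁| + |Real.log c₂| := by
  have hy : 0 < y := lt_of_lt_of_le (by positivity) h₁
  have hc₂ : 0 < c₂ := by
    by_contra hcon
    have := mul_nonpos_of_nonpos_of_nonneg (not_lt.1 hcon) hg.le
    linarith
  have e₁ := Real.log_le_log (by positivity) h₁
  have e₂ := Real.log_le_log hy h₂
  rw [Real.log_mul hc₁.ne' hg.ne'] at e₁
  rw [Real.log_mul hc₂.ne' hg.ne'] at e₂
  rw [abs_le]
  constructor <;>
    linarith [neg_abs_le (Real.log c₁), le_abs_self (Real.log c₂), abs_nonneg (Real.log c₁),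
      abs_nonneg (Real.log c₂)]

/-- The imaginary part of the principal logarithm never exceeds π in modulus, so only the
log-modulus of R can make the logarithm large. -/
theorem norm_log_sub_le (R : ℂ) (a : ℝ) :
    ‖Complex.log R - Complex.I * a‖ ≤ |Real.log ‖R‖| + (Real.pi + |a|) := by
  have h1 : ‖Complex.log R‖ ≤ |Real.log ‖R‖| + Real.pi := by
    refine (Complex.norm_le_abs_re_add_abs_im _).trans (add_le_add ?_ ?_)
    · rw [Complex.log_re]
    · rw [Complex.log_im]
      exact Complex.abs_arg_le_pi R
  have h2 : ‖Complex.I * (a : ℂ)‖ = |a| := by simp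
  have h3 := norm_sub_le (Complex.log R) (Complex.I * a)
  linarith

theorem norm_log_le_of_norm_sub_one_le {B : ℂ} {r : ℝ} (hr : r ≤ 1 / 2) (hB : ‖B - 1‖ ≤ r) :
    B ≠ 0 ∧ ‖Complex.log B‖ ≤ 3 / 2 * r := by
  refine ⟨fun h0 => ?_, ?_⟩
  · rw [h0] at hB
    simp at hB
    linarith
  · have := Complex.norm_log_one_add_half_le_self (z := B - 1) (hB.trans hr)
    rw [add_sub_cancel] at this
    linarith

/-- Expansion of the principal logarithm of a perturbed unimodular number. -/
theorem norm_log_cexp_mul_ratio_sub_le {a κ r : ℝ} (ha : |a| ≤ κ) (hκ : κ < Real.pi)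
    (hr : r ≤ 1 / 2) (hrκ : r ≤ (Real.pi - κ) / 12) {B₁ B₂ B₃ B₄ : ℂ} (h₁ : ‖B₁ - 1‖ ≤ r)
    (h₂ : ‖B₂ - 1‖ ≤ r) (h₃ : ‖B₃ - 1‖ ≤ r) (h₄ : ‖B₄ - 1‖ ≤ r) :
    ‖Complex.log (Complex.exp (Complex.I * a) * (B₁ / B₂ * (B₃ / B₄)⁻¹)) - Complex.I * a‖ ≤
      6 * r := by
  obtain ⟨n₁, l₁⟩ := norm_log_le_of_norm_sub_one_le hr h₁
  obtain ⟨n₂, l₂⟩ := norm_log_le_of_norm_sub_one_le hr h₂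
  obtain ⟨n₃, l₃⟩ := norm_log_le_of_norm_sub_one_le hr h₃
  obtain ⟨n₄, l₄⟩ := norm_log_le_of_norm_sub_one_le hr h₄
  set q : ℂ := Complex.log B₁ - Complex.log B₂ - (Complex.log B₃ - Complex.log B₄) with hq
  have hqn : ‖q‖ ≤ 6 * r := by
    have e1 := norm_sub_le (Complex.log B₁ - Complex.log B₂) (Complex.log B₃ - Complex.log B₄)
    have e2 := norm_sub_le (Complex.log B₁) (Complex.log B₂)
    have e3 := norm_sub_le (Complex.log B₃) (Complex.log B₄)
    linarith
  have hexp : Complex.exp (Complex.I * a) * (B₁ / B₂ * (B₃ / B₄)⁻¹) =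
      Complex.exp (Complex.I * a + q) := by
    rw [hq, Complex.exp_add, Complex.exp_sub, Complex.exp_sub, Complex.exp_sub, Complex.exp_log n₁,
      Complex.exp_log n₂, Complex.exp_log n₃, Complex.exp_log n₄, div_eq_mul_inv (B₁ / B₂)]
  -- Here 6r ≤ (π - κ)/2, so the argument stays strictly inside (-π, π) and the principal branch is
  -- the expected one.
  have him : |(Complex.I * (a : ℂ) + q).im| < Real.pi := by
    have e1 : (Complex.I * (a : ℂ) + q).im = a + q.im := by simp
    have e2 := Complex.abs_im_le_norm q
    have e3 := abs_add_le a q.im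
    rw [e1]
    linarith
  rw [abs_lt] at him
  rw [hexp, Complex.log_exp him.1 him.2.le, add_sub_cancel_left]
  exact hqn

section LogTightness

variable {Ω : Type*} [MeasurableSpace Ω] {k : ℕ} {P : Measure Ω} [IsProbabilityMeasure P]
  {X : ℕ → Ω → EuclideanSpace ℝ (Fin k)} {Z : ℕ → Ω → ℝ}
  {K : EuclideanSpace ℝ (Fin k) → ℝ} {α : ℝ}
  {fX m₁ m₂ : EuclideanSpace ℝ (Fin k) → ℝ} {lam : ℝ} {F₁ F₂ : Measure ℝ}
  [IsProbabilityMeasure F₁] [IsProbabilityMeasure F₂] {C : ℝ}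

/-- The logarithm of the modulus of the oscillating kernel sums is tight, once normalised by the
larger one of the mean and the standard deviation. -/
theorem MixtureSetup.isBigOP_log_norm_kernelSum
    (H : MixtureSetup P X Z K α fX lam m₁ m₂ F₁ F₂ C) (hlam : 0 < lam)
    (x : EuclideanSpace ℝ (Fin k)) (hx : 0 < fX x) {h : ℕ → ℝ} {z : ℕ → ℂ} {q : ℕ → ℝ}
    (hh : ∀ᶠ n in atTop, 0 < h n) (hh0 : Tendsto h atTop (𝓝 0))
    (hnh : Tendsto (fun n : ℕ => (n : ℝ) * h n ^ k) atTop atTop)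
    (hzh : Tendsto (fun n => ‖z n‖ * h n) atTop (𝓝 0)) (hre : ∀ n, (z n).re = 0)
    (hM : ∀ᶠ n in atTop, complexMGF id F₁ (z n) ≠ 0) (hq : ∀ᶠ n in atTop, 0 ≤ q n)
    (hq0 : Tendsto q atTop (𝓝 0))
    (hr : ∃ d : ℝ, ∀ᶠ n in atTop, ‖complexMGF id F₂ (z n)‖ ≤ d * q n * ‖complexMGF id F₁ (z n)‖) :
    IsBigOP P (fun n ω => Real.log ‖kernelSum K X Z n (h n) x (z n) ω / (n * h n ^ k : ℝ)‖ -
      Real.log (max (√(1 / (n * h n ^ k))) ‖complexMGF id F₁ (z n)‖)) (fun _ => 1) := by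
  intro ε hε
  obtain ⟨d, hd⟩ := hr
  have hα := H.kernel.pos
  have hC := H.one_le
  have hI : ∀ᶠ n in atTop, ∀ (F : Measure ℝ) [IsProbabilityMeasure F],
      Integrable (fun e => Real.exp ((z n).re * e)) F ∧
      Integrable (fun e => Real.exp (2 * (z n).re * e)) F :=
    Eventually.of_forall fun n F _ => by simp [hre]
  obtain ⟨C₁, hC₁, hfl⟩ := H.isBigOP_kernelSum_sub x hh hzh (hI.mono fun n hn => hn F₁)
    (hI.mono fun n hn => hn F₂) (v := fun _ => 1) 1
    (Eventually.of_forall fun n => by simp [hre, secondMomentBound]) (ε / 2) (by positivity)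
  obtain ⟨D, hD0, hD⟩ := H.norm_mixtureMean_div_sub_one_le hlam x hx (abs_nonneg d)
  have hbias0 : Tendsto (fun n => D * (q n + ((1 + ‖z n‖) * h n) ^ 2)) atTop (𝓝 0) := by
    have e1 : Tendsto (fun n => (1 + ‖z n‖) * h n) atTop (𝓝 0) := by
      simpa [add_mul] using hh0.add hzh
    simpa using (hq0.add (e1.pow 2)).const_mul D
  have hsm : ∀ᶠ n in atTop, ‖z n‖ * h n < α / C := hzh.eventually_lt_const (by positivity)
  set a := lam * fX x with ha
  have ha0 : 0 < a := mul_pos hlam hx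
  have hmean : ∀ᶠ n in atTop,
      a / 2 * ‖complexMGF id F₁ (z n)‖ ≤ ‖mixtureMean K fX lam m₁ m₂ F₁ F₂ x (h n) (z n)‖ ∧
      ‖mixtureMean K fX lam m₁ m₂ F₁ F₂ x (h n) (z n)‖ ≤ 2 * a * ‖complexMGF id F₁ (z n)‖ := by
    filter_upwards [hh, hsm, hM, hq, hd,
      hbias0.eventually_lt_const (show (0 : ℝ) < 1 / 2 by norm_num)] with n h1 h2 h3 h4 h5 h6
    have hz : C * ‖z n‖ * h n ≤ α := by
      rw [lt_div_iff₀ (by positivity)] at h2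
      linarith
    have hb := hD (h n) (z n) (q n) h1.le h4 hz h3 (by
      rw [hre, zero_mul, Real.exp_zero, one_mul]
      exact h5.trans (by gcongr; exact le_abs_self d))
    have hA := norm_leadingTerm (m := m₁) (F := F₁) hlam.le hx.le (z n)
    rw [hre, zero_mul, Real.exp_zero, mul_one] at hA
    have hA' : ‖leadingTerm fX lam m₁ F₁ x (z n)‖ = a * ‖complexMGF id F₁ (z n)‖ := by
      rw [hA, ha]; ring
    have hMpos : 0 < ‖complexMGF id F₁ (z n)‖ := norm_pos_iff.2 h3
    have hApos : 0 < ‖leadingTerm fX lam m₁ F₁ x (z n)‖ := by rw [hA']; positivity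
    rw [div_sub_one (norm_pos_iff.1 hApos), norm_div] at hb
    have hb' := (div_le_iff₀ hApos).1 (hb.trans h6.le)
    rw [hA'] at hb'
    have t1 := norm_le_norm_add_norm_sub' (mixtureMean K fX lam m₁ m₂ F₁ F₂ x (h n) (z n))
      (leadingTerm fX lam m₁ F₁ x (z n))
    have t2 := norm_le_norm_add_norm_sub (mixtureMean K fX lam m₁ m₂ F₁ F₂ x (h n) (z n))
      (leadingTerm fX lam m₁ F₁ x (z n))
    rw [hA'] at t1 t2
    constructor <;> nlinarith
  set σ : ℕ → ℝ := fun n => √(1 / (n * h n ^ k)) with hσ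
  have hσ0 : Tendsto σ atTop (𝓝 0) := by
    have h1 : Tendsto (fun n : ℕ => 1 / ((n : ℝ) * h n ^ k)) atTop (𝓝 0) := by
      simp only [one_div]
      exact hnh.inv_tendsto_atTop
    have h2 := h1.sqrt
    rwa [Real.sqrt_zero] at h2
  -- Above this threshold the fluctuation C₁σ is at most a/4 times the modulus of the transform,
  -- which is half of the lower bound a/2 for the mean.
  set L := 4 * C₁ / a with hL
  have hL0 : 0 < L := by positivity
  set S : Set ℕ := {n | ‖complexMGF id F₁ (z n)‖ < L * σ n} with hS
  -- Along S the mean is O(σ) and tends to 0, so anticoncentration applies there. Working with the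
  -- filter restricted to S avoids extracting a subsequence and covers a finite S as well.
  obtain ⟨η, hη, hac⟩ := H.exists_measure_norm_kernelSum_le x hx hh hh0 hnh hzh hre
    (l := atTop ⊓ 𝓟 S) inf_le_left (by
      have ht : Tendsto (fun n => 2 * a * (L * σ n)) (atTop ⊓ 𝓟 S) (𝓝 0) := by
        simpa using ((hσ0.const_mul L).const_mul (2 * a)).mono_left inf_le_left
      refine squeeze_zero' (Eventually.of_forall fun n => norm_nonneg _) ?_ ht
      rw [eventually_inf_principal]
      filter_upwards [hmean] with n hn hnS
      exact hn.2.trans (by gcongr; exact le_of_lt hnS)) (show 0 < ε / 2 by positivity)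
  rw [eventually_inf_principal] at hac
  -- One lower constant for each regime: mean dominating outside S, noise dominating on S.
  set c₁ := min (a / 4 / (1 / L + 1)) (η / (1 + L)) with hc₁
  have hc₁0 : 0 < c₁ := by positivity
  refine ⟨|Real.log c₁| + |Real.log (C₁ + 2 * a)| + 1, by positivity, ?_⟩
  filter_upwards [hfl, hac, hmean, hh, eventually_gt_atTop 0] with n e1 e2 e3 e4 e5
  have hn' : (0 : ℝ) < n := by exact_mod_cast e5
  have hσn : 0 < σ n := Real.sqrt_pos.2 (by positivity)
  set G := max (σ n) ‖complexMGF id F₁ (z n)‖ with hG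
  have hG0 : 0 < G := lt_max_of_lt_left hσn
  set M := mixtureMean K fX lam m₁ m₂ F₁ F₂ x (h n) (z n) with hMdef
  have hsub : {ω | (|Real.log c₁| + |Real.log (C₁ + 2 * a)| + 1) * |(1 : ℝ)| <
      ‖Real.log ‖kernelSum K X Z n (h n) x (z n) ω / (n * h n ^ k : ℝ)‖ - Real.log G‖} ⊆
      {ω | C₁ * |σ n| < ‖kernelSum K X Z n (h n) x (z n) ω / (n * h n ^ k : ℝ) - M‖} ∪
      {ω | n ∈ S ∧ ‖kernelSum K X Z n (h n) x (z n) ω / (n * h n ^ k : ℝ)‖ ≤ η * σ n} := by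
    intro ω hω
    by_contra hcon
    rw [Set.mem_union, not_or, Set.mem_ofPred_eq, Set.mem_ofPred_eq, not_lt, abs_of_pos hσn,
      not_and] at hcon
    obtain ⟨g1, g2⟩ := hcon
    rw [Set.mem_ofPred_eq, abs_one, mul_one, Real.norm_eq_abs] at hω
    set y := ‖kernelSum K X Z n (h n) x (z n) ω / (n * h n ^ k : ℝ)‖ with hy
    have t1 := norm_le_norm_add_norm_sub'
      (kernelSum K X Z n (h n) x (z n) ω / (n * h n ^ k : ℝ)) M
    have t2 := norm_le_norm_add_norm_sub
      (kernelSum K X Z n (h n) x (z n) ω / (n * h n ^ k : ℝ)) M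
    have hGσ : σ n ≤ G := le_max_left _ _
    have hGM : ‖complexMGF id F₁ (z n)‖ ≤ G := le_max_right _ _
    have hup : y ≤ (C₁ + 2 * a) * G := by
      nlinarith [mul_le_mul_of_nonneg_left hGσ hC₁.le, mul_le_mul_of_nonneg_left hGM ha0.le]
    have hlow : c₁ * G ≤ y := by
      by_cases hnS : n ∈ S
      · have g3 := not_le.1 (g2 hnS)
        have hGle : G ≤ (1 + L) * σ n := max_le (by nlinarith) (by
          have : ‖complexMGF id F₁ (z n)‖ < L * σ n := hnS
          linarith)
        calc c₁ * G ≤ η / (1 + L) * ((1 + L) * σ n) := by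
              gcongr
              exact min_le_right _ _
          _ = η * σ n := by field_simp
          _ ≤ y := g3.le
      · have g3 : L * σ n ≤ ‖complexMGF id F₁ (z n)‖ := not_lt.1 hnS
        have hGle : G ≤ (1 / L + 1) * ‖complexMGF id F₁ (z n)‖ := max_le (by
          have : σ n ≤ 1 / L * ‖complexMGF id F₁ (z n)‖ := by
            rw [one_div, ← div_eq_inv_mul, le_div_iff₀ hL0]
            linarith
          nlinarith [norm_nonneg (complexMGF id F₁ (z n))]) (by
          have : 0 ≤ 1 / L * ‖complexMGF id F₁ (z n)‖ := by positivity
          linarith)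
        have hCσ : C₁ * σ n ≤ a / 4 * ‖complexMGF id F₁ (z n)‖ := by
          have : C₁ * σ n = a / 4 * (L * σ n) := by rw [hL]; field_simp
          rw [this]
          gcongr
        calc c₁ * G ≤ a / 4 / (1 / L + 1) * ((1 / L + 1) * ‖complexMGF id F₁ (z n)‖) := by
              gcongr
              exact min_le_left _ _
          _ = a / 4 * ‖complexMGF id F₁ (z n)‖ := by field_simp
          _ ≤ y := by linarith [e3.1]
    have := abs_log_sub_log_le hG0 hc₁0 hlow hup
    linarith
  refine (measure_mono hsub).trans ((measure_union_le _ _).trans ?_)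
  rw [← add_halves ε, ENNReal.ofReal_add (by positivity) (by positivity)]
  refine add_le_add e1 ?_
  by_cases hnS : n ∈ S
  · refine (measure_mono fun ω hω => ?_).trans (e2 hnS)
    exact hω.2
  · have : {ω | n ∈ S ∧ ‖kernelSum K X Z n (h n) x (z n) ω / (n * h n ^ k : ℝ)‖ ≤ η * σ n} = ∅ := by
      ext ω
      simp [hnS]
    rw [this]
    simp

end LogTightness

end

/-! ### The slope estimator based on characteristic functions -/

noncomputable section

theorem cfHat_eq {Ω : Type*} {k : ℕ} (K : EuclideanSpace ℝ (Fin k) → ℝ)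
    (X : ℕ → Ω → EuclideanSpace ℝ (Fin k)) (Z : ℕ → Ω → ℝ) (n : ℕ) (b : ℝ)
    (x : EuclideanSpace ℝ (Fin k)) (s : ℝ) (ω : Ω) :
    cfHat K X Z n b x s ω =
      kernelSum K X Z n b x (Complex.I * s) ω / kernelSum K X Z n b x 0 ω := by
  simp [cfHat, kernelSum]

theorem log_norm_div_mul_inv {u v w z : ℂ} (hu : u ≠ 0) (hv : v ≠ 0) (hw : w ≠ 0) (hz : z ≠ 0) :
    Real.log ‖u / v * (w / z)⁻¹‖ =
      (Real.log ‖u‖ - Real.log ‖v‖) - (Real.log ‖w‖ - Real.log ‖z‖) := by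
  rw [← norm_ne_zero_iff] at hu hv hw hz
  rw [norm_mul, norm_inv, norm_div, norm_div, Real.log_mul (div_ne_zero hu hv)
    (inv_ne_zero (div_ne_zero hw hz)), Real.log_inv, Real.log_div hu hv, Real.log_div hw hz]
  ring

theorem complexMGF_id_I_mul (F : Measure ℝ) (s : ℝ) :
    complexMGF id F (Complex.I * s) = charFun F s := by
  rw [mul_comm, complexMGF_id_mul_I]

section CharacteristicFunctions

variable {Ω : Type*} [MeasurableSpace Ω] {k : ℕ} {P : Measure Ω} [IsProbabilityMeasure P]
  {X : ℕ → Ω → EuclideanSpace ℝ (Fin k)} {Z : ℕ → Ω → ℝ}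
  {K : EuclideanSpace ℝ (Fin k) → ℝ} {α : ℝ}
  {fX m₁ m₂ : EuclideanSpace ℝ (Fin k) → ℝ} {lam : ℝ} {F₁ F₂ : Measure ℝ}
  [IsProbabilityMeasure F₁] [IsProbabilityMeasure F₂] {C : ℝ}

/-- Oscillating kernel sums at frequencies `s n` of order at most `r n`: relative error and
tightness of the logarithm. -/
theorem MixtureSetup.isBigOP_oscillating
    (H : MixtureSetup P X Z K α fX lam m₁ m₂ F₁ F₂ C) (hlam : 0 < lam)
    (x : EuclideanSpace ℝ (Fin k)) (hx : 0 < fX x) {b s r : ℕ → ℝ} {f : ℝ → ℝ}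
    (hb : ∀ᶠ n in atTop, 0 < b n) (hb0 : Tendsto b atTop (𝓝 0))
    (hnb : Tendsto (fun n : ℕ => (n : ℝ) * b n ^ k) atTop atTop)
    (hs : Tendsto s atTop atTop) (hsr : ∀ᶠ n in atTop, 1 + s n ≤ 2 * r n)
    (hrb : Tendsto (fun n => r n * b n) atTop (𝓝 0))
    (hf : ∀ s, 0 ≤ f s) (hf0 : Tendsto f atTop (𝓝 0)) (hne : ∀ᶠ s : ℝ in atTop, charFun F₁ s ≠ 0)
    (hO : (fun s : ℝ => charFun F₂ s / charFun F₁ s) =O[atTop] f) :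
    IsBigOP P (fun n ω => kernelSum K X Z n (b n) x (Complex.I * s n) ω / (n * b n ^ k : ℝ) /
        leadingTerm fX lam m₁ F₁ x (Complex.I * s n) - 1)
      (fun n => f (s n) + √((b n * r n) ^ 4 + 1 / (n * b n ^ k * ‖charFun F₁ (s n)‖ ^ 2))) ∧
    IsBigOP P (fun n ω =>
      Real.log ‖kernelSum K X Z n (b n) x (Complex.I * s n) ω / (n * b n ^ k : ℝ)‖ -
      Real.log (max (√(1 / (n * b n ^ k))) ‖charFun F₁ (s n)‖)) (fun _ => 1) := by
  have hnorm : ∀ᶠ n in atTop, ‖Complex.I * (s n : ℂ)‖ = s n := by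
    filter_upwards [hs.eventually_ge_atTop 0] with n hn
    simp [abs_of_nonneg hn]
  have hre : ∀ n, (Complex.I * (s n : ℂ)).re = 0 := fun n => by simp
  have hzb : Tendsto (fun n => ‖Complex.I * (s n : ℂ)‖ * b n) atTop (𝓝 0) := by
    have h2 : Tendsto (fun n => 2 * (r n * b n)) atTop (𝓝 0) := by simpa using hrb.const_mul 2
    refine squeeze_zero' ?_ ?_ h2
    · filter_upwards [hb] with n hn
      positivity
    · filter_upwards [hb, hnorm, hsr] with n h1 h2 h3
      rw [h2]
      nlinarith
  have hM : ∀ᶠ n in atTop, complexMGF id F₁ (Complex.I * s n) ≠ 0 := by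
    filter_upwards [hs.eventually hne] with n hn
    rwa [complexMGF_id_I_mul]
  have hq : ∀ᶠ n in atTop, 0 ≤ f (s n) := Eventually.of_forall fun n => hf _
  have hrat : ∃ d : ℝ, ∀ᶠ n in atTop, ‖complexMGF id F₂ (Complex.I * s n)‖ ≤
      d * f (s n) * ‖complexMGF id F₁ (Complex.I * s n)‖ := by
    obtain ⟨d, hd⟩ := hO.bound
    refine ⟨d, ?_⟩
    filter_upwards [hs.eventually hd, hs.eventually hne] with n h1 h2
    rw [complexMGF_id_I_mul, complexMGF_id_I_mul]
    rw [norm_div, Real.norm_of_nonneg (hf _), div_le_iff₀ (norm_pos_iff.2 h2)] at h1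
    exact h1
  have hI : ∀ (F : Measure ℝ) [IsProbabilityMeasure F], ∀ᶠ n in atTop,
      Integrable (fun e => Real.exp ((Complex.I * (s n : ℂ)).re * e)) F ∧
      Integrable (fun e => Real.exp (2 * (Complex.I * (s n : ℂ)).re * e)) F :=
    fun F _ => Eventually.of_forall fun n => by simp [hre]
  refine ⟨?_, ?_⟩
  · have hmain := H.isBigOP_kernelSum_div_sub_one hlam x hx (q := fun n => f (s n)) hb hzb (hI F₁)
      (hI F₂) hM hq (by
        obtain ⟨d, hd⟩ := hrat
        refine ⟨d, hd.mono fun n hn => ?_⟩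
        rw [hre, zero_mul, Real.exp_zero, one_mul]
        exact hn) ⟨1, Eventually.of_forall fun n => by simp [hre]⟩
    -- Passing from 1 + s to 2r costs 2⁴ = 16 under the root, that is a factor 4.
    refine hmain.mono 4 ?_
    filter_upwards [hb, hnorm, hsr, hs.eventually_ge_atTop 0, eventually_gt_atTop 0]
      with n h1 h2 h3 h4 h5
    have hn' : (0 : ℝ) < n := by exact_mod_cast h5
    rw [hre, h2, complexMGF_id_I_mul, mul_zero, mgf_zero, div_div,
      mul_comm (‖charFun F₁ (s n)‖ ^ 2)]
    have hf' := hf (s n)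
    set V := 1 / (n * b n ^ k * ‖charFun F₁ (s n)‖ ^ 2) with hV
    have hV0 : 0 ≤ V := by positivity
    rw [abs_of_nonneg (by positivity), abs_of_nonneg (by positivity), mul_add]
    refine add_le_add (by linarith) ?_
    have h6 : (4 : ℝ) = √(16 : ℝ) := by
      rw [show (16 : ℝ) = 4 ^ 2 by norm_num, Real.sqrt_sq (by norm_num)]
    rw [h6, ← Real.sqrt_mul (by norm_num)]
    apply Real.sqrt_le_sqrt
    have h7 : (1 + s n) * b n ≤ 2 * (b n * r n) := by nlinarith
    have h8 : ((1 + s n) * b n) ^ 4 ≤ (2 * (b n * r n)) ^ 4 := by gcongr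
    rw [mul_pow] at h8
    linarith
  · have := H.isBigOP_log_norm_kernelSum hlam x hx (q := fun n => f (s n)) hb hb0 hnb hzb hre hM hq
      (hf0.comp hs) hrat
    simp_rw [complexMGF_id_I_mul] at this
    exact this

/-- Stochastic order of the estimator of the slope of the component with the heavier
characteristic function. -/
theorem MixtureSetup.isBigOP_slopeHat₂
    (H : MixtureSetup P X Z K α fX lam m₁ m₂ F₁ F₂ C) (hlam : 0 < lam)
    {x₀ x₁ : EuclideanSpace ℝ (Fin k)} (hx₀ : 0 < fX x₀) (hx₁ : 0 < fX x₁) {b s a : ℕ → ℝ}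
    {f : ℝ → ℝ} (hb : ∀ᶠ n in atTop, 0 < b n) (hb0 : Tendsto b atTop (𝓝 0))
    (hnb : Tendsto (fun n : ℕ => (n : ℝ) * b n ^ k) atTop atTop)
    (hs : Tendsto s atTop atTop) (hsb : Tendsto (fun n => s n * b n) atTop (𝓝 0))
    (ha : ∀ᶠ n in atTop, a n ≠ 0) {A κ : ℝ} (haA : ∀ᶠ n in atTop, |a n| ≤ A) (hκ : κ < Real.pi)
    (haκ : ∀ᶠ n in atTop, |a n * (m₁ x₁ - m₁ x₀)| ≤ κ)
    (hf : ∀ s, 0 ≤ f s) (hf0 : Tendsto f atTop (𝓝 0)) (hne : ∀ᶠ s : ℝ in atTop, charFun F₁ s ≠ 0)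
    (hO : (fun s : ℝ => charFun F₂ s / charFun F₁ s) =O[atTop] f) :
    IsBigOP P
      (fun n ω => slopeHat₂ K X Z x₀ x₁ n (b n) (s n) (a n) ω - ((m₁ x₁ - m₁ x₀ : ℝ) : ℂ))
      (fun n => 1 / |a n| * (f (s n + a n) + f (s n)
        + √((b n * s n) ^ 4 + 1 / ((n : ℝ) * b n ^ k * ‖charFun F₁ (s n + a n)‖ ^ 2))
        + √((b n * s n) ^ 4 + 1 / ((n : ℝ) * b n ^ k * ‖charFun F₁ (s n)‖ ^ 2)))) := by
  set N : EuclideanSpace ℝ (Fin k) → ℝ → ℕ → Ω → ℂ := fun x u n ω =>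
    kernelSum K X Z n (b n) x (Complex.I * u) ω / (n * b n ^ k : ℝ) with hN
  set ρ : ℕ → ℝ := fun n => f (s n + a n) + f (s n)
        + √((b n * s n) ^ 4 + 1 / ((n : ℝ) * b n ^ k * ‖charFun F₁ (s n + a n)‖ ^ 2))
        + √((b n * s n) ^ 4 + 1 / ((n : ℝ) * b n ^ k * ‖charFun F₁ (s n)‖ ^ 2)) with hρ
  set θ : ℕ → ℝ := fun n => a n * (m₁ x₁ - m₁ x₀) with hθ
  set R : ℕ → Ω → ℂ := fun n ω =>
    cfHat K X Z n (b n) x₁ (s n + a n) ω / cfHat K X Z n (b n) x₀ (s n + a n) ω *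
      (cfHat K X Z n (b n) x₁ (s n) ω / cfHat K X Z n (b n) x₀ (s n) ω)⁻¹ with hR
  have hsa : Tendsto (fun n => s n + a n) atTop atTop := by
    refine tendsto_atTop_mono' atTop ?_ (tendsto_atTop_add_const_right atTop (-A) hs)
    filter_upwards [haA] with n hn
    linarith [neg_abs_le (a n)]
  have hev : ∀ᶠ n in atTop, 0 < b n ∧ (0 : ℝ) < n ∧ 0 < (n : ℝ) * b n ^ k := by
    filter_upwards [hb, eventually_gt_atTop 0] with n h1 h2
    have h2' : (0 : ℝ) < n := by exact_mod_cast h2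
    exact ⟨h1, h2', by positivity⟩
  have osc : ∀ x, 0 < fX x → _ := fun x hx =>
    H.isBigOP_oscillating hlam x hx (s := s) (r := s) hb hb0 hnb hs
      (by filter_upwards [hs.eventually_ge_atTop 1] with n hn; linarith) hsb hf hf0 hne hO
  -- The frequency is s + a but the bias is measured with r = s; boundedness of a gives 1 + s + a ≤
  -- 2s for large n.
  have osc' : ∀ x, 0 < fX x → _ := fun x hx =>
    H.isBigOP_oscillating hlam x hx (s := fun n => s n + a n) (r := s) hb hb0 hnb hsa
      (by filter_upwards [hs.eventually_ge_atTop (1 + A), haA] with n h1 h2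
          linarith [le_abs_self (a n)]) hsb hf hf0 hne hO
  have mono₁ : ∀ᶠ n in atTop, |f (s n) + √((b n * s n) ^ 4 +
      1 / ((n : ℝ) * b n ^ k * ‖charFun F₁ (s n)‖ ^ 2))| ≤ 1 * |ρ n| :=
    Eventually.of_forall fun n => by
      have h1 := hf (s n)
      have h2 := hf (s n + a n)
      rw [abs_of_nonneg (by positivity), hρ, abs_of_nonneg (by positivity), one_mul]
      have h3 := Real.sqrt_nonneg
        ((b n * s n) ^ 4 + 1 / ((n : ℝ) * b n ^ k * ‖charFun F₁ (s n + a n)‖ ^ 2))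
      linarith
  have mono₂ : ∀ᶠ n in atTop, |f (s n + a n) + √((b n * s n) ^ 4 +
      1 / ((n : ℝ) * b n ^ k * ‖charFun F₁ (s n + a n)‖ ^ 2))| ≤ 1 * |ρ n| :=
    Eventually.of_forall fun n => by
      have h1 := hf (s n)
      have h2 := hf (s n + a n)
      rw [abs_of_nonneg (by positivity), hρ, abs_of_nonneg (by positivity), one_mul]
      have h3 := Real.sqrt_nonneg
        ((b n * s n) ^ 4 + 1 / ((n : ℝ) * b n ^ k * ‖charFun F₁ (s n)‖ ^ 2))
      linarith
  have o₁ := (osc' x₁ hx₁).1.mono 1 mono₂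
  have o₂ := (osc' x₀ hx₀).1.mono 1 mono₂
  have o₃ := (osc x₁ hx₁).1.mono 1 mono₁
  have o₄ := (osc x₀ hx₀).1.mono 1 mono₁
  -- the ratio either vanishes or is free of the denominators
  have hRcase : ∀ᶠ n in atTop, ∀ ω, R n ω = 0 ∨
      (N x₁ (s n + a n) n ω ≠ 0 ∧ N x₀ (s n + a n) n ω ≠ 0 ∧ N x₁ (s n) n ω ≠ 0 ∧
        N x₀ (s n) n ω ≠ 0 ∧
      R n ω = N x₁ (s n + a n) n ω / N x₀ (s n + a n) n ω * (N x₁ (s n) n ω / N x₀ (s n) n ω)⁻¹) := by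
    filter_upwards [hev] with n ⟨h1, h2, h3⟩ ω
    have hne0 : ((n * b n ^ k : ℝ) : ℂ) ≠ 0 := by exact_mod_cast h3.ne'
    rw [or_iff_not_imp_left]
    intro hR0
    simp only [hR, hN, cfHat_eq] at hR0 ⊢
    simp only [mul_eq_zero, div_eq_zero_iff, inv_eq_zero, not_or] at hR0
    obtain ⟨⟨⟨g1, g2⟩, g3, g4⟩, ⟨g5, g6⟩, g7, g8⟩ := hR0
    refine ⟨div_ne_zero g1 hne0, div_ne_zero g3 hne0, div_ne_zero g5 hne0, div_ne_zero g7 hne0, ?_⟩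
    field_simp
  -- tightness
  have htight : IsBigOP P (fun n ω => Complex.log (R n ω) - Complex.I * θ n) (fun _ => 1) := by
    refine IsBigOP.of_forall_imp (ι := Fin 4) (E := ℝ)
      (Y := ![fun n ω => Real.log ‖N x₁ (s n + a n) n ω‖ -
          Real.log (max (√(1 / (n * b n ^ k))) ‖charFun F₁ (s n + a n)‖),
        fun n ω => Real.log ‖N x₀ (s n + a n) n ω‖ -
          Real.log (max (√(1 / (n * b n ^ k))) ‖charFun F₁ (s n + a n)‖),
        fun n ω => Real.log ‖N x₁ (s n) n ω‖ -
          Real.log (max (√(1 / (n * b n ^ k))) ‖charFun F₁ (s n)‖),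
        fun n ω => Real.log ‖N x₀ (s n) n ω‖ -
          Real.log (max (√(1 / (n * b n ^ k))) ‖charFun F₁ (s n)‖)])
      (r := fun _ _ => 1) ?_ fun c hc => ⟨4 * c + 2 * Real.pi, by positivity, ?_⟩
    · intro i
      fin_cases i
      · exact (osc' x₁ hx₁).2
      · exact (osc' x₀ hx₀).2
      · exact (osc x₁ hx₁).2
      · exact (osc x₀ hx₀).2
    · filter_upwards [hRcase, haκ] with n h1 h2
      refine ae_of_all _ fun ω hall => ?_
      have g1 := hall 0
      have g2 := hall 1
      have g3 := hall 2
      have g4 := hall 3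
      simp only [Matrix.cons_val, abs_one, mul_one, Real.norm_eq_abs] at g1 g2 g3 g4
      rw [abs_one, mul_one]
      have hb1 := norm_log_sub_le (R n ω) (θ n)
      have hθκ : |θ n| ≤ Real.pi := h2.trans hκ.le
      have hlogR : |Real.log ‖R n ω‖| ≤ 4 * c := by
        -- When R = 0, which includes vanishing denominators, the convention log 0 = 0 makes the
        -- bound trivial.
        rcases h1 ω with h0 | ⟨n1, n2, n3, n4, hReq⟩
        · rw [h0]
          simp [hc.le]
        -- At each frequency the normalising maximum does not depend on the point, so it cancels
        -- between x₁ and x₀.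
        · have e : Real.log ‖R n ω‖ = (Real.log ‖N x₁ (s n + a n) n ω‖ -
              Real.log ‖N x₀ (s n + a n) n ω‖) - (Real.log ‖N x₁ (s n) n ω‖ -
              Real.log ‖N x₀ (s n) n ω‖) := by
            rw [hReq]
            exact log_norm_div_mul_inv n1 n2 n3 n4
          rw [e]
          rw [abs_le] at g1 g2 g3 g4 ⊢
          constructor <;> linarith [g1.1, g1.2, g2.1, g2.2, g3.1, g3.2, g4.1, g4.2]
      linarith
  -- The density estimators cancel in the double ratio; their relative errors are used only to know
  -- that the denominators do not vanish.
  have hmain : IsBigOP P (fun n ω => Complex.log (R n ω) - Complex.I * θ n) ρ := by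
    have e₁ := H.isBigOP_kernelSum_zero_div_sub_one x₁ hx₁ hb
    have e₀ := H.isBigOP_kernelSum_zero_div_sub_one x₀ hx₀ hb
    refine IsBigOP.of_forall_imp (ι := Fin 7) (E := ℂ)
      (Y := ![fun n ω => N x₁ (s n + a n) n ω /
          leadingTerm fX lam m₁ F₁ x₁ (Complex.I * (s n + a n : ℝ)) - 1,
        fun n ω => N x₀ (s n + a n) n ω /
          leadingTerm fX lam m₁ F₁ x₀ (Complex.I * (s n + a n : ℝ)) - 1,
        fun n ω => N x₁ (s n) n ω / leadingTerm fX lam m₁ F₁ x₁ (Complex.I * s n) - 1,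
        fun n ω => N x₀ (s n) n ω / leadingTerm fX lam m₁ F₁ x₀ (Complex.I * s n) - 1,
        fun n ω => kernelSum K X Z n (b n) x₁ 0 ω / (n * b n ^ k : ℝ) / fX x₁ - 1,
        fun n ω => kernelSum K X Z n (b n) x₀ 0 ω / (n * b n ^ k : ℝ) / fX x₀ - 1,
        fun n ω => Complex.log (R n ω) - Complex.I * θ n])
      (r := ![ρ, ρ, ρ, ρ, fun n => √(b n ^ 4 + 1 / (n * b n ^ k)),
        fun n => √(b n ^ 4 + 1 / (n * b n ^ k)), fun _ => 1]) ?_ fun c hc => ?_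
    · intro i
      fin_cases i
      · exact o₁
      · exact o₂
      · exact o₃
      · exact o₄
      · exact e₁
      · exact e₀
      · exact htight
    · set c₁ := min (1 / 2) ((Real.pi - κ) / 12) with hc₁
      have hc₁0 : 0 < c₁ := lt_min (by norm_num) (by linarith)
      refine ⟨6 * c + c ^ 2 / c₁, by positivity, ?_⟩
      have hden : Tendsto (fun n => c * √(b n ^ 4 + 1 / (n * b n ^ k))) atTop (𝓝 0) := by
        have h1 : Tendsto (fun n : ℕ => 1 / ((n : ℝ) * b n ^ k)) atTop (𝓝 0) := by
          simp only [one_div]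
          exact hnb.inv_tendsto_atTop
        have h2 := (((hb0.pow 4).add h1).sqrt).const_mul c
        simpa using h2
      filter_upwards [hRcase, haκ, hev, hden.eventually_lt_const (show (0 : ℝ) < 1 by norm_num),
        hs.eventually hne, hsa.eventually hne] with n h1 h2 ⟨h3, h4, h5⟩ h6 h7 h8
      refine ae_of_all _ fun ω hall => ?_
      have g0 := hall 0
      have g1 := hall 1
      have g2 := hall 2
      have g3 := hall 3
      have g4 := hall 4
      have g5 := hall 5
      have g6 := hall 6
      simp only [Matrix.cons_val, abs_one, mul_one] at g0 g1 g2 g3 g4 g5 g6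
      have hρ0 : 0 ≤ ρ n := by
        have h1 := hf (s n)
        have h2 := hf (s n + a n)
        rw [hρ]
        positivity
      rw [abs_of_nonneg (Real.sqrt_nonneg _)] at g4 g5
      rw [abs_of_nonneg hρ0] at g0 g1 g2 g3 ⊢
      -- A small rate permits linearisation of the logarithm. Otherwise 1 < cρ/c₁, and tightness
      -- already is a bound of order ρ; this produces the constant c²/c₁.
      rcases le_or_gt (c * ρ n) c₁ with hsmall | hlarge
      · have hne0 : ((n * b n ^ k : ℝ) : ℂ) ≠ 0 := by exact_mod_cast h5.ne'
        have hD : ∀ x, ‖kernelSum K X Z n (b n) x 0 ω / (n * b n ^ k : ℝ) / fX x - 1‖ ≤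
            c * √(b n ^ 4 + 1 / (n * b n ^ k)) → kernelSum K X Z n (b n) x 0 ω ≠ 0 := by
          intro x hle h0
          rw [h0] at hle
          simp only [zero_div, zero_sub, norm_neg, norm_one] at hle
          linarith
        have hD₁ := hD x₁ g4
        have hD₀ := hD x₀ g5
        have hlamc : (lam : ℂ) ≠ 0 := by exact_mod_cast hlam.ne'
        have hx₁c : (fX x₁ : ℂ) ≠ 0 := by exact_mod_cast hx₁.ne'
        have hx₀c : (fX x₀ : ℂ) ≠ 0 := by exact_mod_cast hx₀.ne'
        have hAne : ∀ u : ℝ, charFun F₁ u ≠ 0 → ∀ x, (fX x : ℂ) ≠ 0 →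
            leadingTerm fX lam m₁ F₁ x (Complex.I * u) ≠ 0 := by
          intro u hu x hxc
          rw [leadingTerm, complexMGF_id_I_mul]
          exact mul_ne_zero hlamc (mul_ne_zero hu (mul_ne_zero hxc (Complex.exp_ne_zero _)))
        have hNne : ∀ (w A : ℂ), ‖w / A - 1‖ ≤ c * ρ n → w ≠ 0 := by
          intro w A hle h0
          rw [h0] at hle
          simp only [zero_div, zero_sub, norm_neg, norm_one] at hle
          have : c₁ ≤ 1 / 2 := min_le_left _ _
          linarith
        have n1 := hNne _ _ g0
        have n2 := hNne _ _ g1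
        have n3 := hNne _ _ g2
        have n4 := hNne _ _ g3
        have hRne : R n ω ≠ 0 := by
          have hk : ∀ x u, N x u n ω ≠ 0 → kernelSum K X Z n (b n) x (Complex.I * u) ω ≠ 0 :=
            fun x u hxu h0 => hxu (by simp only [hN, h0, zero_div])
          simp only [hR, cfHat_eq]
          exact mul_ne_zero (div_ne_zero (div_ne_zero (hk _ _ n1) hD₁) (div_ne_zero (hk _ _ n2) hD₀))
            (inv_ne_zero (div_ne_zero (div_ne_zero (hk _ _ n3) hD₁) (div_ne_zero (hk _ _ n4) hD₀)))
        obtain ⟨-, -, -, -, hReq⟩ := (h1 ω).resolve_left hRne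
        have hA1 := hAne (s n + a n) h8 x₁ hx₁c
        have hA2 := hAne (s n + a n) h8 x₀ hx₀c
        have hA3 := hAne (s n) h7 x₁ hx₁c
        have hA4 := hAne (s n) h7 x₀ hx₀c
        -- Weight, densities and characteristic functions occur equally on both sides, so only the
        -- phase θ survives in the double ratio of leading terms.
        have hAA : leadingTerm fX lam m₁ F₁ x₁ (Complex.I * (s n + a n : ℝ)) *
            leadingTerm fX lam m₁ F₁ x₀ (Complex.I * s n) =
            Complex.exp (Complex.I * θ n) * (leadingTerm fX lam m₁ F₁ x₀
              (Complex.I * (s n + a n : ℝ)) * leadingTerm fX lam m₁ F₁ x₁ (Complex.I * s n)) := by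
          have he : Complex.exp (Complex.I * (s n + a n : ℝ) * m₁ x₁) *
              Complex.exp (Complex.I * s n * m₁ x₀) = Complex.exp (Complex.I * θ n) *
              (Complex.exp (Complex.I * (s n + a n : ℝ) * m₁ x₀) *
                Complex.exp (Complex.I * s n * m₁ x₁)) := by
            rw [← Complex.exp_add, ← Complex.exp_add, ← Complex.exp_add]
            congr 1
            simp only [hθ]
            push_cast
            ring
          simp only [leadingTerm]
          linear_combination ((lam : ℂ) * lam * complexMGF id F₁ (Complex.I * (s n + a n : ℝ)) *
            complexMGF id F₁ (Complex.I * s n) * fX x₁ * fX x₀) * he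
        have hfin : R n ω = Complex.exp (Complex.I * θ n) *
            ((N x₁ (s n + a n) n ω / leadingTerm fX lam m₁ F₁ x₁ (Complex.I * (s n + a n : ℝ))) /
              (N x₀ (s n + a n) n ω / leadingTerm fX lam m₁ F₁ x₀ (Complex.I * (s n + a n : ℝ))) *
            ((N x₁ (s n) n ω / leadingTerm fX lam m₁ F₁ x₁ (Complex.I * s n)) /
              (N x₀ (s n) n ω / leadingTerm fX lam m₁ F₁ x₀ (Complex.I * s n)))⁻¹) := by
          rw [hReq]
          field_simp
          linear_combination (exp := 1) hAA
        rw [hfin]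
        refine (norm_log_cexp_mul_ratio_sub_le h2 hκ (hsmall.trans (min_le_left _ _))
          (hsmall.trans (min_le_right _ _)) g0 g1 g2 g3).trans ?_
        have : 0 ≤ c ^ 2 / c₁ * ρ n := by positivity
        linarith
      · refine g6.trans ?_
        have h9 : c ≤ c ^ 2 / c₁ * ρ n := by
          rw [div_mul_eq_mul_div, le_div_iff₀ hc₁0]
          nlinarith
        have : 0 ≤ 6 * c * ρ n := by positivity
        linarith
  refine hmain.of_imp fun c hc => ⟨c, hc, ?_⟩
  filter_upwards [ha] with n hn
  refine ae_of_all _ fun ω hω => ?_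
  have hac : (a n : ℂ) ≠ 0 := by exact_mod_cast hn
  have heq : slopeHat₂ K X Z x₀ x₁ n (b n) (s n) (a n) ω - ((m₁ x₁ - m₁ x₀ : ℝ) : ℂ) =
      -Complex.I / (a n : ℂ) * (Complex.log (R n ω) - Complex.I * θ n) := by
    rw [slopeHat₂, mul_sub]
    congr 1
    simp only [hθ, Complex.ofReal_mul]
    field_simp
    rw [Complex.I_sq]
    ring
  rw [heq, norm_mul, norm_div, norm_neg, Complex.norm_I, Complex.norm_real, Real.norm_eq_abs,
    abs_mul, abs_of_nonneg (show 0 ≤ 1 / |a n| by positivity)]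
  calc 1 / |a n| * ‖Complex.log (R n ω) - Complex.I * θ n‖ ≤ 1 / |a n| * (c * |ρ n|) := by gcongr
    _ = _ := by ring

end CharacteristicFunctions

end

/-! ### The slope estimator based on moment generating functions -/

noncomputable section

theorem ofReal_mgfHat {Ω : Type*} {k : ℕ} (K : EuclideanSpace ℝ (Fin k) → ℝ)
    (X : ℕ → Ω → EuclideanSpace ℝ (Fin k)) (Z : ℕ → Ω → ℝ) (n : ℕ) (h : ℝ)
    (x : EuclideanSpace ℝ (Fin k)) (t : ℝ) (ω : Ω) :
    (mgfHat K X Z n h x t ω : ℂ) =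
      kernelSum K X Z n h x t ω / kernelSum K X Z n h x 0 ω := by
  simp [mgfHat, kernelSum]

/-- Nonnegativity of the variance of exp(te). It lets the variance of the density estimator be
absorbed by that of the exponential sums. -/
theorem sq_mgf_le_mgf_two_mul (F : Measure ℝ) [IsProbabilityMeasure F] {t : ℝ}
    (h₁ : Integrable (fun e => Real.exp (t * e)) F)
    (h₂ : Integrable (fun e => Real.exp (2 * t * e)) F) :
    mgf id F t ^ 2 ≤ mgf id F (2 * t) := by
  have e : ∀ x : ℝ, (Real.exp (t * x) - mgf id F t) ^ 2 =
      Real.exp (2 * t * x) - 2 * mgf id F t * Real.exp (t * x) + mgf id F t ^ 2 := by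
    intro x
    rw [show 2 * t * x = t * x + t * x by ring, Real.exp_add]
    ring
  have h0 : 0 ≤ ∫ x, (Real.exp (t * x) - mgf id F t) ^ 2 ∂F :=
    integral_nonneg fun x => sq_nonneg _
  have i₁ : ∫ x, Real.exp (t * x) ∂F = mgf id F t := rfl
  have i₂ : ∫ x, Real.exp (2 * t * x) ∂F = mgf id F (2 * t) := rfl
  simp_rw [e] at h0
  have i₃ : Integrable (fun x => Real.exp (2 * t * x) - 2 * mgf id F t * Real.exp (t * x)) F :=
    h₂.sub (h₁.const_mul _)
  rw [integral_add i₃ (integrable_const _), integral_sub h₂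
    (h₁.const_mul _), integral_const_mul, i₁, i₂] at h0
  simp at h0
  linarith

theorem abs_log_norm_le_of_norm_sub_one_le {B : ℂ} {r : ℝ} (hr : r ≤ 1 / 2) (hB : ‖B - 1‖ ≤ r) :
    B ≠ 0 ∧ |Real.log ‖B‖| ≤ 3 / 2 * r := by
  obtain ⟨h1, h2⟩ := norm_log_le_of_norm_sub_one_le hr hB
  refine ⟨h1, ?_⟩
  rw [← Complex.log_re]
  exact (Complex.abs_re_le_norm _).trans h2

section MomentGeneratingFunctions

variable {Ω : Type*} [MeasurableSpace Ω] {k : ℕ} {P : Measure Ω} [IsProbabilityMeasure P]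
  {X : ℕ → Ω → EuclideanSpace ℝ (Fin k)} {Z : ℕ → Ω → ℝ}
  {K : EuclideanSpace ℝ (Fin k) → ℝ} {α : ℝ}
  {fX m₁ m₂ : EuclideanSpace ℝ (Fin k) → ℝ} {lam : ℝ} {F₁ F₂ : Measure ℝ}
  [IsProbabilityMeasure F₁] [IsProbabilityMeasure F₂] {C : ℝ}

/-- Relative error of exponentially weighted kernel sums. -/
theorem MixtureSetup.isBigOP_exponential
    (H : MixtureSetup P X Z K α fX lam m₁ m₂ F₁ F₂ C) (hlam : 0 < lam)
    (x : EuclideanSpace ℝ (Fin k)) (hx : 0 < fX x) {h t : ℕ → ℝ} {μ f : ℝ → ℝ}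
    (hh : ∀ᶠ n in atTop, 0 < h n) (ht : Tendsto t atTop atTop)
    (hth : Tendsto (fun n => t n * h n) atTop (𝓝 0)) (hR : RatioRates F₁ F₂ μ f) :
    IsBigOP P (fun n ω => kernelSum K X Z n (h n) x (t n) ω / (n * h n ^ k : ℝ) /
        leadingTerm fX lam m₁ F₁ x (t n) - 1)
      (fun n => μ (t n) + √((t n * h n) ^ 4 + 1 / ((n : ℝ) * h n ^ k) *
        (mgf id F₁ (2 * t n) / mgf id F₁ (t n) ^ 2))) := by
  have ht2 : Tendsto (fun n => 2 * t n) atTop atTop := ht.const_mul_atTop (by norm_num)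
  have ht0 := ht.eventually_ge_atTop 0
  have hpos₁ : ∀ u, 0 ≤ u → 0 < mgf id F₁ u := fun u hu => mgf_pos (hR.mgf_domain₁ u hu)
  have hnn : ∀ (F : Measure ℝ) u, ‖complexMGF id F (u : ℝ)‖ = mgf id F u := fun F u => by
    rw [complexMGF_ofReal, Complex.norm_real, Real.norm_of_nonneg mgf_nonneg]
  have hzh : Tendsto (fun n => ‖(t n : ℂ)‖ * h n) atTop (𝓝 0) := by
    refine hth.congr' ?_
    filter_upwards [ht0] with n hn
    rw [Complex.norm_real, Real.norm_of_nonneg hn]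
  -- The exponent must be positive and dominate m₂(x) - m₁(x), so that the factor exp(t(m₂(x) -
  -- m₁(x))) is absorbed in the ratio condition.
  obtain ⟨d, hd⟩ := (hR.mgf_ratio (|m₂ x - m₁ x| + 1) (by positivity)).bound
  have hrat : ∀ᶠ u in atTop, Real.exp (u * (m₂ x - m₁ x)) * mgf id F₂ u ≤
      d * μ u * mgf id F₁ u := by
    filter_upwards [hd, eventually_ge_atTop 0] with u h1 h2
    have h3 := hpos₁ u h2
    rw [Real.norm_of_nonneg (hR.μ_nonneg u), Real.norm_of_nonneg
      (mul_nonneg (Real.exp_pos _).le (div_nonneg mgf_nonneg mgf_nonneg)), ← mul_div_assoc,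
      div_le_iff₀ h3] at h1
    refine le_trans ?_ h1
    have h4 : u * (m₂ x - m₁ x) ≤ (|m₂ x - m₁ x| + 1) * u := by
      have := le_abs_self (m₂ x - m₁ x)
      nlinarith
    have h5 : 0 ≤ mgf id F₂ u := mgf_nonneg
    gcongr
  have hmain := H.isBigOP_kernelSum_div_sub_one hlam x hx (q := fun n => μ (t n)) hh hzh
    (z := fun n => (t n : ℂ)) (by
      filter_upwards [ht0] with n hn
      simp only [Complex.ofReal_re]
      exact ⟨hR.mgf_domain₁ _ hn, hR.mgf_domain₁ _ (by linarith)⟩) (by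
      filter_upwards [ht0] with n hn
      simp only [Complex.ofReal_re]
      exact ⟨hR.mgf_domain₂ _ hn, hR.mgf_domain₂ _ (by linarith)⟩) (by
      filter_upwards [ht0] with n hn
      rw [complexMGF_ofReal]
      exact_mod_cast (hpos₁ _ hn).ne') (Eventually.of_forall fun n => hR.μ_nonneg _)
    ⟨d, by
      filter_upwards [ht.eventually hrat] with n hn
      rw [hnn, hnn, Complex.ofReal_re]
      exact hn⟩
    -- At frequency 2t a mere constant is needed, and μ(2t) < 1 eventually.
    ⟨|d|, by
      filter_upwards [ht2.eventually hrat, ht0, (hR.μ_zero.comp ht2).eventually_lt_const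
        (show (0 : ℝ) < 1 by norm_num)] with n hn hn0 h1
      rw [Complex.ofReal_re]
      refine hn.trans ?_
      have h2 := hpos₁ (2 * t n) (by linarith)
      have h3 := hR.μ_nonneg (2 * t n)
      have h4 := le_abs_self d
      have h5 := abs_nonneg d
      simp only [Function.comp] at h1
      gcongr
      nlinarith⟩
  refine hmain.mono 4 ?_
  filter_upwards [hh, ht.eventually_ge_atTop 1, eventually_gt_atTop 0] with n h1 h2 h3
  have hn' : (0 : ℝ) < n := by exact_mod_cast h3
  rw [hnn, Complex.ofReal_re, Complex.norm_real, Real.norm_of_nonneg (by linarith)]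
  have hμ := hR.μ_nonneg (t n)
  have hM : 0 ≤ mgf id F₁ (2 * t n) := mgf_nonneg
  rw [one_div_mul_eq_div (n * h n ^ k : ℝ)]
  set V := mgf id F₁ (2 * t n) / mgf id F₁ (t n) ^ 2 / (n * h n ^ k) with hV
  have hV0 : 0 ≤ V := by positivity
  rw [abs_of_nonneg (by positivity), abs_of_nonneg (by positivity), mul_add]
  refine add_le_add (by linarith) ?_
  have h6 : (4 : ℝ) = √(16 : ℝ) := by
    rw [show (16 : ℝ) = 4 ^ 2 by norm_num, Real.sqrt_sq (by norm_num)]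
  rw [h6, ← Real.sqrt_mul (by norm_num)]
  apply Real.sqrt_le_sqrt
  have h7 : (1 + t n) * h n ≤ 2 * (t n * h n) := by nlinarith
  have h8 : ((1 + t n) * h n) ^ 4 ≤ (2 * (t n * h n)) ^ 4 := by gcongr
  rw [mul_pow] at h8
  linarith

/-- Stochastic order of the estimator of the slope of the component with the heavier moment
generating function. -/
theorem MixtureSetup.isBigOP_slopeHat₁
    (H : MixtureSetup P X Z K α fX lam m₁ m₂ F₁ F₂ C) (hlam : 0 < lam)
    {x₀ x₁ : EuclideanSpace ℝ (Fin k)} (hx₀ : 0 < fX x₀) (hx₁ : 0 < fX x₁) {h t : ℕ → ℝ}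
    {μ f : ℝ → ℝ} (hh : ∀ᶠ n in atTop, 0 < h n) (ht : Tendsto t atTop atTop)
    (hth : Tendsto (fun n => t n * h n) atTop (𝓝 0)) (hR : RatioRates F₁ F₂ μ f)
    (hvar : Tendsto (fun n : ℕ => 1 / ((n : ℝ) * h n ^ k) *
      (mgf id F₁ (2 * t n) / mgf id F₁ (t n) ^ 2)) atTop (𝓝 0)) :
    IsBigOP P (fun n ω => slopeHat₁ K X Z x₀ x₁ n (h n) (t n) ω - (m₁ x₁ - m₁ x₀))
      (fun n => μ (t n) / t n + 1 / t n * √((t n * h n) ^ 4 + 1 / ((n : ℝ) * h n ^ k) *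
        (mgf id F₁ (2 * t n) / mgf id F₁ (t n) ^ 2))) := by
  set r : ℕ → ℝ := fun n => μ (t n) + √((t n * h n) ^ 4 + 1 / ((n : ℝ) * h n ^ k) *
    (mgf id F₁ (2 * t n) / mgf id F₁ (t n) ^ 2)) with hr
  have hpos₁ : ∀ u, 0 ≤ u → 0 < mgf id F₁ u := fun u hu => mgf_pos (hR.mgf_domain₁ u hu)
  have hr0 : ∀ n, 0 ≤ r n := fun n => by
    have := hR.μ_nonneg (t n)
    rw [hr]
    positivity
  have hrz : Tendsto r atTop (𝓝 0) := by
    have := (hR.μ_zero.comp ht).add ((hth.pow 4).add hvar).sqrt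
    simpa [hr] using this
  -- The density ratio does not cancel here, but for t ≥ 1 its error is within the rate: h ≤ th, and
  -- the moment ratio is at least 1.
  have hden : ∀ x, 0 < fX x → IsBigOP P
      (fun n ω => kernelSum K X Z n (h n) x 0 ω / (n * h n ^ k : ℝ) / fX x - 1) r := by
    intro x hx
    refine (H.isBigOP_kernelSum_zero_div_sub_one x hx hh).mono 1 ?_
    filter_upwards [hh, ht.eventually_ge_atTop 1, eventually_gt_atTop 0] with n h1 h2 h3
    have hn' : (0 : ℝ) < n := by exact_mod_cast h3
    rw [abs_of_nonneg (Real.sqrt_nonneg _), abs_of_nonneg (hr0 n), one_mul]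
    refine le_trans ?_ (le_add_of_nonneg_left (hR.μ_nonneg _))
    apply Real.sqrt_le_sqrt
    have h4 : h n ≤ t n * h n := by nlinarith
    have h5 : 1 ≤ mgf id F₁ (2 * t n) / mgf id F₁ (t n) ^ 2 := by
      rw [one_le_div (pow_pos (hpos₁ _ (by linarith)) 2)]
      exact sq_mgf_le_mgf_two_mul F₁ (hR.mgf_domain₁ _ (by linarith))
        (hR.mgf_domain₁ _ (by linarith))
    gcongr
    exact le_mul_of_one_le_right (by positivity) h5
  refine IsBigOP.of_forall_imp (ι := Fin 4) (E := ℂ)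
    (Y := ![fun n ω => kernelSum K X Z n (h n) x₁ (t n) ω / (n * h n ^ k : ℝ) /
        leadingTerm fX lam m₁ F₁ x₁ (t n) - 1,
      fun n ω => kernelSum K X Z n (h n) x₀ (t n) ω / (n * h n ^ k : ℝ) /
        leadingTerm fX lam m₁ F₁ x₀ (t n) - 1,
      fun n ω => kernelSum K X Z n (h n) x₁ 0 ω / (n * h n ^ k : ℝ) / fX x₁ - 1,
      fun n ω => kernelSum K X Z n (h n) x₀ 0 ω / (n * h n ^ k : ℝ) / fX x₀ - 1])
    (r := fun _ => r) ?_ fun c hc => ⟨6 * c, by positivity, ?_⟩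
  · intro i
    fin_cases i
    · exact H.isBigOP_exponential hlam x₁ hx₁ hh ht hth hR
    · exact H.isBigOP_exponential hlam x₀ hx₀ hh ht hth hR
    · exact hden x₁ hx₁
    · exact hden x₀ hx₀
  · have hcr : Tendsto (fun n => c * r n) atTop (𝓝 0) := by simpa using hrz.const_mul c
    filter_upwards [hh, ht.eventually_gt_atTop 0, eventually_gt_atTop 0,
      hcr.eventually_le_const (show (0 : ℝ) < 1 / 2 by norm_num)] with n h1 h2 h3 h4
    refine ae_of_all _ fun ω hall => ?_
    have hn' : (0 : ℝ) < n := by exact_mod_cast h3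
    have hne0 : ((n * h n ^ k : ℝ) : ℂ) ≠ 0 := by
      have : (n * h n ^ k : ℝ) ≠ 0 := by positivity
      exact_mod_cast this
    have g0 := hall 0
    have g1 := hall 1
    have g2 := hall 2
    have g3 := hall 3
    simp only [Matrix.cons_val, abs_of_nonneg (hr0 n)] at g0 g1 g2 g3
    obtain ⟨n0, l0⟩ := abs_log_norm_le_of_norm_sub_one_le h4 g0
    obtain ⟨n1, l1⟩ := abs_log_norm_le_of_norm_sub_one_le h4 g1
    obtain ⟨n2, l2⟩ := abs_log_norm_le_of_norm_sub_one_le h4 g2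
    obtain ⟨n3, l3⟩ := abs_log_norm_le_of_norm_sub_one_le h4 g3
    have hMne : complexMGF id F₁ (t n) ≠ 0 := by
      rw [complexMGF_ofReal]
      exact_mod_cast (hpos₁ _ h2.le).ne'
    have hlamc : (lam : ℂ) ≠ 0 := by exact_mod_cast hlam.ne'
    have hx₁c : (fX x₁ : ℂ) ≠ 0 := by exact_mod_cast hx₁.ne'
    have hx₀c : (fX x₀ : ℂ) ≠ 0 := by exact_mod_cast hx₀.ne'
    set S₁ := kernelSum K X Z n (h n) x₁ (t n) ω
    set S₀ := kernelSum K X Z n (h n) x₀ (t n) ω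
    set D₁ := kernelSum K X Z n (h n) x₁ 0 ω
    set D₀ := kernelSum K X Z n (h n) x₀ 0 ω
    set nn := ((n * h n ^ k : ℝ) : ℂ)
    have hratio : S₁ / D₁ / (S₀ / D₀) = Complex.exp ((t n * (m₁ x₁ - m₁ x₀) : ℝ)) *
        (S₁ / nn / leadingTerm fX lam m₁ F₁ x₁ (t n) /
          (S₀ / nn / leadingTerm fX lam m₁ F₁ x₀ (t n)) *
        (D₁ / nn / fX x₁ / (D₀ / nn / fX x₀))⁻¹) := by
      have he : Complex.exp (t n * m₁ x₁) =
          Complex.exp ((t n * (m₁ x₁ - m₁ x₀) : ℝ)) * Complex.exp (t n * m₁ x₀) := by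
        rw [← Complex.exp_add]
        congr 1
        push_cast
        ring
      have hE := Complex.exp_ne_zero (t n * m₁ x₀ : ℂ)
      have hE' := Complex.exp_ne_zero ((t n * (m₁ x₁ - m₁ x₀) : ℝ) : ℂ)
      simp only [leadingTerm, he]
      generalize Complex.exp (t n * m₁ x₀ : ℂ) = E₀ at hE
      generalize Complex.exp ((t n * (m₁ x₁ - m₁ x₀) : ℝ) : ℂ) = E' at hE'
      have s0 : S₀ ≠ 0 := fun h0 => n1 (by simp [h0])
      have d1 : D₁ ≠ 0 := fun h0 => n2 (by simp [h0])
      have d0 : D₀ ≠ 0 := fun h0 => n3 (by simp [h0])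
      field_simp
    have hlog : Real.log (mgfHat K X Z n (h n) x₁ (t n) ω / mgfHat K X Z n (h n) x₀ (t n) ω) =
        t n * (m₁ x₁ - m₁ x₀) +
        (Real.log ‖S₁ / nn / leadingTerm fX lam m₁ F₁ x₁ (t n)‖ -
          Real.log ‖S₀ / nn / leadingTerm fX lam m₁ F₁ x₀ (t n)‖ -
          (Real.log ‖D₁ / nn / fX x₁‖ - Real.log ‖D₀ / nn / fX x₀‖)) := by
      -- `Real.log` ignores the sign, so signed kernels need no separate treatment and the moduli of
      -- the complex factors suffice.
      rw [← Real.log_abs, ← Real.norm_eq_abs, ← Complex.norm_real, Complex.ofReal_div,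
        ofReal_mgfHat, ofReal_mgfHat, hratio, norm_mul, Complex.norm_exp, Complex.ofReal_re,
        Real.log_mul (Real.exp_ne_zero _) (norm_ne_zero_iff.2 (mul_ne_zero (div_ne_zero n0 n1)
          (inv_ne_zero (div_ne_zero n2 n3)))), Real.log_exp, log_norm_div_mul_inv n0 n1 n2 n3]
    have hrate : μ (t n) / t n + 1 / t n * √((t n * h n) ^ 4 + 1 / ((n : ℝ) * h n ^ k) *
        (mgf id F₁ (2 * t n) / mgf id F₁ (t n) ^ 2)) = 1 / t n * r n := by
      rw [hr]
      ring
    rw [hrate, abs_of_nonneg (mul_nonneg (by positivity) (hr0 n)), slopeHat₁, hlog]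
    rw [show ∀ w : ℝ, 1 / t n * (t n * (m₁ x₁ - m₁ x₀) + w) - (m₁ x₁ - m₁ x₀) = 1 / t n * w from
      fun w => by field_simp; ring, norm_mul, Real.norm_of_nonneg (by positivity),
      mul_left_comm]
    gcongr
    rw [Real.norm_eq_abs]
    rw [abs_le] at l0 l1 l2 l3 ⊢
    constructor <;> linarith [l0.1, l0.2, l1.1, l1.2, l2.1, l2.2, l3.1, l3.2]

end MomentGeneratingFunctions

end

/-! ### From measurable kernels to regular kernels -/

noncomputable section

section RegularKernels

variable {Ω : Type*} [MeasurableSpace Ω] {k : ℕ} {P : Measure Ω} [IsProbabilityMeasure P]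
  {X : ℕ → Ω → EuclideanSpace ℝ (Fin k)} {Z : ℕ → Ω → ℝ}
  {K : EuclideanSpace ℝ (Fin k) → ℝ}
  {fX m₁ m₂ : EuclideanSpace ℝ (Fin k) → ℝ} {x₀ x₁ : EuclideanSpace ℝ (Fin k)} {lam : ℝ}
  {F₁ F₂ : Measure ℝ} [IsProbabilityMeasure F₁] [IsProbabilityMeasure F₂]

theorem exists_mixtureSetup (hK : IsRegularKernel K) (hmodel : RegularModel fX m₁ m₂ x₀ x₁)
    (hlam : 0 ≤ lam) (hlam_le : lam ≤ 1) (hsample : IsMixtureSample P X Z fX lam m₁ m₂ F₁ F₂) :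
    ∃ K' α C, K =ᵐ[volume] K' ∧ MixtureSetup P X Z K' α fX lam m₁ m₂ F₁ F₂ C := by
  obtain ⟨K', α, hKK', hK'⟩ := hK.exists_isMeasurableKernel
  obtain ⟨c₀, h₀⟩ := hmodel.density_bounded
  obtain ⟨c₁, h₁⟩ := hmodel.density_partials.exists_hasTaylorBound
  obtain ⟨c₂, h₂⟩ := hmodel.partials₁.exists_hasTaylorBound
  obtain ⟨c₃, h₃⟩ := hmodel.partials₂.exists_hasTaylorBound
  refine ⟨K', α, max (max 1 c₀) (max c₁ (max c₂ c₃)), hKK', ?_⟩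
  exact
    { sample := hsample
      kernel := hK'
      lam_nonneg := hlam
      lam_le := hlam_le
      one_le := by simp
      measurable_density := hmodel.density_partials.1.continuous.measurable
      measurable₁ := hmodel.partials₁.1.continuous.measurable
      measurable₂ := hmodel.partials₂.1.continuous.measurable
      density_le := fun y => (h₀ y).trans (by simp)
      taylor_density := fun x => (h₁ x).mono (by simp)
      taylor₁ := fun x => (h₂ x).mono (by simp)
      taylor₂ := fun x => (h₃ x).mono (by simp) }

/-- Kernels that agree almost everywhere give the same weights almost surely. -/
theorem IsMixtureSample.ae_kernel_eq (hsample : IsMixtureSample P X Z fX lam m₁ m₂ F₁ F₂)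
    {K' : EuclideanSpace ℝ (Fin k) → ℝ} (hKK' : K =ᵐ[volume] K') {h : ℝ} (hh : h ≠ 0)
    (x : EuclideanSpace ℝ (Fin k)) :
    ∀ᵐ ω ∂P, ∀ p, K (h⁻¹ • (X p ω - x)) = K' (h⁻¹ • (X p ω - x)) := by
  refine ae_all_iff.2 fun p => ?_
  have q₁ : Measure.QuasiMeasurePreserving (X p) P volume :=
    ⟨hsample.measurable_X p, by
      rw [hsample.law_X p]
      exact withDensity_absolutelyContinuous _ _⟩
  have q₂ : Measure.QuasiMeasurePreserving (fun y : EuclideanSpace ℝ (Fin k) => y - x)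
      volume volume := (measurePreserving_sub_right volume x).quasiMeasurePreserving
  have q₃ : Measure.QuasiMeasurePreserving (fun y : EuclideanSpace ℝ (Fin k) => h⁻¹ • y)
      volume volume :=
    ⟨measurable_const_smul _, by
      rw [Measure.map_addHaar_smul volume (inv_ne_zero hh)]
      exact Measure.smul_absolutelyContinuous⟩
  exact (q₃.comp (q₂.comp q₁)).ae_eq_comp hKK'

theorem IsMixtureSample.slopeHat₁_ae_eq (hsample : IsMixtureSample P X Z fX lam m₁ m₂ F₁ F₂)
    {K' : EuclideanSpace ℝ (Fin k) → ℝ} (hKK' : K =ᵐ[volume] K') {h : ℝ} (hh : h ≠ 0)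
    (n : ℕ) (t : ℝ) :
    slopeHat₁ K' X Z x₀ x₁ n h t =ᵐ[P] slopeHat₁ K X Z x₀ x₁ n h t := by
  filter_upwards [hsample.ae_kernel_eq hKK' hh x₀, hsample.ae_kernel_eq hKK' hh x₁] with ω h₀ h₁
  simp only [slopeHat₁, mgfHat, h₀, h₁]

theorem IsMixtureSample.slopeHat₂_ae_eq (hsample : IsMixtureSample P X Z fX lam m₁ m₂ F₁ F₂)
    {K' : EuclideanSpace ℝ (Fin k) → ℝ} (hKK' : K =ᵐ[volume] K') {b : ℝ} (hb : b ≠ 0)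
    (n : ℕ) (s a : ℝ) :
    slopeHat₂ K' X Z x₀ x₁ n b s a =ᵐ[P] slopeHat₂ K X Z x₀ x₁ n b s a := by
  filter_upwards [hsample.ae_kernel_eq hKK' hb x₀, hsample.ae_kernel_eq hKK' hb x₁] with ω h₀ h₁
  simp only [slopeHat₂, cfHat, h₀, h₁]

theorem isBigOP_slopeHat₁ (hK : IsRegularKernel K) (hmodel : RegularModel fX m₁ m₂ x₀ x₁)
    (hlam : 0 < lam) (hlam_le : lam ≤ 1) (hsample : IsMixtureSample P X Z fX lam m₁ m₂ F₁ F₂)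
    {h t : ℕ → ℝ} {μ f : ℝ → ℝ} (hh : ∀ᶠ n in atTop, 0 < h n) (ht : Tendsto t atTop atTop)
    (hth : Tendsto (fun n => t n * h n) atTop (𝓝 0)) (hR : RatioRates F₁ F₂ μ f)
    (hvar : Tendsto (fun n : ℕ => 1 / ((n : ℝ) * h n ^ k) *
      (mgf id F₁ (2 * t n) / mgf id F₁ (t n) ^ 2)) atTop (𝓝 0)) :
    IsBigOP P (fun n ω => slopeHat₁ K X Z x₀ x₁ n (h n) (t n) ω - (m₁ x₁ - m₁ x₀))
      (fun n => μ (t n) / t n + 1 / t n * √((t n * h n) ^ 4 + 1 / ((n : ℝ) * h n ^ k) *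
        (mgf id F₁ (2 * t n) / mgf id F₁ (t n) ^ 2))) := by
  obtain ⟨K', α, C, hKK', H⟩ := exists_mixtureSetup hK hmodel hlam.le hlam_le hsample
  refine (H.isBigOP_slopeHat₁ hlam hmodel.density_pos₀ hmodel.density_pos₁ hh ht hth hR
    hvar).congr_ae ?_
  filter_upwards [hh] with n hn
  filter_upwards [hsample.slopeHat₁_ae_eq (x₀ := x₀) (x₁ := x₁) hKK' hn.ne' n (t n)] with ω hω
  rw [hω]

/-- Obtained by exchanging the components: for characteristic functions the second one dominates,
and its weight 1 - lam is positive. -/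
theorem isBigOP_slopeHat₂ (hK : IsRegularKernel K) (hmodel : RegularModel fX m₁ m₂ x₀ x₁)
    (hlam : 0 < lam) (hlam_lt : lam < 1) (hsample : IsMixtureSample P X Z fX lam m₁ m₂ F₁ F₂)
    {b s a : ℕ → ℝ} {μ f : ℝ → ℝ} (hb : ∀ᶠ n in atTop, 0 < b n) (hb0 : Tendsto b atTop (𝓝 0))
    (hnb : Tendsto (fun n : ℕ => (n : ℝ) * b n ^ k) atTop atTop)
    (hs : Tendsto s atTop atTop) (hsb : Tendsto (fun n => s n * b n) atTop (𝓝 0))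
    (ha : ∀ᶠ n in atTop, a n ≠ 0) {A κ : ℝ} (haA : ∀ᶠ n in atTop, |a n| ≤ A) (hκ : κ < Real.pi)
    (haκ : ∀ᶠ n in atTop, |a n * (m₂ x₁ - m₂ x₀)| ≤ κ) (hR : RatioRates F₁ F₂ μ f) :
    IsBigOP P
      (fun n ω => slopeHat₂ K X Z x₀ x₁ n (b n) (s n) (a n) ω - ((m₂ x₁ - m₂ x₀ : ℝ) : ℂ))
      (fun n => 1 / |a n| * (f (s n + a n) + f (s n)
        + √((b n * s n) ^ 4 + 1 / ((n : ℝ) * b n ^ k * ‖charFun F₂ (s n + a n)‖ ^ 2))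
        + √((b n * s n) ^ 4 + 1 / ((n : ℝ) * b n ^ k * ‖charFun F₂ (s n)‖ ^ 2)))) := by
  obtain ⟨K', α, C, hKK', H⟩ := exists_mixtureSetup hK hmodel hlam.le hlam_lt.le hsample
  refine (H.swap.isBigOP_slopeHat₂ (by linarith) hmodel.density_pos₀ hmodel.density_pos₁ hb hb0
    hnb hs hsb ha haA hκ haκ hR.f_nonneg hR.f_zero hR.cf_ne_zero hR.cf_ratio).congr_ae ?_
  filter_upwards [hb] with n hn
  filter_upwards [hsample.slopeHat₂_ae_eq (x₀ := x₀) (x₁ := x₁) hKK' hn.ne' n (s n) (a n)]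
    with ω hω
  rw [hω]

end RegularKernels

/-! ### Normal errors -/

section Gaussian

theorem mgf_id_gaussianReal_zero (σ : NNReal) (t : ℝ) :
    mgf id (gaussianReal 0 (σ ^ 2)) t = Real.exp ((σ : ℝ) ^ 2 * t ^ 2 / 2) := by
  rw [mgf_id_gaussianReal]
  simp

theorem mgf_gaussianReal_two_mul_div_sq (σ : NNReal) (t : ℝ) :
    mgf id (gaussianReal 0 (σ ^ 2)) (2 * t) / mgf id (gaussianReal 0 (σ ^ 2)) t ^ 2 =
      Real.exp ((σ : ℝ) ^ 2 * t ^ 2) := by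
  rw [mgf_id_gaussianReal_zero, mgf_id_gaussianReal_zero, ← Real.exp_nat_mul, ← Real.exp_sub]
  congr 1
  push_cast
  ring

theorem norm_charFun_gaussianReal_zero (σ : NNReal) (s : ℝ) :
    ‖charFun (gaussianReal 0 (σ ^ 2)) s‖ = Real.exp (-((σ : ℝ) ^ 2 * s ^ 2 / 2)) := by
  rw [charFun_gaussianReal, Complex.norm_exp]
  congr 1
  have : ((0 : ℂ) - ((σ : ℝ) ^ 2 * s ^ 2 / 2 : ℝ)).re = -((σ : ℝ) ^ 2 * s ^ 2 / 2) := by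
    rw [zero_sub, Complex.neg_re, Complex.ofReal_re]
  rw [← this]
  push_cast
  simp

theorem tendsto_exp_neg_mul_sq {c : ℝ} (hc : c < 0) :
    Tendsto (fun t : ℝ => Real.exp (c * t ^ 2)) atTop (𝓝 0) :=
  Real.tendsto_exp_atBot.comp ((tendsto_pow_atTop (by norm_num)).const_mul_atTop_of_neg hc)

/-- The moment generating functions have ratio exp(-δt²/2). The extra factor exp(εt) is absorbed by
exp(νt²) once t ≥ ε/ν, hence the loss of ν in the exponent; the characteristic functions need no
such loss. -/
theorem ratioRates_gaussianReal {σ₁ σ₂ : NNReal} {δ ν : ℝ}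
    (hδ : δ = (σ₁ : ℝ) ^ 2 - (σ₂ : ℝ) ^ 2) (hν : 0 < ν) (hνδ : ν < δ / 2) :
    RatioRates (gaussianReal 0 (σ₁ ^ 2)) (gaussianReal 0 (σ₂ ^ 2))
      (fun t => Real.exp (-(δ / 2 - ν) * t ^ 2)) (fun s => Real.exp (-(1 / 2) * δ * s ^ 2)) where
  mgf_domain₁ t _ := integrable_exp_mul_gaussianReal t
  mgf_domain₂ t _ := integrable_exp_mul_gaussianReal t
  μ_nonneg _ := (Real.exp_pos _).le
  μ_zero := tendsto_exp_neg_mul_sq (by linarith)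
  mgf_ratio ε hε := by
    refine IsBigO.of_bound 1 ?_
    filter_upwards [eventually_ge_atTop (ε / ν), eventually_ge_atTop 0] with t h1 h2
    rw [mgf_id_gaussianReal_zero, mgf_id_gaussianReal_zero, ← Real.exp_sub, ← Real.exp_add,
      Real.norm_of_nonneg (Real.exp_pos _).le, Real.norm_of_nonneg (Real.exp_pos _).le, one_mul,
      Real.exp_le_exp, hδ]
    rw [div_le_iff₀ hν] at h1
    nlinarith
  f_nonneg _ := (Real.exp_pos _).le
  f_zero := tendsto_exp_neg_mul_sq (by linarith)
  cf_ne_zero := Eventually.of_forall fun s => by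
    rw [← norm_pos_iff, norm_charFun_gaussianReal_zero]
    positivity
  cf_ratio := by
    refine IsBigO.of_bound 1 (Eventually.of_forall fun s => ?_)
    rw [norm_div, norm_charFun_gaussianReal_zero, norm_charFun_gaussianReal_zero, ← Real.exp_sub,
      Real.norm_of_nonneg (Real.exp_pos _).le, one_mul, Real.exp_le_exp, hδ]
    linarith

variable {Ω : Type*} [MeasurableSpace Ω] {k : ℕ} {P : Measure Ω} [IsProbabilityMeasure P]
  {X : ℕ → Ω → EuclideanSpace ℝ (Fin k)} {Z : ℕ → Ω → ℝ}
  {K : EuclideanSpace ℝ (Fin k) → ℝ}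
  {fX m₁ m₂ : EuclideanSpace ℝ (Fin k) → ℝ} {x₀ x₁ : EuclideanSpace ℝ (Fin k)} {lam : ℝ}
  {σ₁ σ₂ : NNReal} {δ : ℝ}

theorem isBigOP_slopeHat₁_gaussianReal (hK : IsRegularKernel K)
    (hmodel : RegularModel fX m₁ m₂ x₀ x₁) (hlam : 0 < lam) (hlam_le : lam ≤ 1)
    (hsample : IsMixtureSample P X Z fX lam m₁ m₂ (gaussianReal 0 (σ₁ ^ 2))
      (gaussianReal 0 (σ₂ ^ 2)))
    (hδ : δ = (σ₁ : ℝ) ^ 2 - (σ₂ : ℝ) ^ 2) {ν : ℝ} (hν : 0 < ν) (hνδ : ν < δ / 2)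
    {h t : ℕ → ℝ} (hh : ∀ᶠ n in atTop, 0 < h n) (ht : Tendsto t atTop atTop)
    (hth : Tendsto (fun n => t n * h n) atTop (𝓝 0))
    (hvar : Tendsto (fun n : ℕ => 1 / ((n : ℝ) * h n ^ k) *
      Real.exp ((σ₁ : ℝ) ^ 2 * t n ^ 2)) atTop (𝓝 0)) :
    IsBigOP P (fun n ω => slopeHat₁ K X Z x₀ x₁ n (h n) (t n) ω - (m₁ x₁ - m₁ x₀))
      (fun n => 1 / t n * (Real.exp (-(δ / 2 - ν) * t n ^ 2) +
        √((t n * h n) ^ 4 + 1 / ((n : ℝ) * h n ^ k) * Real.exp ((σ₁ : ℝ) ^ 2 * t n ^ 2)))) := by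
  have := isBigOP_slopeHat₁ hK hmodel hlam hlam_le hsample hh ht hth
    (ratioRates_gaussianReal hδ hν hνδ) (by simpa only [mgf_gaussianReal_two_mul_div_sq])
  simp only [mgf_gaussianReal_two_mul_div_sq] at this
  refine this.mono 1 (Eventually.of_forall fun n => le_of_eq ?_)
  rw [one_mul]
  congr 1
  ring

/-- Of the two frequencies, s has the larger component ratio and s + a the larger variance. Bounding
each pair of terms by twice the larger one gives the factor 2/a. -/
theorem isBigOP_slopeHat₂_gaussianReal (hK : IsRegularKernel K)
    (hmodel : RegularModel fX m₁ m₂ x₀ x₁) (hlam : 0 < lam) (hlam_lt : lam < 1)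
    (hsample : IsMixtureSample P X Z fX lam m₁ m₂ (gaussianReal 0 (σ₁ ^ 2))
      (gaussianReal 0 (σ₂ ^ 2)))
    (hδ : δ = (σ₁ : ℝ) ^ 2 - (σ₂ : ℝ) ^ 2) (hδ0 : 0 < δ)
    {b s : ℕ → ℝ} (hb : ∀ᶠ n in atTop, 0 < b n) (hb0 : Tendsto b atTop (𝓝 0))
    (hnb : Tendsto (fun n : ℕ => (n : ℝ) * b n ^ k) atTop atTop)
    (hs : Tendsto s atTop atTop) (hsb : Tendsto (fun n => s n * b n) atTop (𝓝 0))
    {a : ℝ} (ha : 0 < a) (haπ : a * |m₂ x₁ - m₂ x₀| < Real.pi) :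
    IsBigOP P
      (fun n ω => slopeHat₂ K X Z x₀ x₁ n (b n) (s n) a ω - ((m₂ x₁ - m₂ x₀ : ℝ) : ℂ))
      (fun n => Real.exp (-(1 / 2) * δ * s n ^ 2) +
        √((b n * s n) ^ 4 + 1 / ((n : ℝ) * b n ^ k) *
          Real.exp ((σ₂ : ℝ) ^ 2 * (s n + a) ^ 2))) := by
  have := isBigOP_slopeHat₂ (a := fun _ => a) (A := |a|) hK hmodel hlam hlam_lt hsample hb hb0 hnb
    hs hsb (Eventually.of_forall fun _ => ha.ne') (Eventually.of_forall fun _ => le_rfl) haπ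
    (Eventually.of_forall fun _ => by rw [abs_mul, abs_of_pos ha])
    -- Any admissible ν would do, since ν affects only μ, which does not occur in this bound.
    (ratioRates_gaussianReal (ν := δ / 4) hδ (by linarith) (by linarith))
  refine this.mono (2 / a) ?_
  filter_upwards [hb, hs.eventually_ge_atTop 0, eventually_gt_atTop 0] with n h1 h2 h3
  have hn : (0 : ℝ) < n := by exact_mod_cast h3
  have e : ∀ u : ℝ, 1 / ((n : ℝ) * b n ^ k * ‖charFun (gaussianReal 0 (σ₂ ^ 2)) u‖ ^ 2) =
      1 / ((n : ℝ) * b n ^ k) * Real.exp ((σ₂ : ℝ) ^ 2 * u ^ 2) := by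
    intro u
    rw [norm_charFun_gaussianReal_zero, ← Real.exp_nat_mul, one_div, mul_inv, ← Real.exp_neg,
      one_div]
    congr 2
    push_cast
    ring
  rw [e, e, abs_of_pos ha, abs_of_nonneg (by positivity), abs_of_nonneg (by positivity)]
  have h4 : s n ^ 2 ≤ (s n + a) ^ 2 := by gcongr; linarith
  have h5 : Real.exp (-(1 / 2) * δ * (s n + a) ^ 2) ≤ Real.exp (-(1 / 2) * δ * s n ^ 2) := by
    rw [Real.exp_le_exp]
    nlinarith
  have h6 : √((b n * s n) ^ 4 + 1 / ((n : ℝ) * b n ^ k) * Real.exp ((σ₂ : ℝ) ^ 2 * s n ^ 2)) ≤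
      √((b n * s n) ^ 4 + 1 / ((n : ℝ) * b n ^ k) *
        Real.exp ((σ₂ : ℝ) ^ 2 * (s n + a) ^ 2)) := by gcongr
  rw [show 2 / a = 1 / a * 2 by ring, mul_assoc (1 / a) 2]
  refine mul_le_mul_of_nonneg_left ?_ (one_div_pos.2 ha).le
  linarith

end Gaussian

/-! ### Polynomial rates in dimension one -/

section PolynomialRates

theorem tendsto_natCast_rpow_neg {η : ℝ} (hη : 0 < η) :
    Tendsto (fun n : ℕ => (n : ℝ) ^ (-η)) atTop (𝓝 0) :=
  (tendsto_rpow_neg_atTop hη).comp tendsto_natCast_atTop_atTop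

theorem tendsto_inv_mul_sqrt_log {σ ε : ℝ} (hσ : 0 < σ) (hε : 0 < ε) :
    Tendsto (fun n : ℕ => 1 / σ * √(ε * Real.log n)) atTop atTop :=
  (Real.tendsto_sqrt_atTop.comp ((Real.tendsto_log_atTop.comp
    tendsto_natCast_atTop_atTop).const_mul_atTop hε)).const_mul_atTop (by positivity)

theorem sq_inv_mul_sqrt_log {σ ε : ℝ} (hε : 0 < ε) (n : ℕ) :
    (1 / σ * √(ε * Real.log n)) ^ 2 = ε / σ ^ 2 * Real.log n := by
  rw [mul_pow, Real.sq_sqrt (mul_nonneg hε.le (Real.log_natCast_nonneg n))]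
  ring

theorem exp_mul_sq_inv_mul_sqrt_log {σ ε : ℝ} (hε : 0 < ε) (c : ℝ) {n : ℕ} (hn : 0 < n) :
    Real.exp (c * (1 / σ * √(ε * Real.log n)) ^ 2) = (n : ℝ) ^ (c * (ε / σ ^ 2)) := by
  rw [sq_inv_mul_sqrt_log hε, Real.rpow_def_of_pos (by exact_mod_cast hn)]
  congr 1
  ring

/-- The bound log n ≤ n^η/η spends half of the decay n^(-2η) on removing the logarithm. -/
theorem sq_mul_rpow_le {σ ε η : ℝ} (hε : 0 < ε) (hη : 0 < η) {n : ℕ} (hn : 0 < n) :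
    (1 / σ * √(ε * Real.log n) * (n : ℝ) ^ (-η)) ^ 2 ≤ ε / σ ^ 2 / η * (n : ℝ) ^ (-η) := by
  have hn' : (0 : ℝ) < n := by exact_mod_cast hn
  have h1 := Real.log_le_rpow_div hn'.le hη
  rw [mul_pow, sq_inv_mul_sqrt_log hε, ← Real.rpow_natCast ((n : ℝ) ^ (-η)),
    ← Real.rpow_mul hn'.le]
  calc ε / σ ^ 2 * Real.log n * (n : ℝ) ^ (-η * (2 : ℕ))
      ≤ ε / σ ^ 2 * ((n : ℝ) ^ η / η) * (n : ℝ) ^ (-η * (2 : ℕ)) := by gcongr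
    _ = ε / σ ^ 2 / η * ((n : ℝ) ^ η * (n : ℝ) ^ (-η * (2 : ℕ))) := by ring
    _ = ε / σ ^ 2 / η * (n : ℝ) ^ (-η) := by
        rw [← Real.rpow_add hn']
        congr 2
        push_cast
        ring

theorem tendsto_sqrt_log_mul_rpow {σ ε η : ℝ} (hε : 0 < ε) (hη : 0 < η) :
    Tendsto (fun n : ℕ => 1 / σ * √(ε * Real.log n) * (n : ℝ) ^ (-η)) atTop (𝓝 0) := by
  have h1 : Tendsto (fun n : ℕ => ε / σ ^ 2 / η * (n : ℝ) ^ (-η)) atTop (𝓝 0) := by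
    simpa using (tendsto_natCast_rpow_neg hη).const_mul (ε / σ ^ 2 / η)
  have h2 := squeeze_zero' (Eventually.of_forall fun n : ℕ =>
    sq_nonneg (1 / σ * √(ε * Real.log n) * (n : ℝ) ^ (-η)))
    ((eventually_gt_atTop 0).mono fun n hn => sq_mul_rpow_le hε hη hn) h1
  have h3 := h2.sqrt
  simp only [Real.sqrt_sq_eq_abs, Real.sqrt_zero] at h3
  exact tendsto_zero_iff_abs_tendsto_zero _ |>.2 h3

theorem sqrt_pow_four_add_le {x y D D' w : ℝ} (hw : 0 ≤ w) (hD' : 0 ≤ D') (hx : x ^ 2 ≤ D * w)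
    (hy : y ≤ (D' * w) ^ 2) : √(x ^ 4 + y) ≤ (D + D') * w := by
  have h0 := sq_nonneg x
  apply Real.sqrt_le_iff.2
  constructor
  · nlinarith [mul_nonneg hD' hw]
  · have h1 : x ^ 4 ≤ (D * w) ^ 2 := by
      rw [show x ^ 4 = (x ^ 2) ^ 2 by ring]
      gcongr
    nlinarith [mul_nonneg hD' hw]

theorem mul_rpow_natCast {η : ℝ} {n : ℕ} (hn : 0 < n) :
    (n : ℝ) * (n : ℝ) ^ (-η) = (n : ℝ) ^ (1 - η) := by
  rw [sub_eq_add_neg, Real.rpow_add (by exact_mod_cast hn), Real.rpow_one]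

variable {Ω : Type*} [MeasurableSpace Ω] {P : Measure Ω} [IsProbabilityMeasure P]
  {X : ℕ → Ω → EuclideanSpace ℝ (Fin 1)} {Z : ℕ → Ω → ℝ}
  {K : EuclideanSpace ℝ (Fin 1) → ℝ}
  {fX m₁ m₂ : EuclideanSpace ℝ (Fin 1) → ℝ} {x₀ x₁ : EuclideanSpace ℝ (Fin 1)} {lam : ℝ}
  {σ₁ σ₂ : NNReal} {δ : ℝ}

/-- The choice of t makes exp(σ₁²t²) = n^ε, which offsets the gain in 1/(nh) and leaves the variance
n^(-4/5). The squared bias parameter (th)² is O(n^(-η)) with η = 1/5 - ε, and with ν = δ/4 the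
second component contributes n^(-ξ); the smaller of ξ and η is the rate. -/
theorem exists_isBigOP_slopeHat₁_rpow (hK : IsRegularKernel K)
    (hmodel : RegularModel fX m₁ m₂ x₀ x₁) (hlam : 0 < lam) (hlam_le : lam ≤ 1)
    (hsample : IsMixtureSample P X Z fX lam m₁ m₂ (gaussianReal 0 (σ₁ ^ 2))
      (gaussianReal 0 (σ₂ ^ 2)))
    (hδ : δ = (σ₁ : ℝ) ^ 2 - (σ₂ : ℝ) ^ 2) (hσ : σ₂ < σ₁) (hδ0 : 0 < δ)
    {ε : ℝ} (hε : 0 < ε) (hε5 : ε < 1 / 5) :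
    ∃ γ : ℝ, 0 < γ ∧ IsBigOP P
      (fun n ω => slopeHat₁ K X Z x₀ x₁ n ((n : ℝ) ^ (-(1 / 5) + ε))
        (1 / (σ₁ : ℝ) * √(ε * Real.log n)) ω - (m₁ x₁ - m₁ x₀))
      (fun n => (n : ℝ) ^ (-γ)) := by
  have hσ₁ : (0 : ℝ) < σ₁ := by exact_mod_cast (show 0 ≤ σ₂ from zero_le).trans_lt hσ
  obtain ⟨η, hη, hη5, heq⟩ : ∃ η : ℝ, 0 < η ∧ η < 1 / 5 ∧ -(1 / 5) + ε = -η :=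
    ⟨1 / 5 - ε, by linarith, by linarith, by ring⟩
  rw [heq]
  have hvareq : ∀ n : ℕ, 0 < n → 1 / ((n : ℝ) * ((n : ℝ) ^ (-η)) ^ 1) *
      Real.exp ((σ₁ : ℝ) ^ 2 * (1 / (σ₁ : ℝ) * √(ε * Real.log n)) ^ 2) =
      (n : ℝ) ^ (-(4 / 5 : ℝ)) := by
    intro n hn
    have hn' : (0 : ℝ) < n := by exact_mod_cast hn
    rw [pow_one, mul_rpow_natCast hn, exp_mul_sq_inv_mul_sqrt_log hε _ hn, one_div,
      ← Real.rpow_neg hn'.le, ← Real.rpow_add hn']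
    congr 1
    field_simp
    linarith
  have hmain := isBigOP_slopeHat₁_gaussianReal hK hmodel hlam hlam_le hsample hδ
    (ν := δ / 4) (by linarith) (by linarith) (h := fun n => (n : ℝ) ^ (-η))
    (t := fun n => 1 / (σ₁ : ℝ) * √(ε * Real.log n))
    ((eventually_gt_atTop 0).mono fun n hn => by
      have hn' : (0 : ℝ) < n := by exact_mod_cast hn
      positivity)
    (tendsto_inv_mul_sqrt_log hσ₁ hε) (tendsto_sqrt_log_mul_rpow hε hη)
    ((tendsto_natCast_rpow_neg (by norm_num)).congr' ((eventually_gt_atTop 0).mono fun n hn =>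
      (hvareq n hn).symm))
  set ξ := δ / 4 * (ε / (σ₁ : ℝ) ^ 2) with hξ
  have hξ0 : 0 < ξ := by positivity
  refine ⟨min ξ η, lt_min hξ0 hη, hmain.mono (1 + (ε / (σ₁ : ℝ) ^ 2 / η + 1)) ?_⟩
  filter_upwards [eventually_gt_atTop 0,
    (tendsto_inv_mul_sqrt_log hσ₁ hε).eventually_ge_atTop 1] with n hn h1
  have hn' : (0 : ℝ) < n := by exact_mod_cast hn
  have hn1 : (1 : ℝ) ≤ n := by exact_mod_cast hn
  have hw : (n : ℝ) ^ (-η) ≤ (n : ℝ) ^ (-(min ξ η)) :=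
    Real.rpow_le_rpow_of_exponent_le hn1 (neg_le_neg (min_le_right _ _))
  have hw' : (n : ℝ) ^ (-ξ) ≤ (n : ℝ) ^ (-(min ξ η)) :=
    Real.rpow_le_rpow_of_exponent_le hn1 (neg_le_neg (min_le_left _ _))
  rw [hvareq n hn, exp_mul_sq_inv_mul_sqrt_log hε _ hn,
    show -(δ / 2 - δ / 4) * (ε / (σ₁ : ℝ) ^ 2) = -ξ by rw [hξ]; ring]
  have hsq := sqrt_pow_four_add_le (w := (n : ℝ) ^ (-η)) (D' := 1) (by positivity) zero_le_one
    (sq_mul_rpow_le (σ := σ₁) hε hη hn) (y := (n : ℝ) ^ (-(4 / 5 : ℝ))) (by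
      rw [one_mul, ← Real.rpow_natCast, ← Real.rpow_mul hn'.le]
      apply Real.rpow_le_rpow_of_exponent_le hn1
      push_cast
      linarith)
  rw [abs_of_nonneg (by positivity), abs_of_nonneg (by positivity), add_mul, one_mul]
  calc _ ≤ 1 * ((n : ℝ) ^ (-ξ) + √((1 / (σ₁ : ℝ) * √(ε * Real.log n) * (n : ℝ) ^ (-η)) ^ 4 +
        (n : ℝ) ^ (-(4 / 5 : ℝ)))) := by
        gcongr
        rw [div_le_one (by linarith)]
        exact h1
    _ ≤ _ := by
        rw [one_mul]
        refine add_le_add hw' (hsq.trans ?_)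
        gcongr

theorem exists_isBigOP_slopeHat₂_rpow (hK : IsRegularKernel K)
    (hmodel : RegularModel fX m₁ m₂ x₀ x₁) (hlam : 0 < lam) (hlam_lt : lam < 1)
    (hsample : IsMixtureSample P X Z fX lam m₁ m₂ (gaussianReal 0 (σ₁ ^ 2))
      (gaussianReal 0 (σ₂ ^ 2)))
    (hδ : δ = (σ₁ : ℝ) ^ 2 - (σ₂ : ℝ) ^ 2) (hσ₂ : 0 < σ₂) (hδ0 : 0 < δ)
    {β : ℝ} (hβ : 0 < β) (hβ5 : β < 1 / 5) {a : ℝ} (ha : 0 < a)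
    (haπ : a * |m₂ x₁ - m₂ x₀| < Real.pi) :
    ∃ γ : ℝ, 0 < γ ∧ IsBigOP P
      (fun n ω => slopeHat₂ K X Z x₀ x₁ n ((n : ℝ) ^ (-(1 / 5) + β))
        (1 / (σ₂ : ℝ) * √(β * Real.log n)) a ω - ((m₂ x₁ - m₂ x₀ : ℝ) : ℂ))
      (fun n => (n : ℝ) ^ (-γ)) := by
  have hσ₂' : (0 : ℝ) < σ₂ := by exact_mod_cast hσ₂
  obtain ⟨η, hη, hη5, heq⟩ : ∃ η : ℝ, 0 < η ∧ η < 1 / 5 ∧ -(1 / 5) + β = -η :=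
    ⟨1 / 5 - β, by linarith, by linarith, by ring⟩
  rw [heq]
  have hmain := isBigOP_slopeHat₂_gaussianReal hK hmodel hlam hlam_lt hsample hδ hδ0
    (b := fun n => (n : ℝ) ^ (-η)) (s := fun n => 1 / (σ₂ : ℝ) * √(β * Real.log n))
    ((eventually_gt_atTop 0).mono fun n hn => by
      have hn' : (0 : ℝ) < n := by exact_mod_cast hn
      positivity) (tendsto_natCast_rpow_neg hη)
    (((tendsto_rpow_atTop (show 0 < 1 - η by linarith)).comp
      tendsto_natCast_atTop_atTop).congr' ((eventually_gt_atTop 0).mono fun n hn => by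
        simp only [pow_one, mul_rpow_natCast hn, Function.comp]))
    (tendsto_inv_mul_sqrt_log hσ₂' hβ) (tendsto_sqrt_log_mul_rpow hβ hη) ha haπ
  set ξ := 1 / 2 * δ * (β / (σ₂ : ℝ) ^ 2) with hξ
  have hξ0 : 0 < ξ := by positivity
  refine ⟨min ξ η, lt_min hξ0 hη,
    hmain.mono (1 + (β / (σ₂ : ℝ) ^ 2 / η + Real.exp ((σ₂ : ℝ) ^ 2 * a ^ 2))) ?_⟩
  filter_upwards [eventually_gt_atTop 0] with n hn
  have hn' : (0 : ℝ) < n := by exact_mod_cast hn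
  have hn1 : (1 : ℝ) ≤ n := by exact_mod_cast hn
  have hw : (n : ℝ) ^ (-η) ≤ (n : ℝ) ^ (-(min ξ η)) :=
    Real.rpow_le_rpow_of_exponent_le hn1 (neg_le_neg (min_le_right _ _))
  have hw' : (n : ℝ) ^ (-ξ) ≤ (n : ℝ) ^ (-(min ξ η)) :=
    Real.rpow_le_rpow_of_exponent_le hn1 (neg_le_neg (min_le_left _ _))
  have hvar : 1 / ((n : ℝ) * ((n : ℝ) ^ (-η)) ^ 1) *
      Real.exp ((σ₂ : ℝ) ^ 2 * (1 / (σ₂ : ℝ) * √(β * Real.log n) + a) ^ 2) ≤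
      (Real.exp ((σ₂ : ℝ) ^ 2 * a ^ 2) * (n : ℝ) ^ (-η)) ^ 2 := by
    have h1 : Real.exp ((σ₂ : ℝ) ^ 2 * (1 / (σ₂ : ℝ) * √(β * Real.log n) + a) ^ 2) ≤
        (n : ℝ) ^ (2 * β) * Real.exp ((σ₂ : ℝ) ^ 2 * a ^ 2) ^ 2 := by
      have e := exp_mul_sq_inv_mul_sqrt_log (σ := σ₂) hβ (2 * (σ₂ : ℝ) ^ 2) hn
      rw [show 2 * (σ₂ : ℝ) ^ 2 * (β / (σ₂ : ℝ) ^ 2) = 2 * β by field_simp] at e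
      rw [← e, ← Real.exp_nat_mul, ← Real.exp_add, Real.exp_le_exp]
      push_cast
      -- Separating the shift a in this crude way costs n^(2β) instead of n^β, which is affordable:
      -- -(1 - η) + 2β ≤ -2η for η = 1/5 - β.
      have h2 : (1 / (σ₂ : ℝ) * √(β * Real.log n) + a) ^ 2 ≤
          2 * (1 / (σ₂ : ℝ) * √(β * Real.log n)) ^ 2 + 2 * a ^ 2 := by
        nlinarith [sq_nonneg (1 / (σ₂ : ℝ) * √(β * Real.log n) - a)]
      nlinarith [mul_le_mul_of_nonneg_left h2 (sq_nonneg (σ₂ : ℝ))]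
    rw [pow_one, mul_rpow_natCast hn, one_div, ← Real.rpow_neg hn'.le]
    calc (n : ℝ) ^ (-(1 - η)) * Real.exp ((σ₂ : ℝ) ^ 2 * (1 / (σ₂ : ℝ) * √(β * Real.log n) + a) ^ 2)
        ≤ (n : ℝ) ^ (-(1 - η)) * ((n : ℝ) ^ (2 * β) * Real.exp ((σ₂ : ℝ) ^ 2 * a ^ 2) ^ 2) := by
          gcongr
      _ = Real.exp ((σ₂ : ℝ) ^ 2 * a ^ 2) ^ 2 * (n : ℝ) ^ (-(1 - η) + 2 * β) := by
          rw [Real.rpow_add hn']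
          ring
      _ ≤ Real.exp ((σ₂ : ℝ) ^ 2 * a ^ 2) ^ 2 * (n : ℝ) ^ (-η * (2 : ℕ)) := by
          refine mul_le_mul_of_nonneg_left (Real.rpow_le_rpow_of_exponent_le hn1 ?_) (by positivity)
          push_cast
          linarith
      _ = _ := by rw [Real.rpow_mul hn'.le, Real.rpow_natCast, mul_pow]
  have hsx := sq_mul_rpow_le (σ := σ₂) hβ hη hn
  rw [mul_comm (1 / (σ₂ : ℝ) * √(β * Real.log n))] at hsx
  have hsq := sqrt_pow_four_add_le (w := (n : ℝ) ^ (-η)) (by positivity) (Real.exp_pos _).le hsx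
    hvar
  rw [exp_mul_sq_inv_mul_sqrt_log hβ _ hn,
    show -(1 / 2) * δ * (β / (σ₂ : ℝ) ^ 2) = -ξ by rw [hξ]; ring,
    abs_of_nonneg (by positivity), abs_of_nonneg (by positivity), add_mul, one_mul]
  refine add_le_add hw' (hsq.trans ?_)
  gcongr

end PolynomialRates

end

theorem mainTheorem8 {Ω : Type*} [MeasurableSpace Ω] (P : Measure Ω) [IsProbabilityMeasure P]
    {k : ℕ} (K : EuclideanSpace ℝ (Fin k) → ℝ) (hK : IsRegularKernel K)
    (fX m₁ m₂ : EuclideanSpace ℝ (Fin k) → ℝ) (x₀ x₁ : EuclideanSpace ℝ (Fin k))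
    (hmodel : RegularModel fX m₁ m₂ x₀ x₁)
    (lam : ℝ) (hlam_pos : 0 < lam) (hlam_le : lam ≤ 1)
    (F₁ F₂ : Measure ℝ) [IsProbabilityMeasure F₁] [IsProbabilityMeasure F₂]
    (X : ℕ → Ω → EuclideanSpace ℝ (Fin k)) (Z : ℕ → Ω → ℝ)
    (hsample : IsMixtureSample P X Z fX lam m₁ m₂ F₁ F₂) :
    -- general error distributions
    (∀ (h b t s a : ℕ → ℝ) (μ f : ℝ → ℝ),
      TuningConditions k h b t s → (∀ᶠ n in atTop, a n ≠ 0) → Tendsto a atTop (𝓝 0) →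
      RatioRates F₁ F₂ μ f →
      (Tendsto (fun n : ℕ => 1 / ((n : ℝ) * h n ^ k) *
            (mgf id F₁ (2 * t n) / mgf id F₁ (t n) ^ 2)) atTop (𝓝 0) →
        IsBigOP P (fun n ω => slopeHat₁ K X Z x₀ x₁ n (h n) (t n) ω - (m₁ x₁ - m₁ x₀))
          (fun n => μ (t n) / t n + 1 / t n *
            √((t n * h n) ^ 4 + 1 / ((n : ℝ) * h n ^ k) *
              (mgf id F₁ (2 * t n) / mgf id F₁ (t n) ^ 2)))) ∧
      (lam < 1 →
        IsBigOP P
          (fun n ω => slopeHat₂ K X Z x₀ x₁ n (b n) (s n) (a n) ω - ((m₂ x₁ - m₂ x₀ : ℝ) : ℂ))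
          (fun n => 1 / |a n| *
            (f (s n + a n) + f (s n)
              + √((b n * s n) ^ 4 + 1 / ((n : ℝ) * b n ^ k * ‖charFun F₂ (s n + a n)‖ ^ 2))
              + √((b n * s n) ^ 4 + 1 / ((n : ℝ) * b n ^ k * ‖charFun F₂ (s n)‖ ^ 2)))))) ∧
    -- normal errors
    (∀ σ₁ σ₂ : NNReal, 0 < σ₂ → σ₂ < σ₁ →
      F₁ = gaussianReal 0 (σ₁ ^ 2) → F₂ = gaussianReal 0 (σ₂ ^ 2) →
      ∀ δ : ℝ, δ = (σ₁ : ℝ) ^ 2 - (σ₂ : ℝ) ^ 2 →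
      -- the conditions on the error distributions hold, and the bounds become explicit
      (∀ ν : ℝ, 0 < ν → ν < δ / 2 →
        RatioRates F₁ F₂ (fun t => Real.exp (-(δ / 2 - ν) * t ^ 2))
          (fun s => Real.exp (-(1 / 2) * δ * s ^ 2)) ∧
        ∀ h b t s : ℕ → ℝ, TuningConditions k h b t s →
          (Tendsto (fun n : ℕ => 1 / ((n : ℝ) * h n ^ k) *
              Real.exp ((σ₁ : ℝ) ^ 2 * t n ^ 2)) atTop (𝓝 0) →
            IsBigOP P (fun n ω => slopeHat₁ K X Z x₀ x₁ n (h n) (t n) ω - (m₁ x₁ - m₁ x₀))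
              (fun n => 1 / t n * (Real.exp (-(δ / 2 - ν) * t n ^ 2) +
                √((t n * h n) ^ 4 + 1 / ((n : ℝ) * h n ^ k) *
                  Real.exp ((σ₁ : ℝ) ^ 2 * t n ^ 2))))) ∧
          (lam < 1 → ∀ a : ℝ, 0 < a → a * |m₂ x₁ - m₂ x₀| < Real.pi →
            IsBigOP P
              (fun n ω => slopeHat₂ K X Z x₀ x₁ n (b n) (s n) a ω - ((m₂ x₁ - m₂ x₀ : ℝ) : ℂ))
              (fun n => Real.exp (-(1 / 2) * δ * s n ^ 2) +
                √((b n * s n) ^ 4 + 1 / ((n : ℝ) * b n ^ k) *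
                  Real.exp ((σ₂ : ℝ) ^ 2 * (s n + a) ^ 2))))) ∧
      -- polynomial rates for a suitable choice of the tuning parameters
      (k = 1 → ∀ ε β : ℝ, 0 < ε → ε < 1 / 5 → 0 < β → β < 1 / 5 →
        (∃ γ : ℝ, 0 < γ ∧
          IsBigOP P
            (fun n ω => slopeHat₁ K X Z x₀ x₁ n ((n : ℝ) ^ (-(1 / 5) + ε))
              (1 / (σ₁ : ℝ) * √(ε * Real.log n)) ω - (m₁ x₁ - m₁ x₀))
            (fun n => (n : ℝ) ^ (-γ))) ∧
        (lam < 1 → ∀ a : ℝ, 0 < a → a * |m₂ x₁ - m₂ x₀| < Real.pi →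
          ∃ γ : ℝ, 0 < γ ∧
            IsBigOP P
              (fun n ω => slopeHat₂ K X Z x₀ x₁ n ((n : ℝ) ^ (-(1 / 5) + β))
                (1 / (σ₂ : ℝ) * √(β * Real.log n)) a ω - ((m₂ x₁ - m₂ x₀ : ℝ) : ℂ))
              (fun n => (n : ℝ) ^ (-γ))))) := by
  refine ⟨fun h b t s a μ f hT ha ha0 hR => ⟨fun hvar => ?_, fun hlam_lt => ?_⟩, ?_⟩
  · exact isBigOP_slopeHat₁ hK hmodel hlam_pos hlam_le hsample hT.h_pos hT.t_top hT.th_zero hR hvar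
  · have hκ : Tendsto (fun n => |a n * (m₂ x₁ - m₂ x₀)|) atTop (𝓝 0) := by
      simpa using (ha0.mul_const (m₂ x₁ - m₂ x₀)).abs
    have hA : Tendsto (fun n => |a n|) atTop (𝓝 0) := by simpa using ha0.abs
    -- Since a tends to 0, the phase is eventually at most 1 < π, so no condition linking a and the
    -- slope is required.
    exact isBigOP_slopeHat₂ hK hmodel hlam_pos hlam_lt hsample hT.b_pos hT.b_zero hT.nb_top hT.s_top
      hT.sb_zero ha (hA.eventually_le_const one_pos)
      (κ := 1) (by linarith [Real.pi_gt_three]) (hκ.eventually_le_const one_pos) hR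
  · rintro σ₁ σ₂ hσ₂ hσ rfl rfl δ hδ
    have hδ0 : 0 < δ := by
      have h1 : (σ₂ : ℝ) < σ₁ := by exact_mod_cast hσ
      have h2 : (0 : ℝ) < σ₂ := by exact_mod_cast hσ₂
      nlinarith
    refine ⟨fun ν hν hνδ => ⟨ratioRates_gaussianReal hδ hν hνδ, fun h b t s hT =>
      ⟨fun hvar => ?_, fun hlam_lt a ha haπ => ?_⟩⟩, ?_⟩
    · exact isBigOP_slopeHat₁_gaussianReal hK hmodel hlam_pos hlam_le hsample hδ hν hνδ hT.h_pos
        hT.t_top hT.th_zero hvar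
    · exact isBigOP_slopeHat₂_gaussianReal hK hmodel hlam_pos hlam_lt hsample hδ hδ0 hT.b_pos
        hT.b_zero hT.nb_top hT.s_top hT.sb_zero ha haπ
    · rintro rfl ε β hε hε5 hβ hβ5
      exact ⟨exists_isBigOP_slopeHat₁_rpow hK hmodel hlam_pos hlam_le hsample hδ hσ hδ0 hε hε5,
        fun hlam_lt a ha haπ => exists_isBigOP_slopeHat₂_rpow hK hmodel hlam_pos hlam_lt hsample hδ
          hσ₂ hδ0 hβ hβ5 ha haπ⟩
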